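/- Let $0<\alpha<1$, $1<p<1/\alpha$, $q=\frac{p}{1-\alpha p}$ and $p'=\frac{p}{p-1}$. A weight is a locally integrable function $w:\mathbb R\to\mathbb R$ that is positive almost everywhere. Put $$\|w\|_{A^-_{p,q}}=\sup_{x\in\mathbb R,\,h>0}\Big(\frac1h\int_x^{x+h}w^q\Big)\Big(\frac1h\int_{x-h}^x w^{-p'}\Big)^{q/p'},\qquad \|w\|_{A^+_{p,q}}=\sup_{x\in\mathbb R,\,h>0}\Big(\frac1h\int_{x-h}^x w^q\Big)\Big(\frac1h\int_x^{x+h} w^{-p'}\Big)^{q/p'},$$ and write $w\in A^{\mp}_{p,q}$ if $w$ is a weight and the corresponding quantity is finite. Let $$\mathcal R_\alpha f(x)=\int_{-\infty}^x\frac{f(t)}{(x-t)^{1-\alpha}}\,dt,\qquad \mathcal W_\alpha f(x)=\int_x^\infty\frac{f(t)}{(t-x)^{1-\alpha}}\,dt .$$ For a nonnegative function $v$ let $L^r_v$ be the space of measurable $f:\mathbb R\to\mathbb R$ with $\|f\|_{L^r_v}=\big(\int_{\mathbb R}|f|^r v\,dx\big)^{1/r}<\infty$, and write $\|T\|_{L^p_u\to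 L^q_v}=\sup\{\|Tf\|_{L^q_v}:\|f\|_{L^p_u}\le1\}$. Set $\beta=(1-\alpha)\max\{1,p'/q\}$. Then: (a) There is a constant $c>0$ depending only on $p$ and $\alpha$ such that, for every $w\in A^-_{p,q}$ and every $f\in L^p_{w^p}$, the integral $\mathcal R_\alpha f(x)$ converges absolutely for almost every $x$, $\mathcal R_\alpha f\in L^q_{w^q}$, and $$\|\mathcal R_\alpha\|_{L^p_{w^p}\to L^q_{w^q}}\le c\,\|w\|_{A^-_{p,q}}^{\beta}.$$ The exponent $\beta$ is sharp: for no function $\psi:(0,\infty)\to(0,\infty)$ that is non-decreasing with $\psi(t)=o(t^{\beta})$ as $t\to\infty$ is there a constant $c>0$ with $\|\mathcal R_\alpha\|_{L^p_{w^p}\to L^q_{w^q}}\le c\,\psi(\|w\|_{A^-_{p,q}})$ for all $w\in A^-_{p,q}$; and, for every $\delta>0$, $$\sup_{w\in A^-_{p,q}}\frac{\|\mathcal R_\alpha\|_{L^p_{w^p}\to L^q_{w^q}}}{\|w\|_{A^-_{p,q}}^{\beta-\delta}}=\infty .$$ (b) The same statements, including the sharpness of the same exponent $\beta$, hold with $\mathcal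 W_\alpha$ and $A^+_{p,q}$ in place of $\mathcal R_\alpha$ and $A^-_{p,q}$. -/

import Mathlib

open MeasureTheory Set
open scoped ENNReal

noncomputable section

/-- A weight on the real line: an almost everywhere positive locally integrable function. -/
structure IsWeight (w : ℝ → ℝ) : Prop where
  locallyIntegrable : LocallyIntegrable w volume
  ae_pos : ∀ᵐ x ∂(volume : Measure ℝ), 0 < w x

/-- The conjugate exponent `p' = p / (p - 1)`. -/
def conjExp (p : ℝ) : ℝ := p / (p - 1)

/-- The norm `(∫ |f|^p v dx)^(1/p)` of `L^p_v(ℝ)`, as an extended nonnegative number. -/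
def wLpNorm (p : ℝ) (v f : ℝ → ℝ) : ℝ≥0∞ :=
  (∫⁻ x, ENNReal.ofReal (|f x| ^ p * v x)) ^ (1 / p)

/-- `f ∈ L^p_v(ℝ)`: `f` is (Lebesgue) measurable and its weighted norm is finite. -/
def MemWLp (p : ℝ) (v f : ℝ → ℝ) : Prop :=
  AEMeasurable f volume ∧ wLpNorm p v f < ∞

/-- The operator norm of `T : L^p_u(ℝ) → L^q_v(ℝ)`, i.e. the supremum of `‖T f‖` over the unit
ball of `L^p_u(ℝ)`, as an extended nonnegative number. -/
def wOpNorm (T : (ℝ → ℝ) → ℝ → ℝ) (p : ℝ) (u : ℝ → ℝ) (q : ℝ) (v : ℝ → ℝ) : ℝ≥0∞ :=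
  ⨆ (f : ℝ → ℝ) (_ : MemWLp p u f) (_ : wLpNorm p u f ≤ 1), wLpNorm q v (T f)

/-- The left-sided (Riemann-Liouville) potential
`R_α f(x) = ∫_{-∞}^x f(t) (x - t)^(α-1) dt`. -/
def rlPotential (α : ℝ) (f : ℝ → ℝ) (x : ℝ) : ℝ :=
  ∫ t in Iio x, f t / (x - t) ^ (1 - α)

/-- The Weyl transform `W_α f(x) = ∫_x^∞ f(t) (t - x)^(α-1) dt`. -/
def weylPotential (α : ℝ) (f : ℝ → ℝ) (x : ℝ) : ℝ :=
  ∫ t in Ioi x, f t / (t - x) ^ (1 - α)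

/-- The integral defining `R_α f(x)` converges absolutely for almost every `x`. -/
def RLDefined (α : ℝ) (f : ℝ → ℝ) : Prop :=
  ∀ᵐ x ∂(volume : Measure ℝ), IntegrableOn (fun t => f t / (x - t) ^ (1 - α)) (Iio x) volume

/-- The integral defining `W_α f(x)` converges absolutely for almost every `x`. -/
def WeylDefined (α : ℝ) (f : ℝ → ℝ) : Prop :=
  ∀ᵐ x ∂(volume : Measure ℝ), IntegrableOn (fun t => f t / (t - x) ^ (1 - α)) (Ioi x) volume

/-- The `A_{p,q}^+(ℝ)` characteristic: the supremum over `x ∈ ℝ`, `h > 0` of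
`(1/h ∫_{x-h}^x w^q) (1/h ∫_x^{x+h} w^{-p'})^{q/p'}`. -/
def charPlus (p q : ℝ) (w : ℝ → ℝ) : ℝ≥0∞ :=
  ⨆ (x : ℝ) (h : ℝ) (_ : 0 < h),
    (ENNReal.ofReal (1 / h) * ∫⁻ t in Ioc (x - h) x, ENNReal.ofReal (w t ^ q)) *
    (ENNReal.ofReal (1 / h) *
      ∫⁻ t in Ioc x (x + h), ENNReal.ofReal (w t ^ (-conjExp p))) ^ (q / conjExp p)

/-- The `A_{p,q}^-(ℝ)` characteristic: the supremum over `x ∈ ℝ`, `h > 0` of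
`(1/h ∫_x^{x+h} w^q) (1/h ∫_{x-h}^x w^{-p'})^{q/p'}`. -/
def charMinus (p q : ℝ) (w : ℝ → ℝ) : ℝ≥0∞ :=
  ⨆ (x : ℝ) (h : ℝ) (_ : 0 < h),
    (ENNReal.ofReal (1 / h) * ∫⁻ t in Ioc x (x + h), ENNReal.ofReal (w t ^ q)) *
    (ENNReal.ofReal (1 / h) *
      ∫⁻ t in Ioc (x - h) x, ENNReal.ofReal (w t ^ (-conjExp p))) ^ (q / conjExp p)

/-- `w ∈ A_{p,q}^+(ℝ)`. -/
def MemAPlus (p q : ℝ) (w : ℝ → ℝ) : Prop := IsWeight w ∧ charPlus p q w < ∞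

/-- `w ∈ A_{p,q}^-(ℝ)`. -/
def MemAMinus (p q : ℝ) (w : ℝ → ℝ) : Prop := IsWeight w ∧ charMinus p q w < ∞

/-- Sharpness of the exponent `β` in a bound `N w ≤ c * (K w) ^ β` over all `w ∈ A`: the power
`(K w) ^ β` cannot be replaced, with any constant, by `ψ (K w)` for a positive non-decreasing
function `ψ` growing slower than `t ^ β`; and `sup_w N w / (K w) ^ (β - δ) = ∞` for all `δ > 0`. -/
def IsSharpExponent (A : (ℝ → ℝ) → Prop) (N K : (ℝ → ℝ) → ℝ≥0∞) (β : ℝ) : Prop :=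
  (∀ ψ : ℝ → ℝ, (∀ t, 0 < t → 0 < ψ t) → MonotoneOn ψ (Ioi 0) →
    Asymptotics.IsLittleO Filter.atTop ψ (fun t : ℝ => t ^ β) →
    ¬ ∃ c : ℝ, 0 < c ∧ ∀ w, A w → N w ≤ ENNReal.ofReal (c * ψ (K w).toReal)) ∧
  (∀ δ : ℝ, 0 < δ → (⨆ (w : ℝ → ℝ) (_ : A w), N w / K w ^ (β - δ)) = ∞)

end

/-!
Throughout `q / p = 1 + α q`, `s = q / p'`, `dμ = w ^ q dx`, `dν = w ^ (-p') dx`, and `K` is the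
one-sided characteristic of `w`.

*Upper bound.* Writing `f = φ w ^ (-p')` and dualizing, one has to bound the form
`∬_{t < x} (x - t) ^ (α - 1) φ(t) g(x) dν(t) dμ(x)` by `K ^ β ‖φ‖_{L^p(ν)} ‖g‖_{L^{q'}(μ)}`.  Two
points `t < x` are separated by the two halves of the smallest dyadic interval that contains both.
By the one-third trick, with two grids this interval can be taken of length comparable with
`x - t`, so the form is controlled by sums over dyadic `Q` of
`|Q| ^ (α - 1) ∫_{left Q} φ dν ∫_{right Q} g dμ` (`kernel_le`).  Only pairs of adjacent intervals
`left Q`, `right Q` occur, and these are exactly the pairs on which the one-sided characteristic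
gives information.

For each `Q` let `F Q` be the smallest interval whose left half contains `left Q` and on which the
average of `φ` is a record, i.e. larger (on a dyadic logarithmic scale) than on all larger
intervals, and let `G Q` be the analogous interval for `g` and right halves.  Replacing the averages
of `φ` and `g` by the ones on `F Q` and `G Q` costs a constant, and the `L^p` norms control the
records by a Carleson embedding (`carleson_embedding`).  Either `F Q = G Q = Q`, where Hölder's
inequality suffices (`diagonal_part`), or one of the stopping intervals determines the other and
the sum reduces to testing the operator on the indicator of a half interval (`corona_part`).

The testing condition (`testing`) is where the exponent comes from: the sum of
`|Q| ^ (α - 1) ν(left Q)` through a point is replaced by a sum over the records of the averages of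
`ν`, one power of `K` bounds the local terms, and a power `K ^ (1 / s)` bounds the sum of the masses
of the records, since the condition on the weight dominates the averages of `ν` by averages of
`dx / dμ`.  This gives `K ^ ((1 + 1 / s) / q)`, and the testing condition of the dual operator gives
`K ^ ((1 + s) / q)`; as `(1 + s) / q = 1 - α`, the larger of the two is `K ^ β`.  Finally `K ≥ 1`
by Lebesgue's differentiation theorem, which allows the smaller powers to be absorbed.

*Sharpness.* Power weights `|x| ^ γ` suffice: one of `w ^ q`, `w ^ (-p')` is `|x| ^ (δ - 1)` with
`δ → 0`.  Then `K` is at most a multiple of `δ ^ (-1)`, respectively `δ ^ (-s)`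
(`charMinus_abs_rpow_le`), whereas explicit test functions show that the operator norm is at least a
multiple of `δ ^ (-(1 - α))` (`exists_extremal_of_ge`, `exists_extremal_of_le`).

*The Weyl transform* is the conjugate of the Riemann-Liouville potential by the reflection `x ↦ -x`,
which exchanges the two classes of weights.
-/

/-! ### Powers of two and dyadic levels in `ℝ≥0∞` -/

/-- The power `2 ^ t` as an extended nonnegative number; every positive finite quantity below is
written in this form, which makes inequalities between monomials linear in the exponents. -/
noncomputable def pow2 (t : ℝ) : ℝ≥0∞ := (2 : ℝ≥0∞) ^ t

theorem pow2_ne_zero (t : ℝ) : pow2 t ≠ 0 := by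
  simp [pow2, ENNReal.rpow_eq_zero_iff]

theorem pow2_ne_top (t : ℝ) : pow2 t ≠ ∞ := by
  simp [pow2, ENNReal.rpow_eq_top_iff]

theorem pow2_zero : pow2 0 = 1 := by simp [pow2]

theorem pow2_one : pow2 1 = 2 := by simp [pow2]

theorem pow2_add (a b : ℝ) : pow2 (a + b) = pow2 a * pow2 b :=
  ENNReal.rpow_add _ _ (by simp) (by simp)

theorem pow2_rpow (a b : ℝ) : pow2 a ^ b = pow2 (a * b) := (ENNReal.rpow_mul _ _ _).symm

theorem pow2_le {a b : ℝ} : pow2 a ≤ pow2 b ↔ a ≤ b := by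
  refine ⟨fun h => ?_, fun h => ENNReal.rpow_le_rpow_of_exponent_le (by norm_num) h⟩
  by_contra! hlt
  exact absurd h (not_le.2 (ENNReal.rpow_lt_rpow_of_exponent_lt (by norm_num) (by simp) hlt))

theorem exists_pow2 {x : ℝ≥0∞} (h0 : x ≠ 0) (h1 : x ≠ ∞) : ∃ t, x = pow2 t := by
  refine ⟨Real.logb 2 x.toReal, ?_⟩
  have hx : 0 < x.toReal := ENNReal.toReal_pos h0 h1
  have : (2 : ℝ≥0∞) = ENNReal.ofReal 2 := by simp
  rw [pow2, this, ENNReal.ofReal_rpow_of_pos (by norm_num),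
    Real.rpow_logb (by norm_num) (by norm_num) hx, ENNReal.ofReal_toReal h1]

theorem ofReal_two_zpow (k : ℤ) : ENNReal.ofReal ((2 : ℝ) ^ k) = pow2 k := by
  rw [← Real.rpow_intCast, ← ENNReal.ofReal_rpow_of_pos (by norm_num)]
  simp [pow2]

/-- The sum of the geometric series with ratio `2 ^ (-c)`. -/
noncomputable def geomConst (c : ℝ) : ℝ≥0∞ := (1 - pow2 (-c))⁻¹

theorem geomConst_ne_top {c : ℝ} (hc : 0 < c) : geomConst c ≠ ∞ := by
  have : pow2 (-c) < 1 := by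
    rw [← pow2_zero]
    exact ENNReal.rpow_lt_rpow_of_exponent_lt (by norm_num) (by simp) (by linarith)
  rw [geomConst, ENNReal.inv_ne_top]
  exact (tsub_pos_of_lt this).ne'

/-- A sum of powers `2 ^ (c k)` over distinct integers `k ≤ N` is comparable to its top term. -/
theorem sum_pow2_le {ι : Type*} (s : Finset ι) (lev : ι → ℤ) {c : ℝ}
    (hinj : ∀ i ∈ s, ∀ j ∈ s, lev i = lev j → i = j) (N : ℤ) (hN : ∀ i ∈ s, lev i ≤ N) :
    ∑ i ∈ s, pow2 (c * lev i) ≤ geomConst c * pow2 (c * N) := by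
  classical
  have h1 : ∀ i ∈ s, pow2 (c * lev i) = pow2 (-c) ^ (N - lev i).toNat * pow2 (c * N) := by
    intro i hi
    have h2 : (((N - lev i).toNat : ℤ) : ℝ) = ((N - lev i : ℤ) : ℝ) := by
      rw [Int.toNat_of_nonneg (sub_nonneg.2 (hN i hi))]
    rw [← ENNReal.rpow_natCast, pow2_rpow, ← pow2_add]
    congr 1
    rw [Int.cast_natCast] at h2
    rw [h2]; push_cast; ring
  rw [Finset.sum_congr rfl h1, ← Finset.sum_mul, geomConst, ← ENNReal.tsum_geometric]
  gcongr
  have h3 : ∑ i ∈ s, pow2 (-c) ^ (N - lev i).toNat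
      = ∑ n ∈ s.image fun i => (N - lev i).toNat, pow2 (-c) ^ n := by
    rw [Finset.sum_image]
    intro i hi j hj hij
    have a := hN i hi
    have b := hN j hj
    have hij' : (N - lev i).toNat = (N - lev j).toNat := hij
    exact hinj i hi j hj (by omega)
  rw [h3]
  exact ENNReal.sum_le_tsum _

theorem sum_pow2_le_of_ge {ι : Type*} (s : Finset ι) (lev : ι → ℤ) {c : ℝ}
    (hinj : ∀ i ∈ s, ∀ j ∈ s, lev i = lev j → i = j) (N : ℤ) (hN : ∀ i ∈ s, N ≤ lev i) :
    ∑ i ∈ s, pow2 (-c * lev i) ≤ geomConst c * pow2 (-c * N) := by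
  have := sum_pow2_le s (fun i => -lev i) (c := c)
    (fun i hi j hj h => hinj i hi j hj (by simpa using h)) (-N) (fun i hi => by
      have := hN i hi; omega)
  simpa using this

/-- Hölder's inequality for exponents with `1 / a + 1 / b ≥ 1`. -/
theorem sum_rpow_mul_rpow_le {ι : Type*} (s : Finset ι) (x y : ι → ℝ≥0∞) {a b : ℝ}
    (ha : 1 < a) (hb : 0 < b) (hab : 1 ≤ 1 / a + 1 / b) :
    ∑ i ∈ s, x i ^ (1 / a) * y i ^ (1 / b) ≤
      (∑ i ∈ s, x i) ^ (1 / a) * (∑ i ∈ s, y i) ^ (1 / b) := by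
  have hc : a.HolderConjugate a.conjExponent := Real.HolderConjugate.conjExponent ha
  set c := a.conjExponent
  have hc0 : 0 < c := hc.symm.pos
  have hsum := hc.inv_add_inv_eq_one
  have hcb : 1 ≤ c / b := by
    have : c⁻¹ ≤ b⁻¹ := by
      have := hab; simp only [one_div] at this; linarith
    rw [le_div_iff₀ hb, one_mul]
    exact (inv_le_inv₀ hc0 hb).1 this
  have := ENNReal.inner_le_Lp_mul_Lq s (fun i => x i ^ (1 / a)) (fun i => y i ^ (1 / b)) hc
  refine this.trans ?_
  have e1 : ∀ i, (x i ^ (1 / a)) ^ a = x i := fun i => by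
    rw [← ENNReal.rpow_mul, one_div_mul_cancel (by positivity), ENNReal.rpow_one]
  have e2 : ∀ i, (y i ^ (1 / b)) ^ c = y i ^ (c / b) := fun i => by
    rw [← ENNReal.rpow_mul]; congr 1; ring
  simp only [e1, e2]
  gcongr
  have h3 : ∑ i ∈ s, y i ^ (c / b) ≤ (∑ i ∈ s, y i) ^ (c / b) := by
    classical
    induction s using Finset.induction_on with
    | empty => simp
    | insert i s hi ih =>
      rw [Finset.sum_insert hi, Finset.sum_insert hi]
      exact (add_le_add le_rfl (ih (ENNReal.inner_le_Lp_mul_Lq s _ _ hc))).trans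
        (ENNReal.add_rpow_le_rpow_add _ _ hcb)
  refine (ENNReal.rpow_le_rpow h3 (by positivity)).trans ?_
  rw [← ENNReal.rpow_mul]
  refine le_of_eq ?_
  congr 1
  field_simp

/-! ### Laminar families and records -/

/-- A laminar family of sets: two members are disjoint or nested, and the set indexed by `Q` has
Lebesgue measure `2 ^ gen Q`. -/
structure IsLaminar {ι : Type} (B : ι → Set ℝ) (gen : ι → ℤ) : Prop where
  measurableSet : ∀ Q, MeasurableSet (B Q)
  volume_eq : ∀ Q, volume (B Q) = pow2 (gen Q)
  nested : ∀ Q R, Q ≠ R → Disjoint (B Q) (B R) ∨ (B Q ⊆ B R ∧ gen Q < gen R) ∨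
    (B R ⊆ B Q ∧ gen R < gen Q)

namespace IsLaminar

variable {ι : Type} {B : ι → Set ℝ} {gen : ι → ℤ}

theorem nonempty (h : IsLaminar B gen) (Q : ι) : (B Q).Nonempty := by
  rw [nonempty_iff_ne_empty]
  intro h0
  have := h.volume_eq Q
  rw [h0, measure_empty] at this
  exact pow2_ne_zero _ this.symm

theorem gen_le (h : IsLaminar B gen) {Q R : ι} (hs : B Q ⊆ B R) : gen Q ≤ gen R := by
  have := measure_mono (μ := volume) hs
  rw [h.volume_eq, h.volume_eq, pow2_le] at this
  exact_mod_cast this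

theorem gen_lt (h : IsLaminar B gen) {Q R : ι} (hs : B Q ⊆ B R) (hne : Q ≠ R) :
    gen Q < gen R := by
  rcases h.nested Q R hne with h1 | h1 | h1
  · obtain ⟨x, hx⟩ := h.nonempty Q
    exact (Set.disjoint_left.1 h1 hx (hs hx)).elim
  · exact h1.2
  · exact absurd (h.gen_le hs) (not_le.2 h1.2)

theorem eq_of_subset (h : IsLaminar B gen) {Q R : ι} (hs : B Q ⊆ B R) (hs' : B R ⊆ B Q) :
    Q = R := by
  by_contra hne
  have := h.gen_lt hs hne
  have := h.gen_le hs'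
  omega

theorem subset_or (h : IsLaminar B gen) {Q R : ι} {x : ℝ} (hQ : x ∈ B Q) (hR : x ∈ B R) :
    B Q ⊆ B R ∨ B R ⊆ B Q := by
  by_cases hne : Q = R
  · subst hne; exact Or.inl le_rfl
  rcases h.nested Q R hne with h1 | h1 | h1
  · exact (Set.disjoint_left.1 h1 hQ hR).elim
  · exact Or.inl h1.1
  · exact Or.inr h1.1

theorem gen_inj (h : IsLaminar B gen) {Q R : ι} {x : ℝ} (hQ : x ∈ B Q) (hR : x ∈ B R)
    (hg : gen Q = gen R) : Q = R := by
  by_contra hne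
  rcases h.subset_or hQ hR with h1 | h1
  · exact (h.gen_lt h1 hne).ne hg
  · exact (h.gen_lt h1 (Ne.symm hne)).ne hg.symm

end IsLaminar

open Classical in
/-- The records of the level function `lev`: the members of the finite family `𝒬` whose level
exceeds the level of every strictly larger member. -/
noncomputable def records {ι : Type} (B : ι → Set ℝ) (lev : ι → ℤ) (𝒬 : Finset ι) : Finset ι :=
  𝒬.filter fun Q => ∀ R ∈ 𝒬, B Q ⊆ B R → R ≠ Q → lev R < lev Q

section Records

variable {ι : Type} {B : ι → Set ℝ} {gen : ι → ℤ} {lev : ι → ℤ} {𝒬 : Finset ι}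

theorem mem_records {Q : ι} : Q ∈ records B lev 𝒬 ↔
    Q ∈ 𝒬 ∧ ∀ R ∈ 𝒬, B Q ⊆ B R → R ≠ Q → lev R < lev Q := by
  classical
  simp [records]

theorem records_lev_inj (h : IsLaminar B gen) {Q R : ι} (hQ : Q ∈ records B lev 𝒬)
    (hR : R ∈ records B lev 𝒬) {x : ℝ} (hxQ : x ∈ B Q) (hxR : x ∈ B R) (hl : lev Q = lev R) :
    Q = R := by
  rw [mem_records] at hQ hR
  by_contra hne
  rcases h.subset_or hxQ hxR with h1 | h1
  · exact (hQ.2 R hR.1 h1 (Ne.symm hne)).ne hl.symm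
  · exact (hR.2 Q hQ.1 h1 hne).ne hl

theorem records_lev_le {Q R : ι} (hQ : Q ∈ records B lev 𝒬)
    (hR : R ∈ records B lev 𝒬) (hs : B Q ⊆ B R) : lev R ≤ lev Q := by
  rw [mem_records] at hQ hR
  by_cases hne : R = Q
  · rw [hne]
  · exact (hQ.2 R hR.1 hs hne).le

/-- Every member lies in a smallest record, whose level is at least its own. -/
theorem exists_record (h : IsLaminar B gen) {Q : ι} (hQ : Q ∈ 𝒬) :
    ∃ R ∈ records B lev 𝒬, B Q ⊆ B R ∧ lev Q ≤ lev R ∧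
      ∀ R' ∈ records B lev 𝒬, B Q ⊆ B R' → B R ⊆ B R' := by
  classical
  obtain ⟨R, hR, hmax⟩ := Finset.exists_max_image (𝒬.filter fun R => B Q ⊆ B R)
    (fun R => toLex (lev R, gen R)) ⟨Q, by simp [hQ]⟩
  simp only [Finset.mem_filter] at hR hmax
  have hrec : R ∈ records B lev 𝒬 := by
    rw [mem_records]
    refine ⟨hR.1, fun R' hR' hs hne => ?_⟩
    have h1 := hmax R' ⟨hR', hR.2.trans hs⟩
    have h2 := h.gen_lt hs (Ne.symm hne)
    rw [Prod.Lex.toLex_le_toLex] at h1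
    rcases h1 with h1 | h1
    · exact h1
    · simp only at h1; omega
  have hl : lev Q ≤ lev R := by
    have h1 := hmax Q ⟨hQ, le_rfl⟩
    rw [Prod.Lex.toLex_le_toLex] at h1
    rcases h1 with h1 | h1
    · exact le_of_lt h1
    · exact le_of_eq h1.1
  refine ⟨R, hrec, hR.2, hl, fun R' hR' hs => ?_⟩
  obtain ⟨x, hx⟩ := h.nonempty Q
  rcases h.subset_or (hR.2 hx) (hs hx) with h1 | h1
  · exact h1
  · by_cases hne : R = R'
    · rw [hne]
    have h2 := (mem_records.1 hR').2 R hR.1 h1 hne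
    have h3 := hmax R' ⟨(mem_records.1 hR').1, hs⟩
    rw [Prod.Lex.toLex_le_toLex] at h3
    simp only at h3
    omega

end Records

/-! ### A Carleson embedding for records -/

open Classical in
/-- The sum of the coefficients of the sets containing a given point. -/
noncomputable def chainSum {ι : Type} (B : ι → Set ℝ) (s : Finset ι) (c : ι → ℝ≥0∞) (x : ℝ) : ℝ≥0∞ :=
  ∑ Q ∈ s.filter (fun Q => x ∈ B Q), c Q

section ChainSum

variable {ι : Type} {B : ι → Set ℝ}

theorem chainSum_eq (s : Finset ι) (c : ι → ℝ≥0∞) (x : ℝ) :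
    chainSum B s c x = ∑ Q ∈ s, (B Q).indicator (fun _ => c Q) x := by
  classical
  rw [chainSum, Finset.sum_filter]
  refine Finset.sum_congr rfl fun Q _ => ?_
  by_cases h : x ∈ B Q <;> simp [h]

theorem measurable_chainSum (hB : ∀ Q, MeasurableSet (B Q)) (s : Finset ι) (c : ι → ℝ≥0∞) :
    Measurable (chainSum B s c) := by
  have : chainSum B s c = fun x => ∑ Q ∈ s, (B Q).indicator (fun _ => c Q) x :=
    funext (chainSum_eq s c)
  rw [this]
  exact Finset.measurable_sum _ fun Q _ => measurable_const.indicator (hB Q)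

theorem lintegral_chainSum_mul (hB : ∀ Q, MeasurableSet (B Q)) (s : Finset ι) (c : ι → ℝ≥0∞)
    (μ : Measure ℝ) {g : ℝ → ℝ≥0∞} (hg : AEMeasurable g μ) :
    ∫⁻ x, chainSum B s c x * g x ∂μ = ∑ Q ∈ s, c Q * ∫⁻ x in B Q, g x ∂μ := by
  simp only [chainSum_eq, Finset.sum_mul]
  rw [lintegral_finsetSum' (f := fun Q x => (B Q).indicator (fun _ => c Q) x * g x) _ fun Q _ =>
    ((measurable_const.indicator (hB Q)).aemeasurable.mul hg)]
  refine Finset.sum_congr rfl fun Q _ => ?_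
  rw [← lintegral_const_mul'' _ hg.restrict, ← lintegral_indicator (hB Q)]
  refine lintegral_congr fun x => ?_
  by_cases h : x ∈ B Q <;> simp [h]

theorem lintegral_chainSum (hB : ∀ Q, MeasurableSet (B Q)) (s : Finset ι) (c : ι → ℝ≥0∞)
    (μ : Measure ℝ) : ∫⁻ x, chainSum B s c x ∂μ = ∑ Q ∈ s, c Q * μ (B Q) := by
  have := lintegral_chainSum_mul hB s c μ (g := fun _ => 1) aemeasurable_const
  simpa using this

/-- If the levels of the sets through a point are distinct, then the power sum of `2 ^ lev` behaves
like its largest term. -/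
theorem chainSum_rpow_le (s : Finset ι) (lev : ι → ℤ) {x : ℝ}
    (hinj : ∀ Q ∈ s, ∀ R ∈ s, x ∈ B Q → x ∈ B R → lev Q = lev R → Q = R) {a b : ℝ}
    (hb : 0 < b) :
    chainSum B s (fun Q => pow2 (a * lev Q)) x ^ b ≤
      geomConst a ^ b * chainSum B s (fun Q => pow2 (a * b * lev Q)) x := by
  classical
  rcases (s.filter (fun Q => x ∈ B Q)).eq_empty_or_nonempty with h | h
  · simp [chainSum, h, hb]
  obtain ⟨P, hP, hmax⟩ := Finset.exists_max_image _ lev h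
  have h1 : chainSum B s (fun Q => pow2 (a * lev Q)) x ≤ geomConst a * pow2 (a * lev P) := by
    refine sum_pow2_le _ lev (fun i hi j hj => ?_) _ hmax
    simp only [Finset.mem_filter] at hi hj
    exact hinj i hi.1 j hj.1 hi.2 hj.2
  refine (ENNReal.rpow_le_rpow h1 hb.le).trans ?_
  rw [ENNReal.mul_rpow_of_nonneg _ _ hb.le, pow2_rpow]
  gcongr
  have h2 : a * lev P * b = a * b * lev P := by ring
  rw [h2]
  exact Finset.single_le_sum (f := fun Q => pow2 (a * b * lev Q)) (fun _ _ => zero_le) hP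

/-- Cancelling a power: `X ≤ c X ^ (1 / p')` gives `X ≤ c ^ p`. -/
theorem le_rpow_of_le_mul_rpow {X c : ℝ≥0∞} {p p' : ℝ} (hp : p.HolderConjugate p')
    (hX : X ≠ ∞) (h : X ≤ c * X ^ (1 / p')) : X ≤ c ^ p := by
  rcases eq_or_ne X 0 with rfl | h0
  · exact zero_le
  have hsum := hp.inv_add_inv_eq_one
  have h1 : X ^ (1 / p) * X ^ (1 / p') = X := by
    rw [← ENNReal.rpow_add _ _ h0 hX]
    simp [hsum]
  have h2 : X ^ (1 / p') ≠ 0 := by simp [ENNReal.rpow_eq_zero_iff, h0, hX]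
  have h3 : X ^ (1 / p') ≠ ∞ := ENNReal.rpow_ne_top_of_ne_zero h0 hX
  have h4 : X ^ (1 / p) ≤ c := by
    rw [← ENNReal.mul_le_mul_iff_left h2 h3, h1]
    exact h
  calc X = (X ^ (1 / p)) ^ p := by
        rw [← ENNReal.rpow_mul, one_div_mul_cancel hp.pos.ne', ENNReal.rpow_one]
    _ ≤ c ^ p := ENNReal.rpow_le_rpow h4 hp.pos.le

/-- The `L^p` Carleson embedding: if the levels of the sets through every point are distinct and
`2 ^ lev Q` is at most the `μ`-average of `h` over `B Q`, then the sum of `2 ^ (p lev Q) μ (B Q)` is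
controlled by `∫ h ^ p`.  This replaces the `L^p` bound of the dyadic maximal function. -/
theorem carleson_embedding {p p' : ℝ} (hp : p.HolderConjugate p') (s : Finset ι) (lev : ι → ℤ)
    (hB : ∀ Q, MeasurableSet (B Q))
    (hinj : ∀ x, ∀ Q ∈ s, ∀ R ∈ s, x ∈ B Q → x ∈ B R → lev Q = lev R → Q = R)
    (μ : Measure ℝ) {h : ℝ → ℝ≥0∞} (hh : AEMeasurable h μ) (hfin : ∀ Q ∈ s, μ (B Q) ≠ ∞)
    (havg : ∀ Q ∈ s, pow2 (lev Q) * μ (B Q) ≤ ∫⁻ x in B Q, h x ∂μ)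
    {E : Set ℝ} (hE : MeasurableSet E) (hsE : ∀ Q ∈ s, B Q ⊆ E) :
    ∑ Q ∈ s, pow2 (p * lev Q) * μ (B Q) ≤ geomConst (p - 1) ^ p * ∫⁻ x in E, h x ^ p ∂μ := by
  have hp1 : 0 < p - 1 := sub_pos.2 hp.lt
  have hp'0 : 0 < p' := hp.symm.pos
  have hpp : (p - 1) * p' = p := hp.sub_one_mul_conj
  set X := ∑ Q ∈ s, pow2 (p * lev Q) * μ (B Q) with hX
  have hXtop : X ≠ ∞ := by
    rw [hX, ENNReal.sum_ne_top]
    exact fun Q hQ => ENNReal.mul_ne_top (pow2_ne_top _) (hfin Q hQ)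
  have hm := measurable_chainSum hB s (fun Q => pow2 ((p - 1) * lev Q))
  have h1 : X ≤ ∫⁻ x, chainSum B s (fun Q => pow2 ((p - 1) * lev Q)) x * E.indicator h x ∂μ := by
    rw [lintegral_chainSum_mul hB s _ μ (hh.indicator hE), hX]
    refine Finset.sum_le_sum fun Q hQ => ?_
    have e : p * (lev Q : ℝ) = (p - 1) * lev Q + lev Q := by ring
    rw [e, pow2_add, mul_assoc]
    gcongr
    refine (havg Q hQ).trans (le_of_eq ?_)
    refine setLIntegral_congr_fun (hB Q) fun x hx => ?_
    simp [hsE Q hQ hx]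
  have h2 := ENNReal.lintegral_mul_le_Lp_mul_Lq μ hp.symm hm.aemeasurable (hh.indicator hE)
  have h3 : ∫⁻ x, chainSum B s (fun Q => pow2 ((p - 1) * lev Q)) x ^ p' ∂μ ≤
      geomConst (p - 1) ^ p' * X := by
    rw [hX, ← lintegral_chainSum hB s (fun Q => pow2 (p * lev Q)) μ,
      ← lintegral_const_mul _ (measurable_chainSum hB s _)]
    refine lintegral_mono fun x => ?_
    have := chainSum_rpow_le s lev (hinj x) (a := p - 1) (b := p') hp'0
    rwa [hpp] at this
  have h4 : ∫⁻ x, E.indicator h x ^ p ∂μ = ∫⁻ x in E, h x ^ p ∂μ := by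
    rw [← lintegral_indicator hE]
    refine lintegral_congr fun x => ?_
    by_cases hx : x ∈ E <;> simp [hx, hp.pos]
  rw [h4] at h2
  have h5 : X ≤ (geomConst (p - 1) * (∫⁻ x in E, h x ^ p ∂μ) ^ (1 / p)) * X ^ (1 / p') := by
    refine (h1.trans h2).trans ?_
    refine (mul_le_mul_left (ENNReal.rpow_le_rpow h3 (by positivity)) _).trans (le_of_eq ?_)
    rw [ENNReal.mul_rpow_of_nonneg _ _ (by positivity), ← ENNReal.rpow_mul,
      mul_one_div_cancel hp'0.ne', ENNReal.rpow_one]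
    ring
  have h6 := le_rpow_of_le_mul_rpow hp hXtop h5
  rwa [ENNReal.mul_rpow_of_nonneg _ _ hp.pos.le, ← ENNReal.rpow_mul,
    one_div_mul_cancel hp.pos.ne', ENNReal.rpow_one] at h6

end ChainSum

/-! ### The testing condition -/

section Testing

variable {ι : Type} {B : ι → Set ℝ} {gen : ι → ℤ}

/-- Only the records of the averages `2 ^ (S Q - gen Q)` contribute: between two records the sum
is geometric in the lengths. -/
theorem chainSum_le_records (hB : IsLaminar B gen) {α : ℝ} (𝒬 : Finset ι) (S : ι → ℝ) (x : ℝ) :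
    chainSum B 𝒬 (fun Q => pow2 ((α - 1) * gen Q + S Q)) x ≤ 2 * geomConst α *
      chainSum B (records B (fun Q => ⌊S Q - gen Q⌋) 𝒬)
        (fun Q => pow2 (α * gen Q + ⌊S Q - gen Q⌋)) x := by
  classical
  set lev : ι → ℤ := fun Q => ⌊S Q - gen Q⌋ with hlev
  have hex : ∀ Q, ∃ R, Q ∈ 𝒬 → R ∈ records B lev 𝒬 ∧ B Q ⊆ B R ∧ lev Q ≤ lev R := by
    intro Q
    by_cases hQ : Q ∈ 𝒬
    · obtain ⟨R, h1, h2, h3, -⟩ := exists_record hB (lev := lev) hQ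
      exact ⟨R, fun _ => ⟨h1, h2, h3⟩⟩
    · exact ⟨Q, fun h => absurd h hQ⟩
  choose rec hrec using hex
  rw [chainSum, chainSum, ← Finset.sum_fiberwise_of_maps_to (g := rec)
    (t := (records B lev 𝒬).filter fun Q => x ∈ B Q), Finset.mul_sum]
  swap
  · intro Q hQ
    simp only [Finset.mem_filter] at hQ ⊢
    exact ⟨(hrec Q hQ.1).1, (hrec Q hQ.1).2.1 hQ.2⟩
  refine Finset.sum_le_sum fun R hR => ?_
  have h1 : ∀ Q ∈ (𝒬.filter fun Q => x ∈ B Q).filter (fun Q => rec Q = R),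
      pow2 ((α - 1) * gen Q + S Q) ≤ pow2 (α * gen Q) * pow2 (lev R + 1) := by
    intro Q hQ
    simp only [Finset.mem_filter] at hQ
    have h2 := (hrec Q hQ.1.1).2.2
    rw [hQ.2] at h2
    have h3 : (lev Q : ℝ) ≤ lev R := by exact_mod_cast h2
    have h4 : S Q - gen Q < lev Q + 1 := Int.lt_floor_add_one _
    rw [← pow2_add, pow2_le]
    linarith
  refine (Finset.sum_le_sum h1).trans ?_
  rw [← Finset.sum_mul]
  have h5 := sum_pow2_le ((𝒬.filter fun Q => x ∈ B Q).filter (fun Q => rec Q = R)) gen (c := α)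
    (fun i hi j hj h => by
      simp only [Finset.mem_filter] at hi hj
      exact hB.gen_inj hi.1.2 hj.1.2 h) (gen R) (fun i hi => by
      simp only [Finset.mem_filter] at hi
      have := (hrec i hi.1.1).2.1
      rw [hi.2] at this
      exact hB.gen_le this)
  refine (mul_le_mul_left h5 _).trans (le_of_eq ?_)
  rw [pow2_add, pow2_one, pow2_add]
  ring

open Classical in
/-- The levels increase along a chain of records, so an `ℓ ^ 1` sum over the chain is controlled by
an `ℓ ^ q` sum at the cost of the weights `2 ^ (c (lev P - lev Q))`, `P` running over the records
inside `Q`. -/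
theorem chainSum_records_rpow_le {q q' c : ℝ} (hq : q.HolderConjugate q')
    (𝒬 : Finset ι) (hB : IsLaminar B gen) (lev : ι → ℤ) (a : ι → ℝ) (x : ℝ) :
    chainSum B (records B lev 𝒬) (fun Q => pow2 (a Q)) x ^ q ≤
      (geomConst (c * (q' / q)) ^ (1 / q')) ^ q *
      ∑ Q ∈ records B lev 𝒬, pow2 (q * a Q - c * lev Q) *
        chainSum B ((records B lev 𝒬).filter fun P => B P ⊆ B Q) (fun P => pow2 (c * lev P)) x := by
  have hq0 := hq.pos
  have hq'0 := hq.symm.pos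
  rcases ((records B lev 𝒬).filter (fun Q => x ∈ B Q)).eq_empty_or_nonempty with h | h
  · rw [chainSum, h]; simp [hq0]
  obtain ⟨P, hP, hmin⟩ := Finset.exists_min_image _ gen h
  simp only [Finset.mem_filter] at hP hmin
  have hsub : ∀ Q ∈ records B lev 𝒬, x ∈ B Q → B P ⊆ B Q := by
    intro Q hQ hx
    rcases hB.subset_or hP.2 hx with h1 | h1
    · exact h1
    · by_cases hne : Q = P
      · rw [hne]
      · exact absurd (hmin Q ⟨hQ, hx⟩) (not_le.2 (hB.gen_lt h1 hne))
  set w : ι → ℝ := fun Q => c / q * (lev P - lev Q) with hw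
  have h1 := ENNReal.inner_le_Lp_mul_Lq ((records B lev 𝒬).filter (fun Q => x ∈ B Q))
    (fun Q => pow2 (a Q + w Q)) (fun Q => pow2 (-w Q)) hq
  have e1 : ∀ Q, pow2 (a Q + w Q) * pow2 (-w Q) = pow2 (a Q) := fun Q => by
    rw [← pow2_add]; congr 1; ring
  have e2 : ∀ Q, pow2 (a Q + w Q) ^ q = pow2 (q * a Q - c * lev Q) * pow2 (c * lev P) := fun Q => by
    rw [pow2_rpow, ← pow2_add]; congr 1; rw [hw]; field_simp; ring
  have e3 : ∀ Q, pow2 (-w Q) ^ q' = pow2 (c * (q' / q) * lev Q) * pow2 (-(c * (q' / q) * lev P)) :=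
    fun Q => by rw [pow2_rpow, ← pow2_add]; congr 1; rw [hw]; field_simp; ring
  simp only [e1, e2, e3] at h1
  rw [← Finset.sum_mul, ← Finset.sum_mul] at h1
  have h2 := sum_pow2_le ((records B lev 𝒬).filter (fun Q => x ∈ B Q)) lev (c := c * (q' / q))
    (fun i hi j hj h => by
      simp only [Finset.mem_filter] at hi hj
      exact records_lev_inj hB hi.1 hj.1 hi.2 hj.2 h) (lev P) (fun i hi => by
      simp only [Finset.mem_filter] at hi
      exact records_lev_le hP.1 hi.1 (hsub i hi.1 hi.2))
  have h3 := mul_le_mul_left h2 (pow2 (-(c * (q' / q) * lev P)))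
  rw [mul_assoc (geomConst _), ← pow2_add, add_neg_cancel, pow2_zero, mul_one] at h3
  have h4 := h1.trans (mul_le_mul_right (ENNReal.rpow_le_rpow h3 (by positivity : 0 ≤ 1 / q')) _)
  refine (ENNReal.rpow_le_rpow h4 hq0.le).trans ?_
  rw [ENNReal.mul_rpow_of_nonneg _ _ hq0.le, ← ENNReal.rpow_mul, one_div_mul_cancel hq0.ne',
    ENNReal.rpow_one, mul_comm, Finset.sum_mul]
  gcongr
  refine (Finset.sum_le_sum (fun Q hQ => ?_)).trans
    (Finset.sum_le_sum_of_subset (Finset.filter_subset (fun Q => x ∈ B Q) _))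
  simp only [Finset.mem_filter] at hQ
  gcongr
  exact Finset.single_le_sum (f := fun P => pow2 (c * lev P)) (fun _ _ => zero_le)
    (by simp only [Finset.mem_filter]; exact ⟨⟨hP.1, hsub Q hQ.1 hQ.2⟩, hP.2⟩)

/-- The sum of `2 ^ (-c lev P) |B P|` over the records `P` inside `Q`. -/
theorem sum_records_volume_le (hB : IsLaminar B gen) (𝒬 : Finset ι) (lev : ι → ℤ) {c : ℝ}
    {Q : ι} (hQ : Q ∈ records B lev 𝒬) [DecidablePred fun P => B P ⊆ B Q] :
    ∑ P ∈ (records B lev 𝒬).filter (fun P => B P ⊆ B Q), pow2 (-c * lev P) * pow2 (gen P) ≤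
      geomConst c * pow2 (-c * lev Q) * pow2 (gen Q) := by
  classical
  have h1 := lintegral_chainSum hB.measurableSet ((records B lev 𝒬).filter (fun P => B P ⊆ B Q))
    (fun P => pow2 (-c * lev P)) volume
  simp only [hB.volume_eq] at h1
  rw [← h1, ← hB.volume_eq Q, ← setLIntegral_const, ← lintegral_indicator (hB.measurableSet Q)]
  refine lintegral_mono fun x => ?_
  by_cases hx : x ∈ B Q
  · rw [indicator_of_mem hx]
    refine sum_pow2_le_of_ge _ lev (fun i hi j hj h => ?_) _ (fun i hi => ?_)
    · simp only [Finset.mem_filter] at hi hj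
      exact records_lev_inj hB hi.1.1 hj.1.1 hi.2 hj.2 h
    · simp only [Finset.mem_filter] at hi
      exact records_lev_le hi.1.1 hQ hi.1.2
  · rw [indicator_of_notMem hx]
    refine le_of_eq (Finset.sum_eq_zero fun P hP => ?_)
    simp only [Finset.mem_filter] at hP
    exact absurd (hP.1.2 hP.2) hx

/-- The one-sided `A_∞` packing condition: the masses `2 ^ S Q` of the records of the averages
`2 ^ (S Q - gen Q)` sum to at most a multiple of `K ^ (1 / s)` times the mass of the ambient set.
The averages are at most `(K |B Q| / μ (B Q)) ^ (1 / s)`, so they are controlled by the averages of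
the density `h = dx / dμ`. -/
theorem sum_records_mass_le (hB : IsLaminar B gen) {s κ : ℝ} (hs : 0 < s) (𝒬 : Finset ι)
    (S U : ι → ℝ) (μ : Measure ℝ) {h : ℝ → ℝ≥0∞} (hh : AEMeasurable h μ)
    (hhvol : ∀ E, MeasurableSet E → ∫⁻ x in E, h x ∂μ = volume E)
    (hU : ∀ Q ∈ 𝒬, μ (B Q) = pow2 (U Q))
    (hK : ∀ Q ∈ 𝒬, U Q + s * S Q ≤ κ + (1 + s) * gen Q)
    {E : Set ℝ} (hE : MeasurableSet E) (hsE : ∀ Q ∈ 𝒬, B Q ⊆ E) :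
    ∑ Q ∈ records B (fun Q => ⌊S Q - gen Q⌋) 𝒬, pow2 (S Q) ≤
      2 * geomConst 1 * (2 * pow2 (1 / s)) * geomConst (1 / s) ^ (1 + 1 / s) * pow2 (κ / s) *
        ∫⁻ x in E, h x ^ (1 + 1 / s) ∂μ := by
  classical
  set lev : ι → ℤ := fun Q => ⌊S Q - gen Q⌋ with hlev
  set lev' : ι → ℤ := fun Q => ⌊gen Q - U Q⌋ with hlev'
  have hm := hB.measurableSet
  have h1 : ∑ Q ∈ records B lev 𝒬, pow2 (S Q) ≤
      2 * ∫⁻ x, chainSum B (records B lev 𝒬) (fun Q => pow2 (lev Q)) x := by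
    rw [lintegral_chainSum hm, Finset.mul_sum]
    refine Finset.sum_le_sum fun Q _ => ?_
    rw [hB.volume_eq, ← pow2_add, ← pow2_one, ← pow2_add, pow2_le]
    have h4 : S Q - gen Q < lev Q + 1 := Int.lt_floor_add_one _
    linarith
  have h2 : ∀ x, chainSum B (records B lev 𝒬) (fun Q => pow2 (lev Q)) x ≤
      geomConst 1 * (pow2 (1 / s) * pow2 (κ / s)) *
        chainSum B (records B lev' 𝒬) (fun Q => pow2 (1 / s * lev' Q)) x := by
    intro x
    rcases ((records B lev 𝒬).filter (fun Q => x ∈ B Q)).eq_empty_or_nonempty with hem | hne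
    · rw [chainSum, hem]; simp
    obtain ⟨P, hP, hmax⟩ := Finset.exists_max_image _ lev hne
    have h3 := sum_pow2_le ((records B lev 𝒬).filter (fun Q => x ∈ B Q)) lev (c := 1)
      (fun i hi j hj h => by
        simp only [Finset.mem_filter] at hi hj
        exact records_lev_inj hB hi.1 hj.1 hi.2 hj.2 h) (lev P) hmax
    simp only [one_mul] at h3
    simp only [Finset.mem_filter] at hP
    have hP𝒬 := (mem_records.1 hP.1).1
    obtain ⟨R, hR, hPR, hl, -⟩ := exists_record hB (lev := lev') hP𝒬
    refine h3.trans ?_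
    rw [mul_assoc]
    gcongr
    have h4 : pow2 (lev P) ≤ pow2 (1 / s) * pow2 (κ / s) * pow2 (1 / s * lev' R) := by
      rw [← pow2_add, ← pow2_add, pow2_le]
      have a1 : (lev P : ℝ) ≤ S P - gen P := Int.floor_le _
      have a2 : gen P - U P < lev' P + 1 := Int.lt_floor_add_one _
      have a3 : (lev' P : ℝ) ≤ lev' R := by exact_mod_cast hl
      have a4 := hK P hP𝒬
      have a5 : (lev P : ℝ) * s ≤ 1 + κ + lev' R := by nlinarith
      have a6 : 1 / s + κ / s + 1 / s * lev' R = (1 + κ + lev' R) / s := by ring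
      rw [a6, le_div_iff₀ hs]
      exact a5
    refine h4.trans ?_
    gcongr
    exact Finset.single_le_sum (f := fun Q => pow2 (1 / s * lev' Q)) (fun _ _ => zero_le)
      (by simp only [Finset.mem_filter]; exact ⟨hR, hPR hP.2⟩)
  have h5 : ∫⁻ x, chainSum B (records B lev' 𝒬) (fun Q => pow2 (1 / s * lev' Q)) x ≤
      2 * ∑ Q ∈ records B lev' 𝒬, pow2 ((1 + 1 / s) * lev' Q) * μ (B Q) := by
    rw [lintegral_chainSum hm, Finset.mul_sum]
    refine Finset.sum_le_sum fun Q hQ => ?_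
    rw [hB.volume_eq, hU Q (mem_records.1 hQ).1, ← pow2_add, ← pow2_add, ← pow2_one, ← pow2_add,
      pow2_le]
    have a2 : gen Q - U Q < lev' Q + 1 := Int.lt_floor_add_one _
    linarith
  have hconj : (1 + 1 / s).HolderConjugate (1 + 1 / s).conjExponent :=
    Real.HolderConjugate.conjExponent (by have := one_div_pos.2 hs; linarith)
  have h6 := carleson_embedding hconj (records B lev' 𝒬) lev' hm
    (fun x Q hQ R hR hxQ hxR hl => records_lev_inj hB hQ hR hxQ hxR hl) μ hh
    (fun Q hQ => by rw [hU Q (mem_records.1 hQ).1]; exact pow2_ne_top _)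
    (fun Q hQ => by
      rw [hU Q (mem_records.1 hQ).1, hhvol _ (hm Q), hB.volume_eq, ← pow2_add, pow2_le]
      have : (lev' Q : ℝ) ≤ gen Q - U Q := Int.floor_le _
      linarith) hE (fun Q hQ => hsE Q (mem_records.1 hQ).1)
  rw [add_sub_cancel_left] at h6
  refine h1.trans ?_
  have h7 := (lintegral_mono (μ := volume) h2).trans (le_of_eq (lintegral_const_mul _
    (measurable_chainSum hm (records B lev' 𝒬) (fun Q => pow2 (1 / s * lev' Q)))))
  calc _ ≤ 2 * (geomConst 1 * (pow2 (1 / s) * pow2 (κ / s)) * (2 * (geomConst (1 / s) ^ (1 + 1 / s)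
        * ∫⁻ x in E, h x ^ (1 + 1 / s) ∂μ))) := by
        gcongr
        refine h7.trans ?_
        gcongr
        refine h5.trans ?_
        gcongr
    _ = _ := by ring

/-- The testing condition: the sum of `2 ^ ((α - 1) gen Q) σ_Q` over the sets through a point,
where `σ_Q = 2 ^ S Q`, has `L ^ q(μ)` norm at most a multiple of
`K ^ ((1 + 1 / s) / q) σ(E) ^ (1 / p)`. -/
theorem testing {p q α s : ℝ} (hp : 1 < p) (hq : 1 < q) (hα : 0 < α) (hpq : q / p = 1 + α * q)
    (hs : s = q - q / p) :
    ∃ C : ℝ≥0∞, C ≠ ∞ ∧ ∀ (ι : Type) (B : ι → Set ℝ) (gen : ι → ℤ), IsLaminar B gen →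
      ∀ (κ : ℝ) (𝒬 : Finset ι) (S U : ι → ℝ) (μ : Measure ℝ) (h : ℝ → ℝ≥0∞), AEMeasurable h μ →
      (∀ E, MeasurableSet E → ∫⁻ x in E, h x ∂μ = volume E) →
      (∀ Q ∈ 𝒬, μ (B Q) = pow2 (U Q)) →
      (∀ Q ∈ 𝒬, U Q + s * S Q ≤ κ + (1 + s) * gen Q) →
      ∀ (E : Set ℝ) (N : ℝ≥0∞), MeasurableSet E → (∀ Q ∈ 𝒬, B Q ⊆ E) →
      (∫⁻ x in E, h x ^ (1 + 1 / s) ∂μ ≤ N) → (∀ Q ∈ 𝒬, pow2 (S Q) ≤ N) →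
      ∫⁻ x, chainSum B 𝒬 (fun Q => pow2 ((α - 1) * gen Q + S Q)) x ^ q ∂μ ≤
        C * pow2 (κ * (1 + 1 / s)) * N ^ (q / p) := by
  have hq0 : 0 < q := by linarith
  have hp0 : 0 < p := by linarith
  have hs0 : 0 < s := by
    rw [hs, sub_pos, div_lt_iff₀ hp0]; nlinarith
  have hqp : 1 < q / p := by rw [hpq]; nlinarith
  have hconj : q.HolderConjugate q.conjExponent := Real.HolderConjugate.conjExponent hq
  set q' := q.conjExponent with hq'
  have hq'0 : 0 < q' := hconj.symm.pos
  set C₁ := 2 * geomConst α with hC₁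
  set C₂ := (geomConst (s / 2 * (q' / q)) ^ (1 / q')) ^ q with hC₂
  set C₃ := geomConst (s / 2) with hC₃
  set C₄ := 2 * geomConst 1 * (2 * pow2 (1 / s)) * geomConst (1 / s) ^ (1 + 1 / s) with hC₄
  have hC₁t : C₁ ≠ ∞ := ENNReal.mul_ne_top (by simp) (geomConst_ne_top hα)
  have hC₂t : C₂ ≠ ∞ := ENNReal.rpow_ne_top_of_nonneg hq0.le
    (ENNReal.rpow_ne_top_of_nonneg (by positivity) (geomConst_ne_top (by positivity)))
  have hC₃t : C₃ ≠ ∞ := geomConst_ne_top (by positivity)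
  have hC₄t : C₄ ≠ ∞ := ENNReal.mul_ne_top (ENNReal.mul_ne_top (ENNReal.mul_ne_top (by simp)
    (geomConst_ne_top one_pos)) (ENNReal.mul_ne_top (by simp) (pow2_ne_top _)))
    (ENNReal.rpow_ne_top_of_nonneg (by positivity) (geomConst_ne_top (by positivity)))
  refine ⟨C₁ ^ q * C₂ * C₃ * C₄, ENNReal.mul_ne_top (ENNReal.mul_ne_top (ENNReal.mul_ne_top
    (ENNReal.rpow_ne_top_of_nonneg hq0.le hC₁t) hC₂t) hC₃t) hC₄t, ?_⟩
  intro ι B gen hB κ 𝒬 S U μ h hh hhvol hU hK E N hE hsE hN hSN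
  classical
  set lev : ι → ℤ := fun Q => ⌊S Q - gen Q⌋ with hlev
  have hm := hB.measurableSet
  have h1 : ∫⁻ x, chainSum B 𝒬 (fun Q => pow2 ((α - 1) * gen Q + S Q)) x ^ q ∂μ ≤
      C₁ ^ q * C₂ * ∑ Q ∈ records B lev 𝒬, pow2 (q * (α * gen Q + lev Q) - s / 2 * lev Q) *
        ∑ P ∈ (records B lev 𝒬).filter (fun P => B P ⊆ B Q), pow2 (s / 2 * lev P) * μ (B P) := by
    have : ∀ x, chainSum B 𝒬 (fun Q => pow2 ((α - 1) * gen Q + S Q)) x ^ q ≤ C₁ ^ q * C₂ *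
        ∑ Q ∈ records B lev 𝒬, pow2 (q * (α * gen Q + lev Q) - s / 2 * lev Q) *
        chainSum B ((records B lev 𝒬).filter fun P => B P ⊆ B Q)
          (fun P => pow2 (s / 2 * lev P)) x := by
      intro x
      refine (ENNReal.rpow_le_rpow (chainSum_le_records hB 𝒬 S x) hq0.le).trans ?_
      rw [ENNReal.mul_rpow_of_nonneg _ _ hq0.le, mul_assoc (C₁ ^ q)]
      gcongr
      exact chainSum_records_rpow_le hconj 𝒬 hB lev (fun Q => α * gen Q + lev Q) x
    refine (lintegral_mono this).trans (le_of_eq ?_)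
    rw [lintegral_const_mul _ (Finset.measurable_sum _ fun Q _ =>
      (measurable_chainSum hm _ _).const_mul _), lintegral_finsetSum _ (fun Q _ =>
      (measurable_chainSum hm _ _).const_mul _)]
    congr 1
    refine Finset.sum_congr rfl fun Q _ => ?_
    rw [lintegral_const_mul _ (measurable_chainSum hm _ _), lintegral_chainSum hm]
  have h2 : ∀ Q ∈ records B lev 𝒬,
      ∑ P ∈ (records B lev 𝒬).filter (fun P => B P ⊆ B Q), pow2 (s / 2 * lev P) * μ (B P) ≤
        C₃ * pow2 (κ - s / 2 * lev Q + gen Q) := by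
    intro Q hQ
    have h3 : ∀ P ∈ (records B lev 𝒬).filter (fun P => B P ⊆ B Q),
        pow2 (s / 2 * lev P) * μ (B P) ≤
          pow2 κ * (pow2 (-(s / 2) * lev P) * pow2 (gen P)) := by
      intro P hP
      have hP𝒬 := (mem_records.1 (Finset.mem_filter.1 hP).1).1
      rw [hU P hP𝒬, ← pow2_add, ← pow2_add, ← pow2_add, pow2_le]
      have a1 : (lev P : ℝ) ≤ S P - gen P := Int.floor_le _
      have a2 := hK P hP𝒬
      nlinarith
    refine (Finset.sum_le_sum h3).trans ?_
    rw [← Finset.mul_sum]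
    refine (mul_le_mul_right (sum_records_volume_le hB 𝒬 lev hQ) _).trans (le_of_eq ?_)
    rw [show κ - s / 2 * lev Q + gen Q = κ + -(s / 2) * lev Q + gen Q by ring, pow2_add, pow2_add]
    ring
  have h4 : ∀ Q ∈ records B lev 𝒬, pow2 (q * (α * gen Q + lev Q) - s / 2 * lev Q) *
      ∑ P ∈ (records B lev 𝒬).filter (fun P => B P ⊆ B Q), pow2 (s / 2 * lev P) * μ (B P) ≤
      C₃ * pow2 κ * N ^ (q / p - 1) * pow2 (S Q) := by
    intro Q hQ
    have hQ𝒬 := (mem_records.1 hQ).1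
    have h5 : pow2 (S Q * (q / p - 1)) ≤ N ^ (q / p - 1) := by
      rw [← pow2_rpow]
      exact ENNReal.rpow_le_rpow (hSN Q hQ𝒬) (by linarith)
    calc _ ≤ pow2 (q * (α * gen Q + lev Q) - s / 2 * lev Q) *
          (C₃ * pow2 (κ - s / 2 * lev Q + gen Q)) := by gcongr; exact h2 Q hQ
      _ = C₃ * pow2 (q * (α * gen Q + lev Q) - s / 2 * lev Q + (κ - s / 2 * lev Q + gen Q)) := by
          rw [pow2_add (_ - _) (κ - _ + _)]; ring
      _ ≤ C₃ * (pow2 (κ + S Q * (q / p - 1) + S Q)) := by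
          gcongr
          rw [pow2_le]
          have a1 : (lev Q : ℝ) ≤ S Q - gen Q := Int.floor_le _
          have a2 : q * (α * gen Q + lev Q) - s / 2 * lev Q + (κ - s / 2 * lev Q + gen Q) =
              κ + (1 + α * q) * gen Q + (q - s) * lev Q := by ring
          have a3 : q - s = q / p := by rw [hs]; ring
          rw [a2, ← hpq, a3]
          nlinarith
      _ = C₃ * (pow2 κ * pow2 (S Q * (q / p - 1)) * pow2 (S Q)) := by rw [pow2_add, pow2_add]
      _ ≤ _ := by
          rw [mul_assoc C₃, mul_assoc C₃]
          gcongr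
  have h6 := sum_records_mass_le hB hs0 𝒬 S U μ hh hhvol hU hK hE hsE
  have h7 : ∑ Q ∈ records B lev 𝒬, pow2 (S Q) ≤ C₄ * pow2 (κ / s) * N :=
    h6.trans (mul_le_mul_right hN _)
  refine h1.trans ((mul_le_mul_right (Finset.sum_le_sum h4) _).trans ?_)
  rw [← Finset.mul_sum]
  refine (mul_le_mul_right (mul_le_mul_right h7 _) _).trans (le_of_eq ?_)
  have e1 : κ * (1 + 1 / s) = κ + κ / s := by field_simp
  have e2 : N ^ (q / p) = N ^ (q / p - 1) * N := by
    conv_rhs => rw [← ENNReal.rpow_one N, ← ENNReal.rpow_mul, one_mul,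
      ← ENNReal.rpow_add_of_nonneg _ _ (by linarith) zero_le_one, sub_add_cancel]
  rw [e1, e2, pow2_add]
  ring

end Testing

/-! ### Split systems -/

/-- A system of intervals, each split into a left and a right half of length `2 ^ gen Q`: two
distinct intervals are disjoint, or one of them lies in one of the halves of the other.  Dyadic
grids are the model; the order of the line is not part of the structure, so the two halves can be
exchanged. -/
structure SplitSystem (ι : Type) where
  /-- the left half -/
  left : ι → Set ℝ
  /-- the right half -/
  right : ι → Set ℝ
  /-- the base two logarithm of the length of a half -/
  gen : ι → ℤ
  measurableSet_left : ∀ Q, MeasurableSet (left Q)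
  measurableSet_right : ∀ Q, MeasurableSet (right Q)
  volume_left : ∀ Q, volume (left Q) = pow2 (gen Q)
  volume_right : ∀ Q, volume (right Q) = pow2 (gen Q)
  disjoint : ∀ Q, Disjoint (left Q) (right Q)
  split : ∀ Q R, Q ≠ R → Disjoint (left Q ∪ right Q) (left R ∪ right R) ∨
    left Q ∪ right Q ⊆ left R ∨ left Q ∪ right Q ⊆ right R ∨
    left R ∪ right R ⊆ left Q ∨ left R ∪ right R ⊆ right Q

namespace SplitSystem

variable {ι : Type} (D : SplitSystem ι)

/-- The system with the two halves exchanged. -/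
def swap : SplitSystem ι where
  left := D.right
  right := D.left
  gen := D.gen
  measurableSet_left := D.measurableSet_right
  measurableSet_right := D.measurableSet_left
  volume_left := D.volume_right
  volume_right := D.volume_left
  disjoint Q := (D.disjoint Q).symm
  split Q R h := by
    rw [union_comm (D.right Q), union_comm (D.right R)]
    rcases D.split Q R h with h | h | h | h | h <;> tauto

theorem gen_lt_of_subset {Q R : ι} (h : D.left Q ∪ D.right Q ⊆ D.left R) :
    D.gen Q < D.gen R := by
  have h1 := measure_mono (μ := volume) h
  rw [measure_union (D.disjoint Q) (D.measurableSet_right Q), D.volume_left, D.volume_right,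
    D.volume_left, ← two_mul, ← pow2_one, ← pow2_add, pow2_le] at h1
  have h2 : 1 + D.gen Q ≤ D.gen R := by exact_mod_cast h1
  omega

theorem isLaminar_left : IsLaminar D.left D.gen where
  measurableSet := D.measurableSet_left
  volume_eq := D.volume_left
  nested Q R hne := by
    rcases D.split Q R hne with h | h | h | h | h
    · exact Or.inl (h.mono subset_union_left subset_union_left)
    · exact Or.inr (Or.inl ⟨subset_union_left.trans h, D.gen_lt_of_subset h⟩)
    · exact Or.inl ((D.disjoint R).symm.mono_left (subset_union_left.trans h))
    · exact Or.inr (Or.inr ⟨subset_union_left.trans h, D.gen_lt_of_subset h⟩)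
    · exact Or.inl ((D.disjoint Q).mono_right (subset_union_left.trans h))

theorem isLaminar_right : IsLaminar D.right D.gen := D.swap.isLaminar_left

theorem left_nonempty (Q : ι) : (D.left Q).Nonempty := D.isLaminar_left.nonempty Q

theorem not_subset_left_right {Q R : ι} (h : D.left Q ⊆ D.left R) (h' : D.left Q ⊆ D.right R) :
    False := by
  obtain ⟨x, hx⟩ := D.left_nonempty Q
  exact Set.disjoint_left.1 (D.disjoint R) (h hx) (h' hx)

theorem subset_left_of_ne {Q R : ι} (h : D.left Q ⊆ D.left R) (hne : Q ≠ R) :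
    D.left Q ∪ D.right Q ⊆ D.left R := by
  rcases D.split Q R hne with h1 | h1 | h1 | h1 | h1
  · obtain ⟨x, hx⟩ := D.left_nonempty Q
    exact (Set.disjoint_left.1 h1 (Or.inl hx) (Or.inl (h hx))).elim
  · exact h1
  · exact (D.not_subset_left_right h (subset_union_left.trans h1)).elim
  · exact (hne (D.isLaminar_left.eq_of_subset h (subset_union_left.trans h1))).elim
  · exact (D.not_subset_left_right (Q := Q) le_rfl (h.trans (subset_union_left.trans h1))).elim

theorem subset_right_of_ne {Q R : ι} (h : D.right Q ⊆ D.right R) (hne : Q ≠ R) :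
    D.left Q ∪ D.right Q ⊆ D.right R := by
  rw [union_comm]
  exact D.swap.subset_left_of_ne h hne

theorem left_right_nested {Q R R' : ι} (h : D.left Q ∪ D.right Q ⊆ D.left R)
    (h' : D.left Q ∪ D.right Q ⊆ D.right R') :
    D.left R ⊆ D.right R' ∨ D.right R' ⊆ D.left R := by
  obtain ⟨x, hx⟩ := D.left_nonempty Q
  have hR : x ∈ D.left R := h (Or.inl hx)
  have hR' : x ∈ D.right R' := h' (Or.inl hx)
  by_cases hne : R = R'
  · subst hne
    exact (Set.disjoint_left.1 (D.disjoint R) hR hR').elim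
  rcases D.split R R' hne with h1 | h1 | h1 | h1 | h1
  · exact (Set.disjoint_left.1 h1 (Or.inl hR) (Or.inr hR')).elim
  · exact (Set.disjoint_left.1 (D.disjoint R') (h1 (Or.inl hR)) hR').elim
  · exact Or.inl (subset_union_left.trans h1)
  · exact Or.inr (subset_union_right.trans h1)
  · exact (Set.disjoint_left.1 (D.disjoint R) hR (h1 (Or.inr hR'))).elim

end SplitSystem

/-- `h` is the density of Lebesgue measure with respect to `μ`, and `h ^ (1 + 1 / s)` is at most the
density of `ν`.  For `dμ = u dx` and `dν = u ^ (-1 / s) dx` this holds with `h = 1 / u`. -/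
structure IsDualDensity (μ ν : Measure ℝ) (s : ℝ) (h : ℝ → ℝ≥0∞) : Prop where
  aemeasurable : AEMeasurable h μ
  lintegral_eq : ∀ E, MeasurableSet E → ∫⁻ x in E, h x ∂μ = volume E
  lintegral_rpow_le : ∀ E, MeasurableSet E → ∫⁻ x in E, h x ^ (1 + 1 / s) ∂μ ≤ ν E

/-! ### The bilinear form of a split system -/

/-- The part of the bilinear form where the stopping interval `F Q` of the first function contains
the whole of `Q` and is determined by the stopping interval `G Q` of the second: the testing
condition applies to every `F`, and the stopping intervals of `g` attached to different `F` are
different. -/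
theorem corona_part {p q q' α s : ℝ} (hp : 1 < p) (hq : q.HolderConjugate q') (hα : 0 < α)
    (hpq : q / p = 1 + α * q) (hs : s = q - q / p) :
    ∃ C : ℝ≥0∞, C ≠ ∞ ∧ ∀ (ι : Type) (D : SplitSystem ι) (κ : ℝ) (S U : ι → ℝ)
      (μ ν : Measure ℝ) (h : ℝ → ℝ≥0∞), IsDualDensity μ ν s h →
      (∀ Q, ν (D.left Q) = pow2 (S Q)) → (∀ Q, μ (D.right Q) = pow2 (U Q)) →
      (∀ Q, U Q + s * S Q ≤ κ + (1 + s) * D.gen Q) →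
      ∀ (𝒬 ℱ 𝒢 : Finset ι) (F G : ι → ι) (levf levg : ι → ℤ),
      (∀ Q ∈ 𝒬, F Q ∈ ℱ) → (∀ Q ∈ 𝒬, G Q ∈ 𝒢) →
      (∀ Q ∈ 𝒬, D.left Q ∪ D.right Q ⊆ D.left (F Q)) →
      (∀ Q ∈ 𝒬, D.right Q ⊆ D.right (G Q)) →
      (∀ Q ∈ 𝒬, ∀ R ∈ 𝒬, G Q = G R → F Q = F R) →
      (∀ x, ∀ Q ∈ 𝒢, ∀ R ∈ 𝒢, x ∈ D.right Q → x ∈ D.right R → levg Q = levg R → Q = R) →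
      ∑ Q ∈ 𝒬, pow2 ((α - 1) * D.gen Q + S Q + U Q + levf (F Q) + levg (G Q)) ≤
        C * pow2 (κ * (1 + 1 / s) / q) * (∑ R ∈ ℱ, pow2 (p * levf R + S R)) ^ (1 / p) *
          (∑ R ∈ 𝒢, pow2 (q' * levg R + U R)) ^ (1 / q') := by
  obtain ⟨C, hC, hT⟩ := testing hp hq.lt hα hpq hs
  have hq0 := hq.pos
  have hq'0 := hq.symm.pos
  have hp0 : 0 < p := by linarith
  have hsum := hq.inv_add_inv_eq_one
  have hpq' : 1 ≤ 1 / p + 1 / q' := by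
    have h1 : 1 / p = 1 / q + α := by
      field_simp at hpq ⊢; linarith
    simp only [one_div] at h1 ⊢
    linarith
  refine ⟨C ^ (1 / q) * geomConst 1, ENNReal.mul_ne_top
    (ENNReal.rpow_ne_top_of_nonneg (by positivity) hC) (geomConst_ne_top one_pos), ?_⟩
  intro ι D κ S U μ ν h hh hS hU hK 𝒬 ℱ 𝒢 F G levf levg hF hG hQF hQG hGF hinj
  classical
  set 𝒬F : ι → Finset ι := fun R => 𝒬.filter fun Q => F Q = R with h𝒬F
  set 𝒢F : ι → Finset ι := fun R => (𝒬F R).image G with h𝒢F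
  set T : ι → ℝ → ℝ≥0∞ := fun R =>
    chainSum D.right (𝒬F R) (fun Q => pow2 ((α - 1) * D.gen Q + S Q)) with hTdef
  set g : ι → ℝ → ℝ≥0∞ := fun R =>
    chainSum D.right (𝒢F R) (fun Q => pow2 (1 * levg Q)) with hgdef
  set y : ι → ℝ≥0∞ := fun R => ∑ P ∈ 𝒢F R, pow2 (q' * levg P + U P) with hy
  have hm := D.measurableSet_right
  have hgm : ∀ R, Measurable (g R) := fun R => measurable_chainSum hm _ _
  have hTm : ∀ R, Measurable (T R) := fun R => measurable_chainSum hm _ _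
  have h1 : ∀ R, ∑ Q ∈ 𝒬F R, pow2 ((α - 1) * D.gen Q + S Q + U Q + levf (F Q) + levg (G Q)) ≤
      pow2 (levf R) * ∫⁻ x, T R x * g R x ∂μ := by
    intro R
    rw [lintegral_chainSum_mul hm _ _ μ (hgm R).aemeasurable, Finset.mul_sum]
    refine Finset.sum_le_sum fun Q hQ => ?_
    have hQ' := Finset.mem_filter.1 hQ
    have h2 : pow2 (levg (G Q)) * pow2 (U Q) ≤ ∫⁻ x in D.right Q, g R x ∂μ := by
      rw [← hU Q, ← setLIntegral_const]
      refine setLIntegral_mono (hgm R) fun x hx => ?_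
      have h3 := Finset.single_le_sum (s := (𝒢F R).filter (fun P => x ∈ D.right P))
        (f := fun P => pow2 (1 * levg P)) (fun _ _ => zero_le) (a := G Q)
        (by simp only [Finset.mem_filter]
            exact ⟨Finset.mem_image_of_mem G hQ, hQG Q hQ'.1 hx⟩)
      simp only [one_mul] at h3
      refine h3.trans (le_of_eq ?_)
      simp [hgdef, chainSum]
    refine le_trans (le_of_eq ?_) (mul_le_mul_right (mul_le_mul_right h2 _) _)
    rw [hQ'.2, pow2_add, pow2_add, pow2_add]
    ring
  have h2 : ∀ R, ∫⁻ x, T R x ^ q ∂μ ≤ C * pow2 (κ * (1 + 1 / s)) * pow2 (S R) ^ (q / p) := by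
    intro R
    have hsub : ∀ Q ∈ 𝒬F R, D.left Q ∪ D.right Q ⊆ D.left R := by
      intro Q hQ
      have hQ' := Finset.mem_filter.1 hQ
      have := hQF Q hQ'.1
      rwa [hQ'.2] at this
    refine hT ι D.right D.gen D.isLaminar_right κ (𝒬F R) S U μ h hh.aemeasurable hh.lintegral_eq
      (fun Q _ => hU Q) (fun Q _ => hK Q) (D.left R) (pow2 (S R)) (D.measurableSet_left R)
      (fun Q hQ => subset_union_right.trans (hsub Q hQ)) ?_ (fun Q hQ => ?_)
    · rw [← hS]; exact hh.lintegral_rpow_le _ (D.measurableSet_left R)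
    · rw [← hS, ← hS]
      exact measure_mono (subset_union_left.trans (hsub Q hQ))
  have h3 : ∀ R, ∫⁻ x, g R x ^ q' ∂μ ≤ geomConst 1 ^ q' * y R := by
    intro R
    have h4 : ∀ x, g R x ^ q' ≤ geomConst 1 ^ q' *
        chainSum D.right (𝒢F R) (fun Q => pow2 (1 * q' * levg Q)) x := fun x => by
      refine chainSum_rpow_le (𝒢F R) levg (fun Q hQ P hP => ?_) hq'0
      simp only [h𝒢F, Finset.mem_image] at hQ hP
      obtain ⟨Q₀, hQ₀, rfl⟩ := hQ
      obtain ⟨P₀, hP₀, rfl⟩ := hP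
      exact hinj x _ (hG _ (Finset.mem_filter.1 hQ₀).1) _ (hG _ (Finset.mem_filter.1 hP₀).1)
    refine (lintegral_mono h4).trans ?_
    rw [lintegral_const_mul _ (measurable_chainSum hm _ _), lintegral_chainSum hm]
    gcongr
    refine Finset.sum_le_sum fun P _ => le_of_eq ?_
    rw [hU, ← pow2_add, one_mul]
  have h4 : ∀ R, ∑ Q ∈ 𝒬F R, pow2 ((α - 1) * D.gen Q + S Q + U Q + levf (F Q) + levg (G Q)) ≤
      C ^ (1 / q) * geomConst 1 * pow2 (κ * (1 + 1 / s) / q) *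
        (pow2 (p * levf R + S R) ^ (1 / p) * y R ^ (1 / q')) := by
    intro R
    refine (h1 R).trans ?_
    refine (mul_le_mul_right (ENNReal.lintegral_mul_le_Lp_mul_Lq μ hq (hTm R).aemeasurable
      (hgm R).aemeasurable) _).trans ?_
    refine (mul_le_mul_right (mul_le_mul' (ENNReal.rpow_le_rpow (h2 R) (by positivity))
      (ENNReal.rpow_le_rpow (h3 R) (by positivity))) _).trans (le_of_eq ?_)
    rw [ENNReal.mul_rpow_of_nonneg _ _ (by positivity), ENNReal.mul_rpow_of_nonneg _ _
      (by positivity), ENNReal.mul_rpow_of_nonneg _ _ (by positivity), pow2_rpow, pow2_rpow,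
      pow2_rpow, pow2_rpow, ← ENNReal.rpow_mul, mul_one_div_cancel hq'0.ne', ENNReal.rpow_one]
    have e1 : (p * levf R + S R) * (1 / p) = levf R + S R * (q / p) * (1 / q) := by
      field_simp
    have e2 : κ * (1 + 1 / s) * (1 / q) = κ * (1 + 1 / s) / q := by ring
    rw [e1, e2, pow2_add]
    ring
  rw [← Finset.sum_fiberwise_of_maps_to (g := F) (t := ℱ) hF]
  refine (Finset.sum_le_sum fun R _ => h4 R).trans ?_
  rw [← Finset.mul_sum, mul_assoc (C ^ (1 / q) * geomConst 1 * _)]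
  refine mul_le_mul_right ?_ _
  refine (sum_rpow_mul_rpow_le ℱ _ y hp hq'0 hpq').trans ?_
  gcongr
  rw [hy, ← Finset.sum_biUnion]
  · refine Finset.sum_le_sum_of_subset fun P hP => ?_
    simp only [Finset.mem_biUnion, h𝒢F, Finset.mem_image, h𝒬F, Finset.mem_filter] at hP
    obtain ⟨R, -, Q, ⟨hQ, -⟩, rfl⟩ := hP
    exact hG Q hQ
  · intro R _ R' _ hne
    rw [Function.onFun, Finset.disjoint_left]
    intro P hP hP'
    simp only [h𝒢F, Finset.mem_image, h𝒬F, Finset.mem_filter] at hP hP'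
    obtain ⟨Q, ⟨hQ, rfl⟩, rfl⟩ := hP
    obtain ⟨Q', ⟨hQ', rfl⟩, he⟩ := hP'
    exact hne (hGF Q hQ Q' hQ' he.symm)

/-- The part of the bilinear form where both stopping intervals are the halves of `Q` itself. -/
theorem diagonal_part {ι : Type} (𝒬 : Finset ι) {p q q' α s κ : ℝ} (hp : 1 < p)
    (hq : q.HolderConjugate q') (hα : 0 < α) (hpq : q / p = 1 + α * q) (hs : s = q - q / p)
    (S U : ι → ℝ) (gen levf levg : ι → ℤ)
    (hK : ∀ Q, U Q + s * S Q ≤ κ + (1 + s) * gen Q) :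
    ∑ Q ∈ 𝒬, pow2 ((α - 1) * gen Q + S Q + U Q + levf Q + levg Q) ≤
      pow2 (κ / q) * ((∑ R ∈ 𝒬, pow2 (p * levf R + S R)) ^ (1 / p) *
          (∑ R ∈ 𝒬, pow2 (q' * levg R + U R)) ^ (1 / q')) := by
  have hq0 := hq.pos
  have hq'0 := hq.symm.pos
  have hp0 : 0 < p := by linarith
  have hsum := hq.inv_add_inv_eq_one
  have h1 : 1 / p = 1 / q + α := by
    field_simp at hpq ⊢; linarith
  have hpq' : 1 ≤ 1 / p + 1 / q' := by
    simp only [one_div] at h1 ⊢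
    linarith
  refine le_trans ?_ (mul_le_mul_right (sum_rpow_mul_rpow_le 𝒬 _ _ hp hq'0 hpq') _)
  rw [Finset.mul_sum]
  refine Finset.sum_le_sum fun Q _ => ?_
  rw [pow2_rpow, pow2_rpow, ← pow2_add, ← pow2_add, pow2_le]
  have h2 : (U Q + s * S Q) / q ≤ (κ + (1 + s) * gen Q) / q :=
    div_le_div_of_nonneg_right (hK Q) hq0.le
  have e1 : (p * levf Q + S Q) * (1 / p) = levf Q + S Q * (1 / p) := by field_simp
  have e2 : (q' * levg Q + U Q) * (1 / q') = levg Q + U Q * (1 / q') := by field_simp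
  have e3 : 1 / q' = 1 - 1 / q := by simp only [one_div]; linarith
  have e4 : (U Q + s * S Q) / q = U Q * (1 / q) + S Q * (1 - 1 / p) := by
    rw [hs]; field_simp
  have e5 : (κ + (1 + s) * gen Q) / q = κ / q + (1 - α) * gen Q := by
    have : (1 + s) / q = 1 - α := by
      have : s = q - 1 - α * q := by rw [hs, hpq]; ring
      rw [this]; field_simp; ring
    rw [add_div, mul_div_right_comm, this]
  rw [e4, e5] at h2
  rw [e1, e2, e3]
  linarith

/-- A function in `L ^ p` is integrable on sets of finite measure. -/
theorem setLIntegral_ne_top {p p' : ℝ} (hp : p.HolderConjugate p') (μ : Measure ℝ)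
    {f : ℝ → ℝ≥0∞} (hf : AEMeasurable f μ) (hfp : ∫⁻ x, f x ^ p ∂μ ≠ ∞) {E : Set ℝ}
    (hE : MeasurableSet E) (hμ : μ E ≠ ∞) : ∫⁻ x in E, f x ∂μ ≠ ∞ := by
  have h1 := ENNReal.lintegral_mul_le_Lp_mul_Lq μ hp hf
    (g := E.indicator fun _ => 1) (measurable_const.indicator hE).aemeasurable
  have h2 : ∫⁻ x in E, f x ∂μ = ∫⁻ x, (f * E.indicator (fun _ => 1) : ℝ → ℝ≥0∞) x ∂μ := by
    rw [← lintegral_indicator hE]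
    refine lintegral_congr fun x => ?_
    by_cases hx : x ∈ E <;> simp [hx]
  have h3 : ∫⁻ x, (E.indicator (fun _ => (1 : ℝ≥0∞)) x) ^ p' ∂μ = μ E := by
    rw [← lintegral_indicator_one hE]
    refine lintegral_congr fun x => ?_
    by_cases hx : x ∈ E <;> simp [hx, hp.symm.pos]
  rw [← h2, h3] at h1
  refine ne_top_of_le_ne_top (ENNReal.mul_ne_top ?_ ?_) h1
  · exact ENNReal.rpow_ne_top_of_nonneg (one_div_nonneg.2 hp.pos.le) hfp
  · exact ENNReal.rpow_ne_top_of_nonneg (one_div_nonneg.2 hp.symm.pos.le) hμ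

/-- The bound for the bilinear form of a split system, by a parallel stopping time argument: to each
`Q` correspond the smallest records `F Q` and `G Q` of the averages of `f` over left halves and of
`g` over right halves that contain the halves of `Q`. -/
theorem form_bound {p p' q q' α s : ℝ} (hp : p.HolderConjugate p') (hq : q.HolderConjugate q')
    (hα : 0 < α) (hpq : q / p = 1 + α * q) (hs : s = q - q / p) :
    ∃ C : ℝ≥0∞, C ≠ ∞ ∧ ∀ (ι : Type) (D : SplitSystem ι) (κ : ℝ) (S U : ι → ℝ)
      (μ ν : Measure ℝ) (h h' : ℝ → ℝ≥0∞), 0 ≤ κ →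
      IsDualDensity μ ν s h → IsDualDensity ν μ (1 / s) h' →
      (∀ Q, ν (D.left Q) = pow2 (S Q)) → (∀ Q, μ (D.right Q) = pow2 (U Q)) →
      (∀ Q, U Q + s * S Q ≤ κ + (1 + s) * D.gen Q) →
      ∀ (f g : ℝ → ℝ≥0∞), AEMeasurable f ν → AEMeasurable g μ →
      ∫⁻ x, f x ^ p ∂ν ≠ ∞ → ∫⁻ x, g x ^ q' ∂μ ≠ ∞ → ∀ 𝒬 : Finset ι,
      ∑ Q ∈ 𝒬, pow2 ((α - 1) * D.gen Q) * (∫⁻ x in D.left Q, f x ∂ν) *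
          (∫⁻ x in D.right Q, g x ∂μ) ≤
        C * pow2 (κ * ((1 + s) / q * max 1 (1 / s))) * (∫⁻ x, f x ^ p ∂ν) ^ (1 / p) *
          (∫⁻ x, g x ^ q' ∂μ) ^ (1 / q') := by
  have hq0 := hq.pos
  have hq'0 := hq.symm.pos
  have hp0 := hp.pos
  have hp'0 := hp.symm.pos
  have hsump := hp.inv_add_inv_eq_one
  have hsumq := hq.inv_add_inv_eq_one
  have hs0 : 0 < s := by
    rw [hs, sub_pos, div_lt_iff₀ hp0]; nlinarith [hp.lt]
  have hpi : 1 / p = 1 / q + α := by field_simp at hpq ⊢; linarith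
  have hp'i : 1 / p' = 1 - 1 / p := by simp only [one_div]; linarith
  have hq'i : 1 / q' = 1 - 1 / q := by simp only [one_div]; linarith
  have hsi : s = q / p' := by
    rw [hs, div_eq_mul_one_div q p', hp'i]; ring
  have hpq' : p' / q' = 1 + α * p' := by
    rw [div_eq_mul_one_div p' q', hq'i]
    have : 1 - 1 / q = 1 / p' + α := by linarith
    rw [this]; field_simp
  have hs' : 1 / s = p' - p' / q' := by
    rw [hsi, div_eq_mul_one_div p' q', hq'i]; field_simp; ring
  obtain ⟨C₁, hC₁, hA⟩ := corona_part hp.lt hq hα hpq hs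
  obtain ⟨C₂, hC₂, hB⟩ := corona_part hq.symm.lt hp.symm hα hpq' hs'
  set Cf := (geomConst (p - 1) ^ p) ^ (1 / p) with hCf
  set Cg := (geomConst (q' - 1) ^ q') ^ (1 / q') with hCg
  have hCft : Cf ≠ ∞ := ENNReal.rpow_ne_top_of_nonneg (by positivity)
    (ENNReal.rpow_ne_top_of_nonneg hp0.le (geomConst_ne_top (sub_pos.2 hp.lt)))
  have hCgt : Cg ≠ ∞ := ENNReal.rpow_ne_top_of_nonneg (by positivity)
    (ENNReal.rpow_ne_top_of_nonneg hq'0.le (geomConst_ne_top (sub_pos.2 hq.symm.lt)))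
  refine ⟨4 * (1 + 2 * C₁ + 2 * C₂) * Cf * Cg, by finiteness, ?_⟩
  intro ι D κ S U μ ν h h' hκ hh hh' hS hU hK f g hf hg hfp hgq 𝒬
  classical
  have hK' : ∀ Q, S Q + 1 / s * U Q ≤ κ / s + (1 + 1 / s) * D.swap.gen Q := by
    intro Q
    have h1 : (U Q + s * S Q) / s ≤ (κ + (1 + s) * D.gen Q) / s :=
      div_le_div_of_nonneg_right (hK Q) hs0.le
    have e1 : (U Q + s * S Q) / s = S Q + 1 / s * U Q := by field_simp; ring
    have e2 : (κ + (1 + s) * D.gen Q) / s = κ / s + (1 + 1 / s) * D.gen Q := by field_simp; ring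
    rw [e1, e2] at h1
    exact h1
  set β := (1 + s) / q * max 1 (1 / s) with hβ
  have hβ1 : (1 + s) / q ≤ β := le_mul_of_one_le_right (by positivity) (le_max_left _ _)
  have hβ2 : (1 + 1 / s) / q ≤ β := by
    have : (1 + 1 / s) / q = (1 + s) / q * (1 / s) := by field_simp; ring
    rw [this, hβ]
    gcongr
    exact le_max_right _ _
  have hκ1 : pow2 (κ * (1 + 1 / s) / q) ≤ pow2 (κ * β) := by
    rw [pow2_le, mul_div_assoc]; gcongr
  have hκ2 : pow2 (κ / s * (1 + 1 / (1 / s)) / p') ≤ pow2 (κ * β) := by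
    rw [pow2_le]
    have : κ / s * (1 + 1 / (1 / s)) / p' = κ * ((1 + s) / q) := by
      rw [hsi]; field_simp
    rw [this]; gcongr
  have hκ3 : pow2 (κ / q) ≤ pow2 (κ * β) := by
    rw [pow2_le, div_eq_mul_one_div]
    gcongr
    refine le_trans ?_ hβ1
    gcongr; linarith
  -- the averages of `f` and `g`, after discarding the intervals that contribute nothing
  set 𝒬₀ := 𝒬.filter fun Q => (∫⁻ x in D.left Q, f x ∂ν) ≠ 0 ∧ (∫⁻ x in D.right Q, g x ∂μ) ≠ 0
    with h𝒬₀
  have hfex : ∀ Q, ∃ t, Q ∈ 𝒬₀ → (∫⁻ x in D.left Q, f x ∂ν) = pow2 t := by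
    intro Q
    by_cases hQ : Q ∈ 𝒬₀
    · obtain ⟨t, ht⟩ := exists_pow2 (Finset.mem_filter.1 hQ).2.1
        (setLIntegral_ne_top hp ν hf hfp (D.measurableSet_left Q) (by rw [hS]; exact pow2_ne_top _))
      exact ⟨t, fun _ => ht⟩
    · exact ⟨0, fun h => absurd h hQ⟩
  have hgex : ∀ Q, ∃ t, Q ∈ 𝒬₀ → (∫⁻ x in D.right Q, g x ∂μ) = pow2 t := by
    intro Q
    by_cases hQ : Q ∈ 𝒬₀
    · obtain ⟨t, ht⟩ := exists_pow2 (Finset.mem_filter.1 hQ).2.2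
        (setLIntegral_ne_top hq.symm μ hg hgq (D.measurableSet_right Q)
          (by rw [hU]; exact pow2_ne_top _))
      exact ⟨t, fun _ => ht⟩
    · exact ⟨0, fun h => absurd h hQ⟩
  choose φ hφ using hfex
  choose γ hγ using hgex
  set levf : ι → ℤ := fun Q => ⌊φ Q - S Q⌋ with hlevf
  set levg : ι → ℤ := fun Q => ⌊γ Q - U Q⌋ with hlevg
  set ℱ := records D.left levf 𝒬₀ with hℱ
  set 𝒢 := records D.right levg 𝒬₀ with h𝒢
  have hFex : ∀ Q, ∃ R, Q ∈ 𝒬₀ → R ∈ ℱ ∧ D.left Q ⊆ D.left R ∧ levf Q ≤ levf R ∧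
      ∀ R' ∈ ℱ, D.left Q ⊆ D.left R' → D.left R ⊆ D.left R' := by
    intro Q
    by_cases hQ : Q ∈ 𝒬₀
    · obtain ⟨R, h1, h2⟩ := exists_record D.isLaminar_left (lev := levf) hQ
      exact ⟨R, fun _ => ⟨h1, h2⟩⟩
    · exact ⟨Q, fun h => absurd h hQ⟩
  have hGex : ∀ Q, ∃ R, Q ∈ 𝒬₀ → R ∈ 𝒢 ∧ D.right Q ⊆ D.right R ∧ levg Q ≤ levg R ∧
      ∀ R' ∈ 𝒢, D.right Q ⊆ D.right R' → D.right R ⊆ D.right R' := by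
    intro Q
    by_cases hQ : Q ∈ 𝒬₀
    · obtain ⟨R, h1, h2⟩ := exists_record D.isLaminar_right (lev := levg) hQ
      exact ⟨R, fun _ => ⟨h1, h2⟩⟩
    · exact ⟨Q, fun h => absurd h hQ⟩
  choose F hF using hFex
  choose G hG using hGex
  have hinjF : ∀ x, ∀ Q ∈ ℱ, ∀ R ∈ ℱ, x ∈ D.left Q → x ∈ D.left R → levf Q = levf R → Q = R :=
    fun x Q hQ R hR hxQ hxR hl => records_lev_inj D.isLaminar_left hQ hR hxQ hxR hl
  have hinjG : ∀ x, ∀ Q ∈ 𝒢, ∀ R ∈ 𝒢, x ∈ D.right Q → x ∈ D.right R → levg Q = levg R → Q = R :=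
    fun x Q hQ R hR hxQ hxR hl => records_lev_inj D.isLaminar_right hQ hR hxQ hxR hl
  set X := (∑ R ∈ ℱ, pow2 (p * levf R + S R)) ^ (1 / p) with hX
  set Y := (∑ R ∈ 𝒢, pow2 (q' * levg R + U R)) ^ (1 / q') with hY
  set Nf := (∫⁻ x, f x ^ p ∂ν) ^ (1 / p) with hNf
  set Ng := (∫⁻ x, g x ^ q' ∂μ) ^ (1 / q') with hNg
  have hXle : X ≤ Cf * Nf := by
    have h1 := carleson_embedding hp ℱ levf D.measurableSet_left hinjF ν hf
      (fun Q _ => by rw [hS]; exact pow2_ne_top _) (fun Q hQ => by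
        rw [hφ Q (mem_records.1 hQ).1, hS, ← pow2_add, pow2_le]
        have : (levf Q : ℝ) ≤ φ Q - S Q := Int.floor_le _
        linarith) MeasurableSet.univ (fun Q _ => subset_univ _)
    rw [setLIntegral_univ] at h1
    rw [hX, hCf, hNf, ← ENNReal.mul_rpow_of_nonneg _ _ (by positivity)]
    refine ENNReal.rpow_le_rpow ((Finset.sum_le_sum fun Q _ => ?_).trans h1) (by positivity)
    rw [hS, pow2_add]
  have hYle : Y ≤ Cg * Ng := by
    have h1 := carleson_embedding hq.symm 𝒢 levg D.measurableSet_right hinjG μ hg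
      (fun Q _ => by rw [hU]; exact pow2_ne_top _) (fun Q hQ => by
        rw [hγ Q (mem_records.1 hQ).1, hU, ← pow2_add, pow2_le]
        have : (levg Q : ℝ) ≤ γ Q - U Q := Int.floor_le _
        linarith) MeasurableSet.univ (fun Q _ => subset_univ _)
    rw [setLIntegral_univ] at h1
    rw [hY, hCg, hNg, ← ENNReal.mul_rpow_of_nonneg _ _ (by positivity)]
    refine ENNReal.rpow_le_rpow ((Finset.sum_le_sum fun Q _ => ?_).trans h1) (by positivity)
    rw [hU, pow2_add]
  set t : ι → ℝ≥0∞ := fun Q =>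
    pow2 ((α - 1) * D.gen Q + S Q + U Q + levf (F Q) + levg (G Q)) with ht
  have hterm : ∑ Q ∈ 𝒬, pow2 ((α - 1) * D.gen Q) * (∫⁻ x in D.left Q, f x ∂ν) *
      (∫⁻ x in D.right Q, g x ∂μ) ≤ 4 * ∑ Q ∈ 𝒬₀, t Q := by
    have h1 : ∑ Q ∈ 𝒬, pow2 ((α - 1) * D.gen Q) * (∫⁻ x in D.left Q, f x ∂ν) *
      (∫⁻ x in D.right Q, g x ∂μ) = ∑ Q ∈ 𝒬₀, pow2 ((α - 1) * D.gen Q) *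
        (∫⁻ x in D.left Q, f x ∂ν) * (∫⁻ x in D.right Q, g x ∂μ) := by
      rw [h𝒬₀]
      symm
      refine Finset.sum_filter_of_ne fun Q _ hne => ⟨fun h0 => hne ?_, fun h0 => hne ?_⟩ <;>
        simp [h0]
    rw [h1, Finset.mul_sum]
    refine Finset.sum_le_sum fun Q hQ => ?_
    have e4 : (4 : ℝ≥0∞) = pow2 (1 + 1) := by rw [pow2_add, pow2_one]; norm_num
    rw [hφ Q hQ, hγ Q hQ, ← pow2_add, ← pow2_add, e4, ht, ← pow2_add, pow2_le]
    have a1 : φ Q - S Q < levf Q + 1 := Int.lt_floor_add_one _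
    have a2 : γ Q - U Q < levg Q + 1 := Int.lt_floor_add_one _
    have a3 : (levf Q : ℝ) ≤ levf (F Q) := by exact_mod_cast (hF Q hQ).2.2.1
    have a4 : (levg Q : ℝ) ≤ levg (G Q) := by exact_mod_cast (hG Q hQ).2.2.1
    linarith
  have hAle : ∀ 𝒬' ⊆ 𝒬₀, (∀ Q ∈ 𝒬', D.left Q ∪ D.right Q ⊆ D.left (F Q)) →
      (∀ Q ∈ 𝒬', ∀ R ∈ 𝒬', G Q = G R → F Q = F R) →
      ∑ Q ∈ 𝒬', t Q ≤ C₁ * (pow2 (κ * β) * (X * Y)) := by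
    intro 𝒬' hsub h1 h2
    refine (hA ι D κ S U μ ν h hh hS hU hK 𝒬' ℱ 𝒢 F G levf levg (fun Q hQ => (hF Q (hsub hQ)).1)
      (fun Q hQ => (hG Q (hsub hQ)).1) h1 (fun Q hQ => (hG Q (hsub hQ)).2.1) h2 hinjG).trans ?_
    rw [mul_assoc, mul_assoc]
    gcongr
  have hBle : ∀ 𝒬' ⊆ 𝒬₀, (∀ Q ∈ 𝒬', D.left Q ∪ D.right Q ⊆ D.right (G Q)) →
      (∀ Q ∈ 𝒬', ∀ R ∈ 𝒬', F Q = F R → G Q = G R) →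
      ∑ Q ∈ 𝒬', t Q ≤ C₂ * (pow2 (κ * β) * (X * Y)) := by
    intro 𝒬' hsub h1 h2
    have h3 := hB ι D.swap (κ / s) U S ν μ h' hh' hU hS hK' 𝒬' 𝒢 ℱ G F levg levf
      (fun Q hQ => (hG Q (hsub hQ)).1) (fun Q hQ => (hF Q (hsub hQ)).1)
      (fun Q hQ => by rw [union_comm]; exact h1 Q hQ) (fun Q hQ => (hF Q (hsub hQ)).2.1) h2 hinjF
    calc ∑ Q ∈ 𝒬', t Q = ∑ Q ∈ 𝒬', pow2 ((α - 1) * D.swap.gen Q + U Q + S Q + levg (G Q) +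
          levf (F Q)) := by
          refine Finset.sum_congr rfl fun Q _ => ?_
          refine congrArg pow2 ?_
          change _ = (α - 1) * D.gen Q + U Q + S Q + levg (G Q) + levf (F Q)
          ring
      _ ≤ C₂ * pow2 (κ / s * (1 + 1 / (1 / s)) / p') * Y * X := h3
      _ ≤ C₂ * pow2 (κ * β) * Y * X := by gcongr
      _ = _ := by ring
  set P₁ := 𝒬₀.filter fun Q => D.left Q ∪ D.right Q ⊆ D.left (F Q) ∧
    D.left Q ∪ D.right Q ⊆ D.right (G Q) ∧ D.right (G Q) ⊆ D.left (F Q) with hP₁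
  set P₂ := 𝒬₀.filter fun Q => D.left Q ∪ D.right Q ⊆ D.left (F Q) ∧ G Q = Q with hP₂
  set P₃ := 𝒬₀.filter fun Q => D.left Q ∪ D.right Q ⊆ D.right (G Q) ∧
    D.left Q ∪ D.right Q ⊆ D.left (F Q) ∧ D.left (F Q) ⊆ D.right (G Q) with hP₃
  set P₄ := 𝒬₀.filter fun Q => D.left Q ∪ D.right Q ⊆ D.right (G Q) ∧ F Q = Q with hP₄
  set P₅ := 𝒬₀.filter fun Q => F Q = Q ∧ G Q = Q with hP₅
  have h1 : ∑ Q ∈ P₁, t Q ≤ C₁ * (pow2 (κ * β) * (X * Y)) := by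
    refine hAle P₁ (Finset.filter_subset _ _) (fun Q hQ => (Finset.mem_filter.1 hQ).2.1) ?_
    have key : ∀ Q ∈ P₁, ∀ R ∈ P₁, G Q = G R → D.left (F Q) ⊆ D.left (F R) := by
      intro Q hQ R hR he
      obtain ⟨hQ0, h1, h2, h3⟩ := Finset.mem_filter.1 hQ
      obtain ⟨hR0, h1', h2', h3'⟩ := Finset.mem_filter.1 hR
      refine (hF Q hQ0).2.2.2 _ (hF R hR0).1 ((subset_union_left.trans h2).trans ?_)
      rw [he]; exact h3'
    exact fun Q hQ R hR he =>
      D.isLaminar_left.eq_of_subset (key Q hQ R hR he) (key R hR Q hQ he.symm)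
  have h2 : ∑ Q ∈ P₂, t Q ≤ C₁ * (pow2 (κ * β) * (X * Y)) := by
    refine hAle P₂ (Finset.filter_subset _ _) (fun Q hQ => (Finset.mem_filter.1 hQ).2.1) ?_
    intro Q hQ R hR he
    rw [(Finset.mem_filter.1 hQ).2.2, (Finset.mem_filter.1 hR).2.2] at he
    rw [he]
  have h3 : ∑ Q ∈ P₃, t Q ≤ C₂ * (pow2 (κ * β) * (X * Y)) := by
    refine hBle P₃ (Finset.filter_subset _ _) (fun Q hQ => (Finset.mem_filter.1 hQ).2.1) ?_
    have key : ∀ Q ∈ P₃, ∀ R ∈ P₃, F Q = F R → D.right (G Q) ⊆ D.right (G R) := by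
      intro Q hQ R hR he
      obtain ⟨hQ0, h1, h2, h3⟩ := Finset.mem_filter.1 hQ
      obtain ⟨hR0, h1', h2', h3'⟩ := Finset.mem_filter.1 hR
      refine (hG Q hQ0).2.2.2 _ (hG R hR0).1 ((subset_union_right.trans h2).trans ?_)
      rw [he]; exact h3'
    exact fun Q hQ R hR he =>
      D.isLaminar_right.eq_of_subset (key Q hQ R hR he) (key R hR Q hQ he.symm)
  have h4 : ∑ Q ∈ P₄, t Q ≤ C₂ * (pow2 (κ * β) * (X * Y)) := by
    refine hBle P₄ (Finset.filter_subset _ _) (fun Q hQ => (Finset.mem_filter.1 hQ).2.1) ?_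
    intro Q hQ R hR he
    rw [(Finset.mem_filter.1 hQ).2.2, (Finset.mem_filter.1 hR).2.2] at he
    rw [he]
  have h5 : ∑ Q ∈ P₅, t Q ≤ pow2 (κ * β) * (X * Y) := by
    have hP5F : P₅ ⊆ ℱ := fun Q hQ => by
      obtain ⟨h0, h1, -⟩ := Finset.mem_filter.1 hQ
      have := (hF Q h0).1
      rwa [h1] at this
    have hP5G : P₅ ⊆ 𝒢 := fun Q hQ => by
      obtain ⟨h0, -, h1⟩ := Finset.mem_filter.1 hQ
      have := (hG Q h0).1
      rwa [h1] at this
    have e1 : ∑ Q ∈ P₅, t Q =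
        ∑ Q ∈ P₅, pow2 ((α - 1) * D.gen Q + S Q + U Q + levf Q + levg Q) := by
      refine Finset.sum_congr rfl fun Q hQ => ?_
      obtain ⟨-, h1, h2⟩ := Finset.mem_filter.1 hQ
      simp only [ht, h1, h2]
    rw [e1]
    refine (diagonal_part P₅ hp.lt hq hα hpq hs S U D.gen levf levg hK).trans ?_
    refine mul_le_mul' hκ3 (mul_le_mul' ?_ ?_)
    · exact ENNReal.rpow_le_rpow (Finset.sum_le_sum_of_subset hP5F) (by positivity)
    · exact ENNReal.rpow_le_rpow (Finset.sum_le_sum_of_subset hP5G) (by positivity)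
  have hcover : ∑ Q ∈ 𝒬₀, t Q ≤ ∑ Q ∈ P₁, t Q + ∑ Q ∈ P₂, t Q + ∑ Q ∈ P₃, t Q + ∑ Q ∈ P₄, t Q +
      ∑ Q ∈ P₅, t Q := by
    simp only [hP₁, hP₂, hP₃, hP₄, hP₅, Finset.sum_filter, ← Finset.sum_add_distrib]
    refine Finset.sum_le_sum fun Q hQ => ?_
    have hFQ := (hF Q hQ).2.1
    have hGQ := (hG Q hQ).2.1
    by_cases c1 : F Q = Q
    · by_cases c2 : G Q = Q
      · simp only [c1, c2, and_self, if_true]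
        exact le_add_self
      · have c3 := D.subset_right_of_ne hGQ (Ne.symm c2)
        rw [if_pos (show D.left Q ∪ D.right Q ⊆ D.right (G Q) ∧ F Q = Q from ⟨c3, c1⟩)]
        exact le_add_right le_add_self
    · have c4 := D.subset_left_of_ne hFQ (Ne.symm c1)
      by_cases c2 : G Q = Q
      · rw [if_pos (show D.left Q ∪ D.right Q ⊆ D.left (F Q) ∧ G Q = Q from ⟨c4, c2⟩)]
        exact le_add_right (le_add_right (le_add_right le_add_self))
      · have c3 := D.subset_right_of_ne hGQ (Ne.symm c2)
        rcases D.left_right_nested c4 c3 with c5 | c5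
        · rw [if_pos (show D.left Q ∪ D.right Q ⊆ D.right (G Q) ∧
            D.left Q ∪ D.right Q ⊆ D.left (F Q) ∧ D.left (F Q) ⊆ D.right (G Q) from ⟨c3, c4, c5⟩)]
          exact le_add_right (le_add_right le_add_self)
        · rw [if_pos (show D.left Q ∪ D.right Q ⊆ D.left (F Q) ∧
            D.left Q ∪ D.right Q ⊆ D.right (G Q) ∧ D.right (G Q) ⊆ D.left (F Q) from
              ⟨c4, c3, c5⟩)]
          exact le_add_right (le_add_right (le_add_right (le_add_right le_rfl)))
  calc _ ≤ 4 * ∑ Q ∈ 𝒬₀, t Q := hterm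
    _ ≤ 4 * (C₁ * (pow2 (κ * β) * (X * Y)) + C₁ * (pow2 (κ * β) * (X * Y)) +
        C₂ * (pow2 (κ * β) * (X * Y)) + C₂ * (pow2 (κ * β) * (X * Y)) +
        pow2 (κ * β) * (X * Y)) := by
        gcongr
        exact hcover.trans (by gcongr)
    _ = 4 * (1 + 2 * C₁ + 2 * C₂) * pow2 (κ * β) * (X * Y) := by ring
    _ ≤ 4 * (1 + 2 * C₁ + 2 * C₂) * pow2 (κ * β) * ((Cf * Nf) * (Cg * Ng)) := by gcongr
    _ = _ := by ring

/-! ### Dyadic grids -/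

/-- The offsets of a shifted dyadic grid, with cells
`[2 ^ k (j + off k), 2 ^ k (j + 1 + off k))` of generation `k`; the relation between consecutive
offsets makes the grid nested. -/
structure GridOffset where
  /-- the offset of generation `k`, in units of `2 ^ k` -/
  off : ℤ → ℝ
  /-- the index shift from generation `k + 1` to generation `k` -/
  shift : ℤ → ℤ
  two_mul_off : ∀ k, 2 * off (k + 1) = off k + shift k

namespace GridOffset

variable (c : GridOffset)

/-- The index of the cell of generation `k` that contains `x`. -/
noncomputable def idx (k : ℤ) (x : ℝ) : ℤ := ⌊x / 2 ^ k - c.off k⌋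

theorem idx_succ (k : ℤ) (x : ℝ) : c.idx (k + 1) x = (c.idx k x - c.shift k) / 2 := by
  have h1 : x / 2 ^ (k + 1) - c.off (k + 1) = ((x / 2 ^ k - c.off k) - c.shift k) / 2 := by
    have h2 := c.two_mul_off k
    have h3 : (2 : ℝ) ^ (k + 1) = 2 ^ k * 2 := zpow_add_one₀ (by norm_num) k
    have h4 : (2 : ℝ) ^ k ≠ 0 := by positivity
    rw [h3]
    field_simp
    linear_combination (-(2 : ℝ) ^ k) * h2
  rw [idx, h1, idx, ← Int.floor_sub_intCast]
  generalize x / 2 ^ k - c.off k - c.shift k = y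
  rw [Int.floor_eq_iff]
  have h5 := Int.floor_le y
  have h6 := Int.lt_floor_add_one y
  have h7 : ((2 * (⌊y⌋ / 2) : ℤ) : ℝ) ≤ ⌊y⌋ := by exact_mod_cast (by omega)
  have h8 : (⌊y⌋ + 1 : ℝ) ≤ ((2 * (⌊y⌋ / 2) + 2 : ℤ) : ℝ) := by exact_mod_cast (by omega)
  push_cast at h7 h8
  constructor <;> linarith

theorem idx_eq_of_le {k k' : ℤ} (hk : k ≤ k') {x y : ℝ} (h : c.idx k x = c.idx k y) :
    c.idx k' x = c.idx k' y := by
  induction k', hk using Int.leInduction with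
  | base => exact h
  | succ n _ ih => rw [idx_succ, idx_succ, ih]

theorem idx_mono (k : ℤ) {x y : ℝ} (h : x ≤ y) : c.idx k x ≤ c.idx k y := by
  unfold idx
  gcongr

theorem setOf_idx_eq (k i : ℤ) :
    {x | c.idx k x = i} = Ico (2 ^ k * (i + c.off k)) (2 ^ k * (i + c.off k) + 2 ^ k) := by
  ext x
  have h4 : (0 : ℝ) < 2 ^ k := by positivity
  rw [mem_ofPred_eq, idx, Int.floor_eq_iff, mem_Ico, le_sub_iff_add_le, le_div_iff₀ h4,
    sub_lt_iff_lt_add, div_lt_iff₀ h4]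
  constructor <;> rintro ⟨h1, h2⟩ <;> constructor <;> nlinarith

theorem volume_setOf_idx_eq (k i : ℤ) : volume {x | c.idx k x = i} = pow2 k := by
  rw [setOf_idx_eq, Real.volume_Ico, add_sub_cancel_left, ofReal_two_zpow]

/-- The cells of a shifted dyadic grid form a split system; `(k, j)` is the cell of index `j` and
generation `k + 1`, whose halves are cells of generation `k`. -/
noncomputable def system : SplitSystem (ℤ × ℤ) where
  left Q := {x | c.idx Q.1 x = 2 * Q.2 + c.shift Q.1}
  right Q := {x | c.idx Q.1 x = 2 * Q.2 + c.shift Q.1 + 1}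
  gen Q := Q.1
  measurableSet_left Q := by rw [setOf_idx_eq]; exact measurableSet_Ico
  measurableSet_right Q := by rw [setOf_idx_eq]; exact measurableSet_Ico
  volume_left Q := c.volume_setOf_idx_eq _ _
  volume_right Q := c.volume_setOf_idx_eq _ _
  disjoint Q := by
    rw [Set.disjoint_left]
    intro x h1 h2
    simp only [mem_ofPred_eq] at h1 h2
    omega
  split := by
    have hun : ∀ (Q : ℤ × ℤ) (x : ℝ), x ∈ ({x | c.idx Q.1 x = 2 * Q.2 + c.shift Q.1} ∪
        {x | c.idx Q.1 x = 2 * Q.2 + c.shift Q.1 + 1} : Set ℝ) ↔ c.idx (Q.1 + 1) x = Q.2 := by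
      intro Q x
      simp only [mem_union, mem_ofPred_eq, idx_succ]
      omega
    have key : ∀ Q R : ℤ × ℤ, Q.1 < R.1 →
        Disjoint ({x | c.idx Q.1 x = 2 * Q.2 + c.shift Q.1} ∪
          {x | c.idx Q.1 x = 2 * Q.2 + c.shift Q.1 + 1} : Set ℝ)
          ({x | c.idx R.1 x = 2 * R.2 + c.shift R.1} ∪
          {x | c.idx R.1 x = 2 * R.2 + c.shift R.1 + 1}) ∨
        ({x | c.idx Q.1 x = 2 * Q.2 + c.shift Q.1} ∪
          {x | c.idx Q.1 x = 2 * Q.2 + c.shift Q.1 + 1} : Set ℝ) ⊆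
          {x | c.idx R.1 x = 2 * R.2 + c.shift R.1} ∨
        ({x | c.idx Q.1 x = 2 * Q.2 + c.shift Q.1} ∪
          {x | c.idx Q.1 x = 2 * Q.2 + c.shift Q.1 + 1} : Set ℝ) ⊆
          {x | c.idx R.1 x = 2 * R.2 + c.shift R.1 + 1} := by
      intro Q R hlt
      by_cases hd : Disjoint ({x | c.idx Q.1 x = 2 * Q.2 + c.shift Q.1} ∪
          {x | c.idx Q.1 x = 2 * Q.2 + c.shift Q.1 + 1} : Set ℝ)
          ({x | c.idx R.1 x = 2 * R.2 + c.shift R.1} ∪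
          {x | c.idx R.1 x = 2 * R.2 + c.shift R.1 + 1})
      · exact Or.inl hd
      right
      obtain ⟨y, hyQ, hyR⟩ := Set.not_disjoint_iff.1 hd
      have hall : ∀ x, c.idx (Q.1 + 1) x = Q.2 → c.idx R.1 x = c.idx R.1 y := fun x hx =>
        c.idx_eq_of_le (by omega) (hx.trans ((hun Q y).1 hyQ).symm)
      rcases hyR with hyR | hyR
      · exact Or.inl fun x hx => (hall x ((hun Q x).1 hx)).trans hyR
      · exact Or.inr fun x hx => (hall x ((hun Q x).1 hx)).trans hyR
    intro Q R hne
    rcases lt_trichotomy Q.1 R.1 with h | h | h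
    · rcases key Q R h with h | h | h <;> tauto
    · left
      rw [Set.disjoint_left]
      intro x hQ hR
      rw [hun] at hQ hR
      rw [h] at hQ
      exact hne (Prod.ext h (hQ.symm.trans hR))
    · rcases key R Q h with h | h | h
      · exact Or.inl h.symm
      · tauto
      · tauto

/-- Two points in a common cell are separated by the halves of the smallest cell that contains
both. -/
theorem exists_mem_left_right {k : ℤ} {t x : ℝ} (htx : t < x) (h : c.idx k t = c.idx k x) :
    ∃ Q : ℤ × ℤ, t ∈ c.system.left Q ∧ x ∈ c.system.right Q ∧ Q.1 < k := by
  have hd : 0 < x - t := sub_pos.2 htx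
  have hb : ∀ m, c.idx m t = c.idx m x → Int.log 2 (x - t) ≤ m := by
    intro m hm
    have h1 : t ∈ {y | c.idx m y = c.idx m x} := hm
    have h2 : x ∈ {y | c.idx m y = c.idx m x} := rfl
    rw [setOf_idx_eq, mem_Ico] at h1 h2
    have h3 : x - t < (2 : ℝ) ^ m := by linarith [h1.1, h2.2]
    exact ((Int.lt_zpow_iff_log_lt (by norm_num) hd).1 (by exact_mod_cast h3)).le
  obtain ⟨m, hm, hmin⟩ := Int.exists_least_of_bdd (P := fun m => c.idx m t = c.idx m x)
    ⟨_, hb⟩ ⟨k, h⟩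
  have hne : c.idx (m - 1) t ≠ c.idx (m - 1) x := fun he => by
    have := hmin _ he
    omega
  have hle := c.idx_mono (m - 1) htx.le
  have h1 := c.idx_succ (m - 1) t
  have h2 := c.idx_succ (m - 1) x
  rw [sub_add_cancel] at h1 h2
  have hmk := hmin k h
  refine ⟨(m - 1, c.idx m t), ?_, ?_, by simp only; omega⟩
  · change c.idx (m - 1) t = 2 * c.idx m t + c.shift (m - 1)
    omega
  · change c.idx (m - 1) x = 2 * c.idx m t + c.shift (m - 1) + 1
    omega

/-- The standard dyadic grid. -/
def standard : GridOffset where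
  off _ := 0
  shift _ := 0
  two_mul_off k := by simp

/-- The dyadic grid shifted by one third of a cell in every generation. -/
noncomputable def third : GridOffset where
  off k := (-1) ^ k / 3
  shift k := -(-1) ^ k.natAbs
  two_mul_off k := by
    have h1 : (-1 : ℝ) ^ (k + 1) = -(-1) ^ k := by
      rw [zpow_add_one₀ (by norm_num)]; ring
    have h2 : ((-1 : ℝ) ^ k.natAbs) = (-1) ^ k := by
      rcases Int.natAbs_eq k with h | h
      · conv_rhs => rw [h, zpow_natCast]
      · conv_rhs => rw [h]
        rw [zpow_neg, zpow_natCast, ← inv_pow]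
        norm_num
    push_cast
    rw [h1, h2]
    ring

/-- The one-third trick: two points at distance less than `2 ^ k / 3` share a cell of generation `k`
in one of the two grids, since the end points of the two grids are `2 ^ k / 3` apart. -/
theorem idx_eq_or {k : ℤ} {t x : ℝ} (htx : t < x) (hd : 3 * (x - t) < 2 ^ k) :
    standard.idx k t = standard.idx k x ∨ third.idx k t = third.idx k x := by
  by_contra! hcon
  have hpos : (0 : ℝ) < 2 ^ k := by positivity
  have key : ∀ c : GridOffset, c.idx k t ≠ c.idx k x →
      ∃ i : ℤ, t / 2 ^ k < i + c.off k ∧ i + c.off k ≤ x / 2 ^ k := by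
    intro c hne
    have hlt : c.idx k t < c.idx k x := lt_of_le_of_ne (c.idx_mono k htx.le) hne
    refine ⟨c.idx k x, ?_, ?_⟩
    · have h1 := (Int.floor_lt (a := t / 2 ^ k - c.off k)).1 hlt
      linarith
    · have h2 : ((c.idx k x : ℤ) : ℝ) ≤ x / 2 ^ k - c.off k := Int.floor_le _
      linarith
  obtain ⟨i, hi1, hi2⟩ := key standard hcon.1
  obtain ⟨j, hj1, hj2⟩ := key third hcon.2
  have hd' : x / 2 ^ k - t / 2 ^ k < 1 / 3 := by
    rw [← sub_div, div_lt_iff₀ hpos]; linarith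
  have e0 : standard.off k = 0 := rfl
  have e1 : third.off k = (-1) ^ k / 3 := rfl
  rw [e0] at hi1 hi2
  rw [e1] at hj1 hj2
  have h3 : |(3 * (i - j) : ℝ) - (-1) ^ k| < 1 := by
    rw [abs_lt]; constructor <;> linarith
  rcases Int.even_or_odd k with hk | hk
  · rw [hk.neg_one_zpow] at h3
    have h4 : |3 * (i - j) - 1| < 1 := by exact_mod_cast h3
    rw [abs_lt] at h4
    omega
  · rw [hk.neg_one_zpow] at h3
    have h4 : |3 * (i - j) - -1| < 1 := by exact_mod_cast h3
    rw [abs_lt] at h4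
    omega

end GridOffset

/-- The kernel `(x - t) ^ (α - 1)` is dominated by the kernels of the two grids. -/
theorem kernel_le {α : ℝ} (hα : α < 1) {t x : ℝ} (htx : t < x) :
    ∃ c ∈ ({GridOffset.standard, GridOffset.third} : Set GridOffset), ∃ Q : ℤ × ℤ,
      t ∈ c.system.left Q ∧ x ∈ c.system.right Q ∧
      ENNReal.ofReal ((x - t) ^ (α - 1)) ≤
        ENNReal.ofReal (3 ^ (1 - α)) * pow2 ((α - 1) * Q.1) := by
  have hd : 0 < x - t := sub_pos.2 htx
  set k := Int.log 2 (3 * (x - t)) + 1 with hk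
  have h1 : 3 * (x - t) < (2 : ℝ) ^ k := by
    exact_mod_cast Int.lt_zpow_succ_log_self (b := 2) (by norm_num) (3 * (x - t))
  have h2 : (2 : ℝ) ^ (k - 1) ≤ 3 * (x - t) := by
    rw [hk, add_sub_cancel_right]
    exact_mod_cast Int.zpow_log_le_self (b := 2) (by norm_num) (by linarith : 0 < 3 * (x - t))
  have main : ∀ c : GridOffset, c.idx k t = c.idx k x → ∃ Q : ℤ × ℤ,
      t ∈ c.system.left Q ∧ x ∈ c.system.right Q ∧
      ENNReal.ofReal ((x - t) ^ (α - 1)) ≤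
        ENNReal.ofReal (3 ^ (1 - α)) * pow2 ((α - 1) * Q.1) := by
    intro c hc
    obtain ⟨Q, hl, hr, hQ⟩ := c.exists_mem_left_right htx hc
    refine ⟨Q, hl, hr, ?_⟩
    have h3 : (2 : ℝ) ^ Q.1 ≤ 3 * (x - t) :=
      (zpow_le_zpow_right₀ (by norm_num) (by omega : Q.1 ≤ k - 1)).trans h2
    have h4 : pow2 ((α - 1) * Q.1) = ENNReal.ofReal ((2 ^ Q.1) ^ (α - 1)) := by
      rw [← ENNReal.ofReal_rpow_of_pos (by positivity), ofReal_two_zpow, pow2_rpow, mul_comm]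
    rw [h4, ← ENNReal.ofReal_mul (by positivity)]
    refine ENNReal.ofReal_le_ofReal ?_
    have h5 : (x - t) ^ (α - 1) = 3 ^ (1 - α) * (3 * (x - t)) ^ (α - 1) := by
      rw [Real.mul_rpow (by norm_num) hd.le, ← mul_assoc, ← Real.rpow_add (by norm_num)]
      simp
    rw [h5]
    gcongr 3 ^ (1 - α) * ?_
    exact Real.rpow_le_rpow_of_nonpos (by positivity) h3 (by linarith)
  rcases GridOffset.idx_eq_or htx h1 with h | h
  · exact ⟨_, by simp, main _ h⟩
  · exact ⟨_, by simp, main _ h⟩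

/-! ### The strong type bound -/

/-- The strong type bound for finite parts of the dyadic operator, by duality from the bound of the
bilinear form: test it with the power `q - 1` of the operator itself. -/
theorem lintegral_chainSum_rpow_le {p p' q q' α s : ℝ} (hp : p.HolderConjugate p')
    (hq : q.HolderConjugate q') (hα : 0 < α) (hpq : q / p = 1 + α * q) (hs : s = q - q / p) :
    ∃ C : ℝ≥0∞, C ≠ ∞ ∧ ∀ (ι : Type) (D : SplitSystem ι) (κ : ℝ) (S U : ι → ℝ)
      (μ ν : Measure ℝ) (h h' : ℝ → ℝ≥0∞), 0 ≤ κ →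
      IsDualDensity μ ν s h → IsDualDensity ν μ (1 / s) h' →
      (∀ Q, ν (D.left Q) = pow2 (S Q)) → (∀ Q, μ (D.right Q) = pow2 (U Q)) →
      (∀ Q, U Q + s * S Q ≤ κ + (1 + s) * D.gen Q) →
      ∀ f : ℝ → ℝ≥0∞, AEMeasurable f ν → ∫⁻ x, f x ^ p ∂ν ≠ ∞ → ∀ 𝒬 : Finset ι,
      ∫⁻ x, chainSum D.right 𝒬
          (fun Q => pow2 ((α - 1) * D.gen Q) * ∫⁻ t in D.left Q, f t ∂ν) x ^ q ∂μ ≤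
        (C * pow2 (κ * ((1 + s) / q * max 1 (1 / s))) * (∫⁻ x, f x ^ p ∂ν) ^ (1 / p)) ^ q := by
  obtain ⟨C, hC, hform⟩ := form_bound hp hq hα hpq hs
  refine ⟨C, hC, ?_⟩
  intro ι D κ S U μ ν h h' hκ hh hh' hS hU hK f hf hfp 𝒬
  have hm := D.measurableSet_right
  have hq0 := hq.pos
  have hq1 : 0 < q - 1 := sub_pos.2 hq.lt
  have hqq : (q - 1) * q' = q := hq.sub_one_mul_conj
  set c : ι → ℝ≥0∞ := fun Q => pow2 ((α - 1) * D.gen Q) * ∫⁻ t in D.left Q, f t ∂ν with hc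
  set T := chainSum D.right 𝒬 c with hT
  have hTm : Measurable T := measurable_chainSum hm 𝒬 c
  have hctop : ∀ Q, c Q ≠ ∞ := fun Q => ENNReal.mul_ne_top (pow2_ne_top _)
    (setLIntegral_ne_top hp ν hf hfp (D.measurableSet_left Q) (by rw [hS]; exact pow2_ne_top _))
  -- the operator is bounded with support of finite measure, so its norm is finite a priori
  have hX : ∫⁻ x, T x ^ q ∂μ ≠ ∞ := by
    have h1 : ∀ x, T x ^ q ≤ (∑ Q ∈ 𝒬, c Q) ^ (q - 1) * T x := by
      intro x
      have e1 : T x ^ q = T x ^ (q - 1) * T x := by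
        conv_rhs => rw [← ENNReal.rpow_one (T x), ← ENNReal.rpow_mul, one_mul,
          ← ENNReal.rpow_add_of_nonneg _ _ hq1.le zero_le_one, sub_add_cancel]
      rw [e1]
      gcongr
      rw [hT, chainSum_eq]
      refine Finset.sum_le_sum fun Q _ => ?_
      exact indicator_le_self _ (fun _ => c Q) x
    refine ne_top_of_le_ne_top ?_ (lintegral_mono h1)
    rw [lintegral_const_mul _ hTm, hT, lintegral_chainSum hm]
    refine ENNReal.mul_ne_top (ENNReal.rpow_ne_top_of_nonneg hq1.le
      (ENNReal.sum_ne_top.2 fun Q _ => hctop Q)) (ENNReal.sum_ne_top.2 fun Q _ =>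
      ENNReal.mul_ne_top (hctop Q) (by rw [hU]; exact pow2_ne_top _))
  have hg : AEMeasurable (fun x => T x ^ (q - 1)) μ := (hTm.pow_const _).aemeasurable
  have hgq : ∀ x, (T x ^ (q - 1)) ^ q' = T x ^ q := fun x => by rw [← ENNReal.rpow_mul, hqq]
  have h2 := hform ι D κ S U μ ν h h' hκ hh hh' hS hU hK f (fun x => T x ^ (q - 1)) hf hg hfp
    (by simpa only [hgq] using hX) 𝒬
  simp only [hgq] at h2
  have h3 : ∫⁻ x, T x ^ q ∂μ = ∑ Q ∈ 𝒬, c Q * ∫⁻ x in D.right Q, T x ^ (q - 1) ∂μ := by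
    rw [← lintegral_chainSum_mul hm 𝒬 c μ hg]
    refine lintegral_congr fun x => ?_
    rw [← hT]
    conv_rhs => rw [← ENNReal.rpow_one (T x), ← ENNReal.rpow_mul, one_mul,
      ← ENNReal.rpow_add_of_nonneg _ _ zero_le_one hq1.le, add_sub_cancel]
  rw [← h3] at h2
  exact le_rpow_of_le_mul_rpow hq hX h2

/-- The passage from finite parts to the full dyadic operator by monotone convergence. -/
theorem lintegral_tsum_indicator_rpow_le {ι : Type} [Countable ι] {B : ι → Set ℝ}
    (hB : ∀ Q, MeasurableSet (B Q)) (c : ι → ℝ≥0∞) (μ : Measure ℝ) {q : ℝ} (hq : 0 < q)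
    {A : ℝ≥0∞} (h : ∀ 𝒬 : Finset ι, ∫⁻ x, chainSum B 𝒬 c x ^ q ∂μ ≤ A) :
    ∫⁻ x, (∑' Q, (B Q).indicator (fun _ => c Q) x) ^ q ∂μ ≤ A := by
  have h1 : ∀ x, (∑' Q, (B Q).indicator (fun _ => c Q) x) ^ q =
      ⨆ 𝒬 : Finset ι, chainSum B 𝒬 c x ^ q := by
    intro x
    simp only [chainSum_eq]
    rw [ENNReal.tsum_eq_iSup_sum]
    exact (ENNReal.orderIsoRpow q hq).map_iSup _
  simp only [h1]
  rw [lintegral_iSup_directed_of_measurable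
    (fun 𝒬 => (measurable_chainSum hB 𝒬 c).pow_const q)]
  · exact iSup_le h
  · classical
    intro s t
    have hmono : ∀ {s t : Finset ι}, s ⊆ t → ∀ x, chainSum B s c x ^ q ≤ chainSum B t c x ^ q := by
      intro s t hst x
      refine ENNReal.rpow_le_rpow ?_ hq.le
      simp only [chainSum_eq]
      exact Finset.sum_le_sum_of_subset hst
    exact ⟨s ∪ t, hmono Finset.subset_union_left, hmono Finset.subset_union_right⟩

/-- For a positive finite density `u`, the measures `u dx` and `u ^ (-1 / s) dx` are dual. -/
theorem isDualDensity_withDensity {u v : ℝ → ℝ≥0∞} (hu : Measurable u) (hu0 : ∀ x, u x ≠ 0)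
    (hut : ∀ x, u x ≠ ∞) {s : ℝ} (hv : ∀ x, v x = u x ^ (-(1 / s))) :
    IsDualDensity (volume.withDensity u) (volume.withDensity v) s (fun x => (u x)⁻¹) where
  aemeasurable := hu.inv.aemeasurable
  lintegral_eq E hE := by
    rw [setLIntegral_withDensity_eq_setLIntegral_mul _ hu
      (show Measurable fun x => (u x)⁻¹ from hu.inv) hE, ← setLIntegral_one]
    refine lintegral_congr fun x => ?_
    exact ENNReal.mul_inv_cancel (hu0 x) (hut x)
  lintegral_rpow_le E hE := by
    rw [setLIntegral_withDensity_eq_setLIntegral_mul _ hu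
      (show Measurable fun x => (u x)⁻¹ ^ (1 + 1 / s) from hu.inv.pow_const _) hE,
      withDensity_apply _ hE]
    refine le_of_eq (lintegral_congr fun x => ?_)
    rw [Pi.mul_apply, hv, ENNReal.inv_rpow, ← ENNReal.rpow_neg]
    conv_lhs => rw [← ENNReal.rpow_one (u x), ← ENNReal.rpow_mul, one_mul,
      ← ENNReal.rpow_add _ _ (hu0 x) (hut x)]
    congr 1
    ring

/-- The Riemann-Liouville potential of a nonnegative function, as an extended nonnegative number. -/
noncomputable def lrl (α : ℝ) (φ : ℝ → ℝ≥0∞) (x : ℝ) : ℝ≥0∞ :=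
  ∫⁻ t in Iio x, ENNReal.ofReal ((x - t) ^ (α - 1)) * φ t

/-- The potential is dominated by the dyadic operators of the two grids. -/
theorem lrl_le {α : ℝ} (hα : α < 1) {φ : ℝ → ℝ≥0∞} (hφ : AEMeasurable φ volume) (x : ℝ) :
    lrl α φ x ≤ ENNReal.ofReal (3 ^ (1 - α)) *
      ((∑' Q, (GridOffset.standard.system.right Q).indicator
        (fun _ => pow2 ((α - 1) * GridOffset.standard.system.gen Q) *
          ∫⁻ t in GridOffset.standard.system.left Q, φ t) x) +
      ∑' Q, (GridOffset.third.system.right Q).indicator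
        (fun _ => pow2 ((α - 1) * GridOffset.third.system.gen Q) *
          ∫⁻ t in GridOffset.third.system.left Q, φ t) x) := by
  set k : GridOffset → ℝ → ℝ≥0∞ := fun c t => ∑' Q, (c.system.right Q).indicator
    (fun _ => pow2 ((α - 1) * c.system.gen Q) * (c.system.left Q).indicator φ t) x with hk
  have hkle : ∀ (c : GridOffset) (Q : ℤ × ℤ) (t : ℝ), t ∈ c.system.left Q →
      x ∈ c.system.right Q → pow2 ((α - 1) * Q.1) * φ t ≤ k c t := by
    intro c Q t ht hx
    refine le_trans (le_of_eq ?_) (ENNReal.le_tsum Q)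
    rw [indicator_of_mem hx, indicator_of_mem ht]
    rfl
  have hkint : ∀ c : GridOffset, ∫⁻ t, k c t = ∑' Q, (c.system.right Q).indicator
      (fun _ => pow2 ((α - 1) * c.system.gen Q) * ∫⁻ t in c.system.left Q, φ t) x := by
    intro c
    have hmeas : ∀ Q, AEMeasurable (fun t => (c.system.left Q).indicator φ t) volume :=
      fun Q => hφ.indicator (c.system.measurableSet_left Q)
    rw [hk, lintegral_tsum]
    · refine tsum_congr fun Q => ?_
      by_cases hx : x ∈ c.system.right Q
      · simp only [indicator_of_mem hx]
        rw [lintegral_const_mul'' _ (hmeas Q), lintegral_indicator (c.system.measurableSet_left Q)]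
      · simp only [indicator_of_notMem hx, lintegral_zero]
    · intro Q
      by_cases hx : x ∈ c.system.right Q
      · simp only [indicator_of_mem hx]
        exact (hmeas Q).const_mul _
      · simp only [indicator_of_notMem hx]
        exact aemeasurable_const
  have hkm : AEMeasurable (k GridOffset.standard) volume := by
    refine AEMeasurable.tsum fun Q => ?_
    by_cases hx : x ∈ GridOffset.standard.system.right Q
    · simp only [indicator_of_mem hx]
      exact (hφ.indicator (GridOffset.standard.system.measurableSet_left Q)).const_mul _
    · simp only [indicator_of_notMem hx]
      exact aemeasurable_const
  rw [← hkint, ← hkint, ← lintegral_add_left' hkm, lrl,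
    ← lintegral_const_mul' _ _ ENNReal.ofReal_ne_top, ← lintegral_indicator measurableSet_Iio]
  refine lintegral_mono fun t => ?_
  by_cases ht : t ∈ Iio x
  · rw [indicator_of_mem ht]
    obtain ⟨c, hc, Q, hl, hr, hle⟩ := kernel_le hα ht
    refine (mul_le_mul_left hle _).trans ?_
    rw [mul_assoc]
    gcongr
    refine (hkle c Q t hl hr).trans ?_
    rcases hc with rfl | rfl
    · exact le_self_add
    · exact le_add_self
  · rw [indicator_of_notMem ht]
    exact zero_le

/-- The strong type bound for positive measurable weights `W` and nonnegative functions. -/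
theorem lintegral_lrl_rpow_le {p p' q α : ℝ} (hp : p.HolderConjugate p') (hq : 1 < q)
    (hα : 0 < α) (hα1 : α < 1) (hpq : q / p = 1 + α * q) :
    ∃ C : ℝ≥0∞, C ≠ ∞ ∧ ∀ (W : ℝ → ℝ) (κ : ℝ), Measurable W → (∀ x, 0 < W x) → 0 ≤ κ →
      (∀ x h : ℝ, 0 < h → (ENNReal.ofReal (1 / h) * ∫⁻ t in Ioc x (x + h),
          ENNReal.ofReal (W t ^ q)) * (ENNReal.ofReal (1 / h) * ∫⁻ t in Ioc (x - h) x,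
          ENNReal.ofReal (W t ^ (-p'))) ^ (q / p') ≤ pow2 κ) →
      ∀ φ : ℝ → ℝ≥0∞, AEMeasurable φ volume → ∫⁻ x, φ x ^ p * ENNReal.ofReal (W x ^ p) ≠ ∞ →
      ∫⁻ x, lrl α φ x ^ q * ENNReal.ofReal (W x ^ q) ≤
        (C * pow2 (κ * ((1 - α) * max 1 (p' / q))) *
          (∫⁻ x, φ x ^ p * ENNReal.ofReal (W x ^ p)) ^ (1 / p)) ^ q := by
  have hq' : q.HolderConjugate q.conjExponent := Real.HolderConjugate.conjExponent hq
  have hp0 := hp.pos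
  have hp'0 := hp.symm.pos
  have hq0 := hq'.pos
  have hsum := hp.inv_add_inv_eq_one
  have hp'i : 1 / p' = 1 - 1 / p := by simp only [one_div]; linarith
  set s := q / p' with hsdef
  have hs0 : 0 < s := by positivity
  have hs : s = q - q / p := by rw [hsdef, div_eq_mul_one_div q p', hp'i]; ring
  have hs1 : (1 + s) / q = 1 - α := by
    have : s = q - 1 - α * q := by rw [hs, hpq]; ring
    rw [this]; field_simp; ring
  have hs2 : 1 / s = p' / q := by rw [hsdef]; field_simp
  obtain ⟨C, hC, hbound⟩ := lintegral_chainSum_rpow_le hp hq' hα hpq hs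
  set C₀ : ℝ≥0∞ := ENNReal.ofReal (3 ^ (1 - α)) with hC₀
  refine ⟨C₀ * 2 * C, by finiteness, ?_⟩
  intro W κ hW hW0 hκ hchar φ hφ hφp
  set u : ℝ → ℝ≥0∞ := fun x => ENNReal.ofReal (W x ^ q) with hu
  set v : ℝ → ℝ≥0∞ := fun x => ENNReal.ofReal (W x ^ (-p')) with hv
  have hum : Measurable u := (hW.pow_const q).ennreal_ofReal
  have hvm : Measurable v := (hW.pow_const (-p')).ennreal_ofReal
  have hw : ∀ (x r : ℝ), ENNReal.ofReal (W x ^ r) = ENNReal.ofReal (W x) ^ r := fun x r =>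
    (ENNReal.ofReal_rpow_of_pos (hW0 x)).symm
  have hw0 : ∀ x, ENNReal.ofReal (W x) ≠ 0 := fun x => by simpa using hW0 x
  have hwr0 : ∀ (x r : ℝ), ENNReal.ofReal (W x ^ r) ≠ 0 := fun x r => by
    simpa using Real.rpow_pos_of_pos (hW0 x) r
  have hvu : ∀ x, v x = u x ^ (-(1 / s)) := by
    intro x
    simp only [hu, hv]
    rw [hw, hw, ← ENNReal.rpow_mul, hs2]
    congr 1; field_simp
  have huv : ∀ x, u x = v x ^ (-(1 / (1 / s))) := by
    intro x
    simp only [hu, hv]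
    rw [hw, hw, ← ENNReal.rpow_mul, hs2]
    congr 1; field_simp
  set μ := volume.withDensity u with hμ
  set ν := volume.withDensity v with hν
  have hdual := isDualDensity_withDensity hum (fun x => hwr0 x q)
    (fun _ => ENNReal.ofReal_ne_top) hvu
  have hdual' := isDualDensity_withDensity hvm (fun x => hwr0 x (-p'))
    (fun _ => ENNReal.ofReal_ne_top) huv
  set f : ℝ → ℝ≥0∞ := fun x => φ x * (v x)⁻¹ with hf
  have hfm : AEMeasurable f volume := hφ.mul hvm.inv.aemeasurable
  have hfν : AEMeasurable f ν := hfm.mono_ac (withDensity_absolutelyContinuous _ _)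
  have hvf : ∀ x, v x * f x = φ x := fun x => by
    change v x * (φ x * (v x)⁻¹) = φ x
    rw [mul_left_comm, ENNReal.mul_inv_cancel (hwr0 x _) ENNReal.ofReal_ne_top, mul_one]
  have hfp : ∫⁻ x, f x ^ p ∂ν = ∫⁻ x, φ x ^ p * ENNReal.ofReal (W x ^ p) := by
    rw [hν, lintegral_withDensity_eq_lintegral_mul₀ hvm.aemeasurable (hfm.pow_const p)]
    refine lintegral_congr fun x => ?_
    simp only [Pi.mul_apply, hf, hv]
    rw [ENNReal.mul_rpow_of_nonneg _ _ hp0.le, hw, hw, ← ENNReal.rpow_neg, ← ENNReal.rpow_mul,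
      mul_left_comm, ← ENNReal.rpow_add _ _ (hw0 x) ENNReal.ofReal_ne_top]
    congr 2
    have := hp.mul_eq_add
    linarith
  have hfl : ∀ E, MeasurableSet E → ∫⁻ t in E, f t ∂ν = ∫⁻ t in E, φ t := by
    intro E hE
    rw [hν, restrict_withDensity hE, lintegral_withDensity_eq_lintegral_mul₀ hvm.aemeasurable
      hfm.restrict]
    exact lintegral_congr fun x => hvf x
  set A := (C * pow2 (κ * ((1 - α) * max 1 (p' / q))) *
    (∫⁻ x, φ x ^ p * ENNReal.ofReal (W x ^ p)) ^ (1 / p)) ^ q with hA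
  have hsys : ∀ c : GridOffset, ∫⁻ x, (∑' Q, (c.system.right Q).indicator
      (fun _ => pow2 ((α - 1) * c.system.gen Q) * ∫⁻ t in c.system.left Q, φ t) x) ^ q ∂μ ≤ A := by
    intro c
    have hmass : ∀ Q : ℤ × ℤ, μ (c.system.right Q) * ν (c.system.left Q) ^ s ≤
        pow2 (κ + (1 + s) * c.system.gen Q) := by
      intro Q
      have hpos : (0 : ℝ) < 2 ^ Q.1 := by positivity
      set m : ℝ := 2 ^ Q.1 * ((2 * Q.2 + c.shift Q.1 + 1 : ℤ) + c.off Q.1) with hmdef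
      have e1 : c.system.right Q = Ico m (m + 2 ^ Q.1) := c.setOf_idx_eq _ _
      have e2 : c.system.left Q = Ico (m - 2 ^ Q.1) m := by
        refine (c.setOf_idx_eq _ _).trans ?_
        have : (2 : ℝ) ^ Q.1 * ((2 * Q.2 + c.shift Q.1 : ℤ) + c.off Q.1) = m - 2 ^ Q.1 := by
          rw [hmdef]; push_cast; ring
        rw [this, sub_add_cancel]
      have h1 := hchar m (2 ^ Q.1) hpos
      have e3 : ENNReal.ofReal (1 / 2 ^ Q.1) = pow2 (-Q.1) := by
        rw [one_div, ← zpow_neg, ofReal_two_zpow]; simp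
      rw [e3, ENNReal.mul_rpow_of_nonneg _ _ hs0.le, pow2_rpow] at h1
      rw [e1, e2, hμ, hν, withDensity_apply _ measurableSet_Ico,
        withDensity_apply _ measurableSet_Ico, setLIntegral_congr Ico_ae_eq_Ioc,
        setLIntegral_congr Ico_ae_eq_Ioc]
      have h2 := mul_le_mul_right h1 (pow2 ((1 + s) * Q.1))
      have e4 : pow2 ((1 + s) * Q.1) * pow2 (-Q.1) * pow2 (-Q.1 * s) = 1 := by
        rw [← pow2_add, ← pow2_add, ← pow2_zero]; congr 1; ring
      calc _ = (pow2 ((1 + s) * Q.1) * pow2 (-Q.1) * pow2 (-Q.1 * s)) *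
            ((∫⁻ t in Ioc m (m + 2 ^ Q.1), u t) * (∫⁻ t in Ioc (m - 2 ^ Q.1) m, v t) ^ s) := by
            rw [e4, one_mul]
        _ = pow2 ((1 + s) * Q.1) * (pow2 (-Q.1) * (∫⁻ t in Ioc m (m + 2 ^ Q.1), u t) *
            (pow2 (-Q.1 * s) * (∫⁻ t in Ioc (m - 2 ^ Q.1) m, v t) ^ s)) := by ring
        _ ≤ pow2 ((1 + s) * Q.1) * pow2 κ := h2
        _ = _ := by rw [← pow2_add, add_comm]; rfl
    have hpos : ∀ (d : ℝ → ℝ≥0∞), Measurable d → (∀ x, d x ≠ 0) → ∀ E, MeasurableSet E →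
        volume E ≠ 0 → volume.withDensity d E ≠ 0 := by
      intro d hd hd0 E hE hE0
      rw [withDensity_apply _ hE]
      refine ((setLIntegral_pos_iff hd).2 ?_).ne'
      rw [show Function.support d = univ from eq_univ_of_forall hd0, univ_inter]
      exact pos_iff_ne_zero.2 hE0
    have hμ0 : ∀ Q, μ (c.system.right Q) ≠ 0 := fun Q => hpos u hum (fun x => hwr0 x q) _
      (c.system.measurableSet_right Q) (by rw [c.system.volume_right]; exact pow2_ne_zero _)
    have hν0 : ∀ Q, ν (c.system.left Q) ≠ 0 := fun Q => hpos v hvm (fun x => hwr0 x (-p')) _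
      (c.system.measurableSet_left Q) (by rw [c.system.volume_left]; exact pow2_ne_zero _)
    have hμt : ∀ Q, μ (c.system.right Q) ≠ ∞ := fun Q h => by
      have h1 := hmass Q
      rw [h, ENNReal.top_mul (by simp [ENNReal.rpow_eq_zero_iff, hν0 Q, hs0.le])] at h1
      exact pow2_ne_top _ (top_le_iff.1 h1)
    have hνt : ∀ Q, ν (c.system.left Q) ≠ ∞ := fun Q h => by
      have h1 := hmass Q
      rw [h, ENNReal.top_rpow_of_pos hs0, ENNReal.mul_top (hμ0 Q)] at h1
      exact pow2_ne_top _ (top_le_iff.1 h1)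
    choose S hS using fun Q => exists_pow2 (hν0 Q) (hνt Q)
    choose U hU using fun Q => exists_pow2 (hμ0 Q) (hμt Q)
    have hK : ∀ Q, U Q + s * S Q ≤ κ + (1 + s) * c.system.gen Q := by
      intro Q
      have h1 := hmass Q
      rw [hS, hU, pow2_rpow, ← pow2_add, pow2_le] at h1
      linarith
    have h1 := hbound (ℤ × ℤ) c.system κ S U μ ν _ _ hκ hdual hdual' hS hU hK f hfν
      (by rw [hfp]; exact hφp)
    simp only [hfl _ (c.system.measurableSet_left _), hfp] at h1
    rw [hs1, hs2] at h1
    exact lintegral_tsum_indicator_rpow_le c.system.measurableSet_right _ μ hq0 h1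
  set T : GridOffset → ℝ → ℝ≥0∞ := fun c x => ∑' Q, (c.system.right Q).indicator
      (fun _ => pow2 ((α - 1) * c.system.gen Q) * ∫⁻ t in c.system.left Q, φ t) x with hT
  have hTm : ∀ c, Measurable (T c) := fun c => Measurable.tsum fun Q =>
    measurable_const.indicator (c.system.measurableSet_right Q)
  have e1 : ∀ g : ℝ → ℝ≥0∞, Measurable g →
      ∫⁻ x, g x * ENNReal.ofReal (W x ^ q) = ∫⁻ x, g x ∂μ := by
    intro g hg
    rw [hμ, lintegral_withDensity_eq_lintegral_mul _ hum hg]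
    exact lintegral_congr fun x => mul_comm _ _
  calc ∫⁻ x, lrl α φ x ^ q * ENNReal.ofReal (W x ^ q)
      ≤ ∫⁻ x, C₀ ^ q * (2 ^ (q - 1) * (T GridOffset.standard x ^ q + T GridOffset.third x ^ q)) *
          ENNReal.ofReal (W x ^ q) := by
        refine lintegral_mono fun x => ?_
        gcongr
        refine (ENNReal.rpow_le_rpow (lrl_le hα1 hφ x) hq0.le).trans ?_
        rw [ENNReal.mul_rpow_of_nonneg _ _ hq0.le]
        gcongr
        exact ENNReal.rpow_add_le_mul_rpow_add_rpow _ _ hq.le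
    _ = C₀ ^ q * (2 ^ (q - 1) * (∫⁻ x, T GridOffset.standard x ^ q ∂μ +
          ∫⁻ x, T GridOffset.third x ^ q ∂μ)) := by
        have hm1 := (hTm GridOffset.standard).pow_const q
        have hm2 := (hTm GridOffset.third).pow_const q
        have hm3 : Measurable fun x => T GridOffset.standard x ^ q + T GridOffset.third x ^ q :=
          hm1.add hm2
        rw [e1 _ ((hm3.const_mul _).const_mul _), lintegral_const_mul _ (hm3.const_mul _),
          lintegral_const_mul _ hm3, lintegral_add_left hm1]
    _ ≤ C₀ ^ q * (2 ^ (q - 1) * (A + A)) := by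
        gcongr
        · exact hsys _
        · exact hsys _
    _ = (C₀ * 2) ^ q * A := by
        have : (2 : ℝ≥0∞) ^ q = 2 ^ (q - 1) * 2 := by
          conv_rhs => rw [← ENNReal.rpow_one 2, ← ENNReal.rpow_mul, one_mul,
            ← ENNReal.rpow_add_of_nonneg _ _ (by linarith) zero_le_one, sub_add_cancel]
        rw [ENNReal.mul_rpow_of_nonneg _ _ hq0.le, this, ← two_mul]
        ring
    _ = _ := by
        rw [hA, ← ENNReal.mul_rpow_of_nonneg _ _ hq0.le]
        congr 1
        ring

/-! ### Weights and the operator norm -/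

/-- A weight agrees almost everywhere with a measurable function that is positive everywhere. -/
theorem IsWeight.exists_measurable {w : ℝ → ℝ} (hw : IsWeight w) :
    ∃ W : ℝ → ℝ, Measurable W ∧ (∀ x, 0 < W x) ∧ w =ᵐ[volume] W := by
  have hm := hw.locallyIntegrable.aestronglyMeasurable.aemeasurable
  refine ⟨fun x => if 0 < hm.mk w x then hm.mk w x else 1, ?_, fun x => ?_, ?_⟩
  · exact Measurable.ite (measurableSet_lt measurable_const hm.measurable_mk) hm.measurable_mk
      measurable_const
  · dsimp only
    split_ifs with h
    · exact h
    · exact one_pos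
  · filter_upwards [hm.ae_eq_mk, hw.ae_pos] with x h1 h2
    rw [← h1, if_pos h2]

theorem charMinus_congr {p q : ℝ} {w W : ℝ → ℝ} (h : w =ᵐ[volume] W) :
    charMinus p q w = charMinus p q W := by
  have h1 : ∀ (r : ℝ) (E : Set ℝ), ∫⁻ t in E, ENNReal.ofReal (w t ^ r) =
      ∫⁻ t in E, ENNReal.ofReal (W t ^ r) := fun r E =>
    lintegral_congr_ae (ae_restrict_of_ae (h.mono fun x hx => by simp only [hx]))
  simp only [charMinus, h1]

theorem wLpNorm_congr {p : ℝ} {v V f : ℝ → ℝ} (h : v =ᵐ[volume] V) :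
    wLpNorm p v f = wLpNorm p V f := by
  unfold wLpNorm
  congr 1
  exact lintegral_congr_ae (h.mono fun x hx => by simp only [hx])

/-- The characteristic of a weight is at least one, by Lebesgue's differentiation theorem. -/
theorem one_le_of_average_mul_le {p' q : ℝ} (hp' : 0 < p') (hq : 0 < q) {W : ℝ → ℝ}
    (hW : Measurable W) (hW0 : ∀ x, 0 < W x) {K : ℝ≥0∞} (hK : K ≠ ∞)
    (hchar : ∀ x h : ℝ, 0 < h → (ENNReal.ofReal (1 / h) * ∫⁻ t in Ioc x (x + h),
          ENNReal.ofReal (W t ^ q)) * (ENNReal.ofReal (1 / h) * ∫⁻ t in Ioc (x - h) x,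
          ENNReal.ofReal (W t ^ (-p'))) ^ (q / p') ≤ K) : 1 ≤ K := by
  have hs0 : 0 < q / p' := by positivity
  have hm : ∀ r : ℝ, Measurable fun x => W x ^ r := fun r => hW.pow_const r
  have hpos : ∀ (r a b : ℝ), a < b → ∫⁻ t in Ioc a b, ENNReal.ofReal (W t ^ r) ≠ 0 := by
    intro r a b hab
    refine ((setLIntegral_pos_iff (hm r).ennreal_ofReal).2 ?_).ne'
    rw [show Function.support (fun t => ENNReal.ofReal (W t ^ r)) = univ from
      eq_univ_of_forall fun x => by simpa using Real.rpow_pos_of_pos (hW0 x) r, univ_inter]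
    simpa using hab
  have hloc : ∀ r : ℝ, (∀ x, ∫⁻ t in Ioc (x - 1) (x + 1), ENNReal.ofReal (W t ^ r) ≠ ∞) →
      LocallyIntegrable (fun x => W x ^ r) volume := by
    intro r hr x
    refine ⟨Ioc (x - 1) (x + 1), Ioc_mem_nhds (by linarith) (by linarith),
      (hm r).aestronglyMeasurable, ?_⟩
    rw [hasFiniteIntegral_iff_ofReal (ae_of_all _ fun t => (Real.rpow_pos_of_pos (hW0 t) r).le)]
    exact (hr x).lt_top
  have hc0 : ENNReal.ofReal (1 / 2) ≠ 0 := by simp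
  have hu : LocallyIntegrable (fun x => W x ^ q) volume := by
    refine hloc q fun x h => hK ?_
    have h1 := hchar (x - 1) 2 (by norm_num)
    have e : x - 1 + 2 = x + 1 := by ring
    have h2 : ENNReal.ofReal (1 / 2) * ∫⁻ t in Ioc (x - 1 - 2) (x - 1),
        ENNReal.ofReal (W t ^ (-p')) ≠ 0 := mul_ne_zero hc0 (hpos _ _ _ (by linarith))
    rw [e, h, ENNReal.mul_top hc0, ENNReal.top_mul] at h1
    · exact top_le_iff.1 h1
    · exact (ENNReal.rpow_pos_of_nonneg (pos_iff_ne_zero.2 h2) hs0.le).ne'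
  have hv : LocallyIntegrable (fun x => W x ^ (-p')) volume := by
    refine hloc (-p') fun x h => hK ?_
    have h1 := hchar (x + 1) 2 (by norm_num)
    have e : x + 1 - 2 = x - 1 := by ring
    rw [e, h, ENNReal.mul_top hc0, ENNReal.top_rpow_of_pos hs0, ENNReal.mul_top] at h1
    · exact top_le_iff.1 h1
    · exact mul_ne_zero hc0 (hpos _ _ _ (by linarith))
  have hii : ∀ r : ℝ, LocallyIntegrable (fun x => W x ^ r) volume → ∀ a b : ℝ,
      IntervalIntegrable (fun x => W x ^ r) volume a b := fun r hr a b =>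
    intervalIntegrable_iff.mpr
      ((LocallyIntegrable.integrableOn_isCompact hr isCompact_uIcc).mono_set uIoc_subset_uIcc)
  -- averages over `(a, b]` as difference quotients of the primitive
  have hav : ∀ r : ℝ, LocallyIntegrable (fun x => W x ^ r) volume → ∀ a h : ℝ, 0 < h →
      ENNReal.ofReal (1 / h) * ∫⁻ t in Ioc a (a + h), ENNReal.ofReal (W t ^ r) =
        ENNReal.ofReal (h⁻¹ * ((∫ t in (0 : ℝ)..(a + h), W t ^ r) - ∫ t in (0 : ℝ)..a, W t ^ r)) := by
    intro r hr a h hh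
    rw [intervalIntegral.integral_interval_sub_left (hii r hr _ _) (hii r hr _ _),
      intervalIntegral.integral_of_le (by linarith), ENNReal.ofReal_mul (by positivity),
      one_div, ofReal_integral_eq_lintegral_ofReal ((intervalIntegrable_iff_integrableOn_Ioc_of_le
        (by linarith)).1 (hii r hr a (a + h)))
        (ae_of_all _ fun t => (Real.rpow_pos_of_pos (hW0 t) r).le)]
  obtain ⟨x, hux, hvx⟩ := ((LocallyIntegrable.ae_hasDerivAt_integral hu).and
    (LocallyIntegrable.ae_hasDerivAt_integral hv)).exists
  have h1 := (hux 0).tendsto_slope_zero_right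
  have h2 := (hvx 0).tendsto_slope_zero_left
  have h3 : Filter.Tendsto (fun h : ℝ => ENNReal.ofReal (1 / h) * ∫⁻ t in Ioc x (x + h),
      ENNReal.ofReal (W t ^ q)) (nhdsWithin 0 (Ioi 0)) (nhds (ENNReal.ofReal (W x ^ q))) := by
    refine (ENNReal.tendsto_ofReal h1).congr' ?_
    filter_upwards [self_mem_nhdsWithin] with h hh
    rw [hav q hu x h hh, smul_eq_mul]
  have h4 : Filter.Tendsto (fun h : ℝ => ENNReal.ofReal (1 / h) * ∫⁻ t in Ioc (x - h) x,
      ENNReal.ofReal (W t ^ (-p'))) (nhdsWithin 0 (Ioi 0))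
      (nhds (ENNReal.ofReal (W x ^ (-p')))) := by
    have h5 : Filter.Tendsto (fun h : ℝ => -h) (nhdsWithin 0 (Ioi 0)) (nhdsWithin 0 (Iio 0)) := by
      refine tendsto_nhdsWithin_iff.2 ⟨?_, ?_⟩
      · have : Filter.Tendsto (fun h : ℝ => -h) (nhds 0) (nhds (-0)) := continuous_neg.tendsto 0
        rw [neg_zero] at this
        exact this.mono_left nhdsWithin_le_nhds
      · filter_upwards [self_mem_nhdsWithin] with h hh
        simpa using hh
    refine (ENNReal.tendsto_ofReal (h2.comp h5)).congr' ?_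
    filter_upwards [self_mem_nhdsWithin] with h hh
    have h6 := hav (-p') hv (x - h) h hh
    rw [sub_add_cancel] at h6
    rw [h6]
    simp only [Function.comp_apply, smul_eq_mul]
    congr 1
    rw [← sub_eq_add_neg, inv_neg]
    ring
  have h5 := ENNReal.Tendsto.mul h3 (Or.inr (ENNReal.rpow_ne_top_of_nonneg hs0.le
    ENNReal.ofReal_ne_top)) ((ENNReal.continuous_rpow_const (y := q / p')).tendsto _ |>.comp h4)
    (Or.inr ENNReal.ofReal_ne_top)
  have h6 : ENNReal.ofReal (W x ^ q) * ENNReal.ofReal (W x ^ (-p')) ^ (q / p') = 1 := by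
    have hx := hW0 x
    rw [ENNReal.ofReal_rpow_of_pos (Real.rpow_pos_of_pos hx _), ← Real.rpow_mul hx.le,
      ← ENNReal.ofReal_mul (by positivity), ← Real.rpow_add hx]
    have : q + -p' * (q / p') = 0 := by field_simp; ring
    rw [this]; simp
  rw [h6] at h5
  refine le_of_tendsto h5 ?_
  filter_upwards [self_mem_nhdsWithin] with h hh
  exact hchar x h hh

section Potential

variable {α : ℝ} {f : ℝ → ℝ}

theorem enorm_div_rpow (f : ℝ → ℝ) {t x : ℝ} (h : t < x) :
    ‖f t / (x - t) ^ (1 - α)‖ₑ =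
      ENNReal.ofReal ((x - t) ^ (α - 1)) * ENNReal.ofReal |f t| := by
  have hd : 0 < x - t := sub_pos.2 h
  rw [← ENNReal.ofReal_mul (by positivity), Real.enorm_eq_ofReal_abs, abs_div,
    abs_of_pos (Real.rpow_pos_of_pos hd _), div_eq_mul_inv, ← Real.rpow_neg hd.le, neg_sub,
    mul_comm]

theorem lintegral_enorm_eq_lrl (f : ℝ → ℝ) (x : ℝ) :
    ∫⁻ t in Iio x, ‖f t / (x - t) ^ (1 - α)‖ₑ = lrl α (fun t => ENNReal.ofReal |f t|) x :=
  setLIntegral_congr_fun measurableSet_Iio fun _ ht => enorm_div_rpow f ht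

theorem enorm_rlPotential_le (f : ℝ → ℝ) (x : ℝ) :
    ‖rlPotential α f x‖ₑ ≤ lrl α (fun t => ENNReal.ofReal |f t|) x := by
  rw [← lintegral_enorm_eq_lrl]
  exact enorm_integral_le_lintegral_enorm _

theorem measurable_div_rpow (hf : Measurable f) (x : ℝ) :
    Measurable fun t => f t / (x - t) ^ (1 - α) :=
  hf.div ((measurable_const.sub measurable_id).pow_const _)

theorem measurable_lrl {φ : ℝ → ℝ≥0∞} (hφ : Measurable φ) : Measurable (lrl α φ) := by
  have h1 : lrl α φ = fun x => ∫⁻ t, ({z : ℝ × ℝ | z.2 < z.1}.indicator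
      (fun z => ENNReal.ofReal ((z.1 - z.2) ^ (α - 1)) * φ z.2)) (x, t) := by
    funext x
    rw [lrl, ← lintegral_indicator measurableSet_Iio]
    rfl
  rw [h1]
  refine Measurable.lintegral_prod_right' (Measurable.indicator ?_
    (measurableSet_lt measurable_snd measurable_fst))
  exact ((measurable_fst.sub measurable_snd).pow_const _).ennreal_ofReal.mul
    (hφ.comp measurable_snd)

theorem measurable_rlPotential (hf : Measurable f) : Measurable (rlPotential α f) := by
  have h1 : rlPotential α f = fun x => ∫ t, ({z : ℝ × ℝ | z.2 < z.1}.indicator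
      (fun z => f z.2 / (z.1 - z.2) ^ (1 - α))) (x, t) := by
    funext x
    rw [rlPotential, ← integral_indicator measurableSet_Iio]
    rfl
  rw [h1]
  refine (StronglyMeasurable.integral_prod_right' (Measurable.stronglyMeasurable
    (Measurable.indicator ?_ (measurableSet_lt measurable_snd measurable_fst)))).measurable
  exact (hf.comp measurable_snd).div ((measurable_fst.sub measurable_snd).pow_const _)

theorem rlPotential_congr {g : ℝ → ℝ} (h : f =ᵐ[volume] g) :
    rlPotential α f = rlPotential α g := by
  funext x
  exact integral_congr_ae (ae_restrict_of_ae (h.mono fun t ht => by simp only [ht]))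

theorem rlDefined_congr {g : ℝ → ℝ} (h : f =ᵐ[volume] g) (hg : RLDefined α g) :
    RLDefined α f :=
  hg.mono fun x hx => hx.congr (ae_restrict_of_ae (h.mono fun t ht => by simp only [ht]))

theorem rlDefined_of_lrl (hf : Measurable f)
    (h : ∀ᵐ x, lrl α (fun t => ENNReal.ofReal |f t|) x < ∞) : RLDefined α f :=
  h.mono fun x hx => ⟨(measurable_div_rpow hf x).aestronglyMeasurable, by
    rw [hasFiniteIntegral_iff_enorm, lintegral_enorm_eq_lrl]; exact hx⟩

/-- For a nonnegative function the potential is given by the extended integral. -/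
theorem ofReal_rlPotential (hf0 : ∀ t, 0 ≤ f t) (h : RLDefined α f) :
    ∀ᵐ x, ENNReal.ofReal (rlPotential α f x) = lrl α (fun t => ENNReal.ofReal (f t)) x := by
  filter_upwards [h] with x hx
  rw [rlPotential, ofReal_integral_eq_lintegral_ofReal hx]
  · refine setLIntegral_congr_fun measurableSet_Iio fun t ht => ?_
    have hd : 0 < x - t := sub_pos.2 ht
    have h1 := enorm_div_rpow (α := α) f ht
    rwa [Real.enorm_of_nonneg (div_nonneg (hf0 t) (by positivity)), abs_of_nonneg (hf0 t)] at h1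
  · filter_upwards [ae_restrict_mem measurableSet_Iio] with t ht
    have hd : 0 < x - t := sub_pos.2 ht
    exact div_nonneg (hf0 t) (by positivity)

end Potential

/-- The exponents of the theorem: `q / p = 1 + α q` and `q > 1`. -/
theorem exponent_relations {α p q : ℝ} (hα0 : 0 < α) (hp1 : 1 < p) (hpα : p < 1 / α)
    (hq : q = p / (1 - α * p)) : 1 < q ∧ q / p = 1 + α * q := by
  have h1 : α * p < 1 := by
    rw [lt_div_iff₀ hα0] at hpα; linarith
  have h2 : 0 < 1 - α * p := by linarith
  have h3 : 0 < α * p := by positivity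
  constructor
  · rw [hq, lt_div_iff₀ h2]; linarith
  · have hp0 : p ≠ 0 := by linarith
    have h4 := h2.ne'
    rw [hq, div_div, mul_comm, ← div_div, div_self hp0, mul_div_assoc', eq_comm,
      eq_div_iff h4, add_mul, div_mul_cancel₀ _ h4]
    ring

/-- The weighted bound of the potential. -/
theorem rlPotential_bound {α p q : ℝ} (hα0 : 0 < α) (hα1 : α < 1) (hp1 : 1 < p)
    (hpα : p < 1 / α) (hq : q = p / (1 - α * p)) :
    ∃ C : ℝ≥0∞, C ≠ ∞ ∧ ∀ w : ℝ → ℝ, MemAMinus p q w →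
      ∀ f : ℝ → ℝ, MemWLp p (fun x => w x ^ p) f →
        RLDefined α f ∧ AEMeasurable (rlPotential α f) volume ∧
          wLpNorm q (fun x => w x ^ q) (rlPotential α f) ≤
            C * charMinus p q w ^ ((1 - α) * max 1 (conjExp p / q)) *
              wLpNorm p (fun x => w x ^ p) f := by
  obtain ⟨hq1, hpq⟩ := exponent_relations hα0 hp1 hpα hq
  have hp : p.HolderConjugate (conjExp p) := Real.HolderConjugate.conjExponent hp1
  have hp0 := hp.pos
  have hq0 : 0 < q := by linarith
  obtain ⟨C, hC, hbound⟩ := lintegral_lrl_rpow_le hp hq1 hα0 hα1 hpq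
  refine ⟨C, hC, ?_⟩
  intro w ⟨hw, hchar⟩ f ⟨hfm, hfn⟩
  obtain ⟨W, hWm, hW0, hwW⟩ := hw.exists_measurable
  have hfg := hfm.ae_eq_mk
  set g := hfm.mk f with hg
  have hgm : Measurable g := hfm.measurable_mk
  rw [charMinus_congr hwW] at hchar ⊢
  have hwp : ∀ r : ℝ, (fun x => w x ^ r) =ᵐ[volume] fun x => W x ^ r := fun r =>
    hwW.mono fun x hx => by simp only [hx]
  rw [wLpNorm_congr (hwp p)] at hfn ⊢
  rw [wLpNorm_congr (hwp q), rlPotential_congr hfg]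
  have hchar' : ∀ x h : ℝ, 0 < h → (ENNReal.ofReal (1 / h) * ∫⁻ t in Ioc x (x + h),
      ENNReal.ofReal (W t ^ q)) * (ENNReal.ofReal (1 / h) * ∫⁻ t in Ioc (x - h) x,
      ENNReal.ofReal (W t ^ (-conjExp p))) ^ (q / conjExp p) ≤ charMinus p q W := by
    intro x h hh
    exact le_iSup_of_le x (le_iSup_of_le h (le_iSup_of_le hh le_rfl))
  have hK1 := one_le_of_average_mul_le hp.symm.pos hq0 hWm hW0 hchar.ne hchar'
  obtain ⟨κ, hκ⟩ := exists_pow2 (zero_lt_one.trans_le hK1).ne' hchar.ne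
  rw [hκ] at hchar' hK1 ⊢
  rw [← pow2_zero, pow2_le] at hK1
  set φ : ℝ → ℝ≥0∞ := fun t => ENNReal.ofReal |g t| with hφ
  have hφm : Measurable φ := hgm.abs.ennreal_ofReal
  have hnorm : wLpNorm p (fun x => W x ^ p) f =
      (∫⁻ x, φ x ^ p * ENNReal.ofReal (W x ^ p)) ^ (1 / p) := by
    rw [wLpNorm]
    congr 1
    refine lintegral_congr_ae (hfg.mono fun x hx => ?_)
    dsimp only
    rw [hx, hφ, ENNReal.ofReal_rpow_of_nonneg (abs_nonneg _) hp0.le,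
      ENNReal.ofReal_mul (by positivity)]
  have hfin : ∫⁻ x, φ x ^ p * ENNReal.ofReal (W x ^ p) ≠ ∞ := by
    rw [hnorm, ENNReal.rpow_lt_top_iff_of_pos (by positivity)] at hfn
    exact hfn.ne
  have h1 := hbound W κ hWm hW0 hK1 hchar' φ hφm.aemeasurable hfin
  rw [← hnorm, ← pow2_rpow] at h1
  set R := C * pow2 κ ^ ((1 - α) * max 1 (conjExp p / q)) * wLpNorm p (fun x => W x ^ p) f with hR
  have hRt : R ≠ ∞ := by
    refine ENNReal.mul_ne_top (ENNReal.mul_ne_top hC ?_) hfn.ne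
    rw [pow2_rpow]; exact pow2_ne_top _
  have hlm := measurable_lrl (α := α) hφm
  have hdef : ∀ᵐ x, lrl α φ x < ∞ := by
    have h2 := ae_lt_top ((hlm.pow_const q).mul (hWm.pow_const q).ennreal_ofReal)
      (ne_top_of_le_ne_top (ENNReal.rpow_ne_top_of_nonneg hq0.le hRt) h1)
    refine h2.mono fun x hx => ?_
    by_contra hcon
    rw [not_lt, top_le_iff] at hcon
    rw [Pi.mul_apply, hcon, ENNReal.top_rpow_of_pos hq0, ENNReal.top_mul] at hx
    · exact lt_irrefl _ hx
    · simpa using Real.rpow_pos_of_pos (hW0 x) q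
  refine ⟨rlDefined_congr hfg (rlDefined_of_lrl hgm hdef),
    (measurable_rlPotential hgm).aemeasurable, ?_⟩
  have h2 : ∫⁻ x, ENNReal.ofReal (|rlPotential α g x| ^ q * W x ^ q) ≤ R ^ q := by
    refine le_trans (lintegral_mono fun x => ?_) h1
    rw [ENNReal.ofReal_mul (by positivity), ← ENNReal.ofReal_rpow_of_nonneg (abs_nonneg _) hq0.le,
      ← Real.enorm_eq_ofReal_abs]
    exact mul_le_mul_left (ENNReal.rpow_le_rpow (enorm_rlPotential_le g x) hq0.le) _
  refine (ENNReal.rpow_le_rpow h2 (by positivity)).trans_eq ?_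
  rw [← ENNReal.rpow_mul, mul_one_div_cancel hq0.ne', ENNReal.rpow_one]

theorem wLpNorm_const_mul {p : ℝ} (hp : 0 < p) (v f : ℝ → ℝ) {c : ℝ} (hc : 0 ≤ c) :
    wLpNorm p v (fun x => c * f x) = ENNReal.ofReal c * wLpNorm p v f := by
  have h1 : ∀ x, ENNReal.ofReal (|c * f x| ^ p * v x) =
      ENNReal.ofReal (c ^ p) * ENNReal.ofReal (|f x| ^ p * v x) := by
    intro x
    rw [← ENNReal.ofReal_mul (by positivity), abs_mul, abs_of_nonneg hc,
      Real.mul_rpow hc (abs_nonneg _), mul_assoc]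
  rw [wLpNorm, wLpNorm]
  simp only [h1]
  rw [lintegral_const_mul' _ _ ENNReal.ofReal_ne_top, ENNReal.mul_rpow_of_nonneg _ _ (by positivity),
    ← ENNReal.ofReal_rpow_of_nonneg hc hp.le, ← ENNReal.rpow_mul, mul_one_div_cancel hp.ne',
    ENNReal.rpow_one]

/-- The operator norm of a homogeneous operator controls the image of every function of finite
positive norm. -/
theorem wLpNorm_le_wOpNorm_mul {T : (ℝ → ℝ) → ℝ → ℝ}
    (hT : ∀ (c : ℝ) (f : ℝ → ℝ), T (fun x => c * f x) = fun x => c * T f x) {p q : ℝ}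
    (hp : 0 < p) (hq : 0 < q) {u v f : ℝ → ℝ} (hf : MemWLp p u f) (hf0 : wLpNorm p u f ≠ 0) :
    wLpNorm q v (T f) ≤ wOpNorm T p u q v * wLpNorm p u f := by
  set A := wLpNorm p u f with hA
  have hAt : A ≠ ∞ := hf.2.ne
  have hA0 : 0 < A.toReal := ENNReal.toReal_pos hf0 hAt
  have hn : wLpNorm p u (fun x => A.toReal⁻¹ * f x) = 1 := by
    rw [wLpNorm_const_mul hp _ _ (by positivity), ENNReal.ofReal_inv_of_pos hA0,
      ENNReal.ofReal_toReal hAt, ← hA, ENNReal.inv_mul_cancel hf0 hAt]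
  have h1 : wLpNorm q v (T fun x => A.toReal⁻¹ * f x) ≤ wOpNorm T p u q v := by
    refine le_iSup_of_le (fun x => A.toReal⁻¹ * f x) (le_iSup_of_le ⟨hf.1.const_mul _, ?_⟩
      (le_iSup_of_le hn.le le_rfl))
    rw [hn]; exact ENNReal.one_lt_top
  rw [hT, wLpNorm_const_mul hq _ _ (by positivity), ENNReal.ofReal_inv_of_pos hA0,
    ENNReal.ofReal_toReal hAt] at h1
  rw [mul_comm]
  exact (ENNReal.inv_mul_le_iff hf0 hAt).1 h1

theorem rlPotential_const_mul (α c : ℝ) (f : ℝ → ℝ) :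
    rlPotential α (fun x => c * f x) = fun x => c * rlPotential α f x := by
  funext x
  simp only [rlPotential, mul_div_assoc]
  exact integral_const_mul _ _

/-! ### Power weights -/

theorem setLIntegral_preimage_neg (s : Set ℝ) (φ : ℝ → ℝ≥0∞) :
    ∫⁻ t in Neg.neg ⁻¹' s, φ (-t) = ∫⁻ t in s, φ t :=
  (Measure.measurePreserving_neg (volume : Measure ℝ)).setLIntegral_comp_preimage_emb
    (MeasurableEquiv.neg ℝ).measurableEmbedding φ s

theorem setLIntegral_Ioo_neg (a b : ℝ) (φ : ℝ → ℝ≥0∞) :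
    ∫⁻ t in Ioo (-b) (-a), φ t = ∫⁻ t in Ioo a b, φ (-t) := by
  rw [← setLIntegral_preimage_neg]
  simp

theorem lintegral_Ioo_rpow {a b : ℝ} (ha : -1 < a) (hb : 0 ≤ b) :
    ∫⁻ t in Ioo 0 b, ENNReal.ofReal (t ^ a) = ENNReal.ofReal (b ^ (a + 1) / (a + 1)) := by
  have h1 := integral_rpow (a := 0) (b := b) (r := a) (Or.inl ha)
  rw [Real.zero_rpow (by linarith), sub_zero, intervalIntegral.integral_of_le hb] at h1
  rw [← h1, ofReal_integral_eq_lintegral_ofReal, setLIntegral_congr Ioo_ae_eq_Ioc]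
  · exact (intervalIntegrable_iff_integrableOn_Ioc_of_le hb).1
      (intervalIntegral.intervalIntegrable_rpow' ha)
  · filter_upwards [ae_restrict_mem measurableSet_Ioc] with t ht
    exact Real.rpow_nonneg ht.1.le _

theorem lintegral_Ioo_inv {x : ℝ} (hx : 0 < x) (hx1 : x ≤ 1) :
    ∫⁻ t in Ioo x 1, ENNReal.ofReal t⁻¹ = ENNReal.ofReal (Real.log (1 / x)) := by
  have h1 := integral_inv_of_pos hx one_pos
  rw [intervalIntegral.integral_of_le hx1] at h1
  rw [← h1, ofReal_integral_eq_lintegral_ofReal, setLIntegral_congr Ioo_ae_eq_Ioc]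
  · refine (intervalIntegrable_iff_integrableOn_Ioc_of_le hx1).1
      (intervalIntegral.intervalIntegrable_inv (fun t ht => ?_) continuousOn_id)
    rw [uIcc_of_le hx1] at ht
    exact (hx.trans_le ht.1).ne'
  · filter_upwards [ae_restrict_mem measurableSet_Ioc] with t ht
    exact inv_nonneg.2 (hx.trans ht.1).le

theorem lintegral_Ioc_abs_rpow_le {a b : ℝ} (ha : -1 < a) (hb : 0 ≤ b) :
    ∫⁻ t in Ioc (-b) b, ENNReal.ofReal (|t| ^ a) ≤ ENNReal.ofReal (2 * (b ^ (a + 1) / (a + 1))) := by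
  have h1 : ∫⁻ t in Ioo 0 b, ENNReal.ofReal (|t| ^ a) =
      ENNReal.ofReal (b ^ (a + 1) / (a + 1)) := by
    rw [← lintegral_Ioo_rpow ha hb]
    exact setLIntegral_congr_fun measurableSet_Ioo fun t ht => by
      simp only [abs_of_pos ht.1]
  have h2 : ∫⁻ t in Ioo (-b) 0, ENNReal.ofReal (|t| ^ a) =
      ENNReal.ofReal (b ^ (a + 1) / (a + 1)) := by
    have := setLIntegral_Ioo_neg 0 b fun t => ENNReal.ofReal (|t| ^ a)
    rw [neg_zero] at this
    rw [this]
    simpa only [abs_neg] using h1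
  rw [← Ioc_union_Ioc_eq_Ioc (neg_nonpos.2 hb) hb]
  refine (lintegral_union_le _ _ _).trans_eq ?_
  rw [← setLIntegral_congr Ioo_ae_eq_Ioc, ← setLIntegral_congr Ioo_ae_eq_Ioc, h1, h2, two_mul,
    ENNReal.ofReal_add] <;> exact div_nonneg (by positivity) (by linarith)

/-- Averages of a power over intervals of length `h` that lie within `3 h` of the origin. -/
theorem average_abs_rpow_le_of_subset {a h : ℝ} (ha : -1 < a) (hh : 0 < h) {E : Set ℝ}
    (hE : E ⊆ Ioc (-(3 * h)) (3 * h)) :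
    ENNReal.ofReal (1 / h) * ∫⁻ t in E, ENNReal.ofReal (|t| ^ a) ≤
      ENNReal.ofReal (6 * (3 * h) ^ a / (a + 1)) := by
  refine (mul_le_mul_right ((lintegral_mono_set hE).trans
    (lintegral_Ioc_abs_rpow_le ha (by positivity))) _).trans_eq ?_
  rw [← ENNReal.ofReal_mul (by positivity), Real.rpow_add (by positivity), Real.rpow_one]
  congr 1
  have : a + 1 ≠ 0 := by linarith
  field_simp
  ring

/-- Averages of a power over intervals whose points are comparable with `x`. -/
theorem average_abs_rpow_le_of_comparable {a h x c : ℝ} (ha : -1 ≤ a) (ha1 : a ≤ 1) (hh : 0 < h)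
    (hx : 0 < |x|) (hE : ∀ t ∈ Ioc c (c + h), |x| / 2 ≤ |t| ∧ |t| ≤ 2 * |x|) :
    ENNReal.ofReal (1 / h) * ∫⁻ t in Ioc c (c + h), ENNReal.ofReal (|t| ^ a) ≤
      ENNReal.ofReal (2 * |x| ^ a) := by
  have h1 : ∫⁻ t in Ioc c (c + h), ENNReal.ofReal (|t| ^ a) ≤
      ∫⁻ _ in Ioc c (c + h), ENNReal.ofReal (2 * |x| ^ a) := by
    refine setLIntegral_mono measurable_const fun t ht => ENNReal.ofReal_le_ofReal ?_
    obtain ⟨h1, h2⟩ := hE t ht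
    rcases le_total 0 a with h0 | h0
    · calc |t| ^ a ≤ (2 * |x|) ^ a := Real.rpow_le_rpow (abs_nonneg _) h2 h0
        _ = 2 ^ a * |x| ^ a := Real.mul_rpow (by norm_num) hx.le
        _ ≤ 2 * |x| ^ a := by
          refine mul_le_mul_of_nonneg_right ?_ (by positivity)
          simpa using Real.rpow_le_rpow_of_exponent_le (one_le_two (α := ℝ)) ha1
    · calc |t| ^ a ≤ (2⁻¹ * |x|) ^ a :=
            Real.rpow_le_rpow_of_nonpos (by positivity) (by linarith) h0
        _ = 2 ^ (-a) * |x| ^ a := by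
          rw [Real.mul_rpow (by norm_num) hx.le, Real.inv_rpow (by norm_num),
            Real.rpow_neg (by norm_num)]
        _ ≤ 2 * |x| ^ a := by
          refine mul_le_mul_of_nonneg_right ?_ (by positivity)
          simpa using Real.rpow_le_rpow_of_exponent_le (one_le_two (α := ℝ))
            (show -a ≤ 1 by linarith)
  refine (mul_le_mul_right h1 _).trans_eq ?_
  rw [setLIntegral_const, Real.volume_Ioc, add_sub_cancel_left, mul_comm, mul_assoc,
    ← ENNReal.ofReal_mul hh.le, mul_one_div_cancel hh.ne', ENNReal.ofReal_one, mul_one]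

/-- The characteristic of a power weight. With `a` and `b` the exponents of `w ^ q` and
`w ^ (-p')`, homogeneity gives `a + (q / p') b = 0`, so that the bound does not depend on the
interval. -/
theorem charMinus_abs_rpow_le {p q γ : ℝ} (hp' : 0 < conjExp p) (hq : 0 < q) (ha : -1 < γ * q)
    (ha1 : γ * q ≤ 1) (hb : -1 < γ * -conjExp p) (hb1 : γ * -conjExp p ≤ 1) :
    charMinus p q (fun x => |x| ^ γ) ≤ ENNReal.ofReal (8 ^ (1 + q / conjExp p) /
      ((γ * q + 1) * (γ * -conjExp p + 1) ^ (q / conjExp p))) := by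
  have hs0 : 0 < q / conjExp p := by positivity
  have hab : γ * q + γ * -conjExp p * (q / conjExp p) = 0 := by field_simp; ring
  set s := q / conjExp p
  have hw : ∀ r : ℝ, (fun t : ℝ => ENNReal.ofReal ((|t| ^ γ) ^ r)) =
      fun t => ENNReal.ofReal (|t| ^ (γ * r)) := fun r => by
    funext t; rw [← Real.rpow_mul (abs_nonneg t)]
  simp only [charMinus, hw]
  set a := γ * q
  set b := γ * -conjExp p
  have ha' : 0 < a + 1 := by linarith
  have hb' : 0 < b + 1 := by linarith
  refine iSup_le fun x => iSup_le fun h => iSup_le fun hh => ?_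
  have hprod : ∀ y D₁ D₂ : ℝ, 0 < y → 0 < D₁ → 0 < D₂ →
      ENNReal.ofReal (D₁ * y ^ a) * ENNReal.ofReal (D₂ * y ^ b) ^ s =
        ENNReal.ofReal (D₁ * D₂ ^ s) := by
    intro y D₁ D₂ hy h1 h2
    rw [ENNReal.ofReal_rpow_of_nonneg (by positivity) hs0.le, ← ENNReal.ofReal_mul (by positivity),
      Real.mul_rpow h2.le (by positivity), ← Real.rpow_mul hy.le]
    congr 1
    calc D₁ * y ^ a * (D₂ ^ s * y ^ (b * s)) = D₁ * D₂ ^ s * (y ^ a * y ^ (b * s)) := by ring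
      _ = D₁ * D₂ ^ s := by rw [← Real.rpow_add hy, hab, Real.rpow_zero, mul_one]
  rcases le_or_gt |x| (2 * h) with hx | hx
  · obtain ⟨hx1, hx2⟩ := abs_le.1 hx
    have h1 := average_abs_rpow_le_of_subset (a := a) (E := Ioc x (x + h)) ha hh
      (Ioc_subset_Ioc (by linarith) (by linarith))
    have h2 := average_abs_rpow_le_of_subset (a := b) (E := Ioc (x - h) x) hb hh
      (Ioc_subset_Ioc (by linarith) (by linarith))
    refine (mul_le_mul' h1 (ENNReal.rpow_le_rpow h2 hs0.le)).trans ?_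
    rw [mul_div_right_comm, mul_div_right_comm, hprod _ _ _ (by positivity) (by positivity)
      (by positivity)]
    refine ENNReal.ofReal_le_ofReal ?_
    rw [Real.div_rpow (by norm_num) hb'.le, div_mul_div_comm]
    refine div_le_div_of_nonneg_right ?_ (by positivity)
    calc (6 : ℝ) * 6 ^ s = 6 ^ (1 + s) := by rw [Real.rpow_add (by norm_num), Real.rpow_one]
      _ ≤ 8 ^ (1 + s) := Real.rpow_le_rpow (by norm_num) (by norm_num) (by linarith)
  · have hx0 : 0 < |x| := by linarith
    have hfar : ∀ t, |t - x| ≤ h → |x| / 2 ≤ |t| ∧ |t| ≤ 2 * |x| := fun t ht => by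
      have h1 := abs_sub_abs_le_abs_sub t x
      have h2 := abs_sub_abs_le_abs_sub x t
      rw [abs_sub_comm x t] at h2
      constructor <;> linarith
    have h1 := average_abs_rpow_le_of_comparable (a := a) (x := x) (c := x) ha.le ha1 hh hx0
      fun t ht => hfar t (abs_le.2 ⟨by linarith [ht.1], by linarith [ht.2]⟩)
    have h2 := average_abs_rpow_le_of_comparable (a := b) (x := x) (c := x - h) hb.le hb1 hh hx0
      fun t ht => hfar t (abs_le.2 ⟨by linarith [ht.1], by linarith [ht.2]⟩)
    rw [sub_add_cancel] at h2
    refine (mul_le_mul' h1 (ENNReal.rpow_le_rpow h2 hs0.le)).trans ?_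
    rw [hprod _ _ _ hx0 (by norm_num) (by norm_num)]
    refine ENNReal.ofReal_le_ofReal ?_
    rw [le_div_iff₀ (by positivity)]
    have h3 : (b + 1) ^ s ≤ 2 ^ s := Real.rpow_le_rpow hb'.le (by linarith) hs0.le
    calc 2 * 2 ^ s * ((a + 1) * (b + 1) ^ s) ≤ 2 * 2 ^ s * (2 * 2 ^ s) := by
          gcongr; linarith
      _ = (4 : ℝ) ^ (1 + s) := by
          rw [show (4 : ℝ) = 2 * 2 by norm_num, Real.mul_rpow (by norm_num) (by norm_num),
            Real.rpow_add (by norm_num), Real.rpow_one]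
      _ ≤ 8 ^ (1 + s) := Real.rpow_le_rpow (by norm_num) (by norm_num) (by linarith)

theorem measurable_abs_rpow (γ : ℝ) : Measurable fun x : ℝ => |x| ^ γ :=
  measurable_id.abs.pow_const γ

theorem isWeight_abs_rpow {γ : ℝ} (hγ : -1 < γ) : IsWeight fun x => |x| ^ γ := by
  constructor
  · intro x
    refine ⟨Ioc (-(|x| + 1)) (|x| + 1), Ioc_mem_nhds ?_ ?_,
      (measurable_abs_rpow γ).aestronglyMeasurable, ?_⟩
    · linarith [neg_abs_le x]
    · linarith [le_abs_self x]
    · rw [hasFiniteIntegral_iff_ofReal (ae_of_all _ fun t => by positivity)]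
      exact (lintegral_Ioc_abs_rpow_le hγ (by positivity)).trans_lt ENNReal.ofReal_lt_top
  · have : ∀ᵐ x : ℝ, x ≠ 0 := by simp [ae_iff, measure_singleton]
    exact this.mono fun x hx => Real.rpow_pos_of_pos (abs_pos.2 hx) _

/-- A lower bound for the operator norm from a single nonnegative function. -/
theorem le_wOpNorm_rlPotential {α p q : ℝ} (hα0 : 0 < α) (hα1 : α < 1) (hp1 : 1 < p)
    (hpα : p < 1 / α) (hq : q = p / (1 - α * p)) {w f : ℝ → ℝ} (hw : MemAMinus p q w)
    (hfm : Measurable f) (hf0 : ∀ t, 0 ≤ f t) {A B : ℝ} (hA : 0 < A) (hB : 0 ≤ B)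
    (hfA : ∫⁻ x, ENNReal.ofReal (|f x| ^ p * w x ^ p) = ENNReal.ofReal A)
    (hfB : ENNReal.ofReal B ≤ ∫⁻ x, lrl α (fun t => ENNReal.ofReal (f t)) x ^ q *
      ENNReal.ofReal (w x ^ q)) :
    ENNReal.ofReal (B ^ (1 / q) / A ^ (1 / p)) ≤
      wOpNorm (rlPotential α) p (fun x => w x ^ p) q (fun x => w x ^ q) := by
  obtain ⟨hq1, -⟩ := exponent_relations hα0 hp1 hpα hq
  have hq0 : 0 < q := by linarith
  have hp0 : 0 < p := by linarith
  have hn : wLpNorm p (fun x => w x ^ p) f = ENNReal.ofReal (A ^ (1 / p)) := by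
    rw [wLpNorm, hfA, ENNReal.ofReal_rpow_of_pos hA]
  have hA' : 0 < A ^ (1 / p) := by positivity
  have hmem : MemWLp p (fun x => w x ^ p) f :=
    ⟨hfm.aemeasurable, by rw [hn]; exact ENNReal.ofReal_lt_top⟩
  obtain ⟨C, -, hC⟩ := rlPotential_bound hα0 hα1 hp1 hpα hq
  obtain ⟨hdef, -, -⟩ := hC w hw f hmem
  have h1 := wLpNorm_le_wOpNorm_mul (rlPotential_const_mul α) hp0 hq0
    (v := fun x => w x ^ q) hmem (by rw [hn]; simpa using hA')
  have h2 : ENNReal.ofReal (B ^ (1 / q)) ≤ wLpNorm q (fun x => w x ^ q) (rlPotential α f) := by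
    rw [← ENNReal.ofReal_rpow_of_nonneg hB (by positivity), wLpNorm]
    refine ENNReal.rpow_le_rpow (hfB.trans (le_of_eq (lintegral_congr_ae ?_))) (by positivity)
    filter_upwards [ofReal_rlPotential hf0 hdef, hw.1.ae_pos] with x hx hwx
    rw [← hx, ENNReal.ofReal_mul (by positivity),
      ← ENNReal.ofReal_rpow_of_nonneg (abs_nonneg _) hq0.le, abs_of_nonneg]
    exact setIntegral_nonneg measurableSet_Iio fun t ht => by
      have : 0 < x - t := sub_pos.2 ht
      exact div_nonneg (hf0 t) (by positivity)
  rw [ENNReal.ofReal_div_of_pos hA']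
  refine ENNReal.div_le_of_le_mul ?_
  rw [← hn]
  exact h2.trans h1

/-! ### Extremal families -/

/-- The power of `L` in the quotient of norms: `(1 + q) / q - 1 / p = 1 - α`. -/
theorem extremal_ratio {α p q κ μ L : ℝ} (hp : 0 < p) (hq : 0 < q) (hpq : q / p = 1 + α * q)
    (hκ : 0 < κ) (hμ : 0 < μ) (hL : 0 < L) :
    (κ * L ^ (1 + q)) ^ (1 / q) / (μ * L) ^ (1 / p) =
      κ ^ (1 / q) / μ ^ (1 / p) * L ^ (1 - α) := by
  rw [Real.mul_rpow hκ.le (by positivity), Real.mul_rpow hμ.le hL.le, ← Real.rpow_mul hL.le,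
    mul_div_mul_comm, ← Real.rpow_sub hL]
  have : (1 + q) * (1 / q) - 1 / p = 1 - α := by
    have h1 : 1 / p = 1 / q + α := by
      have : 1 / p = q / p / q := by field_simp
      rw [this, hpq]; field_simp
    rw [h1]; field_simp; ring
  rw [this]

/-- The extremal family for `q ≤ p'`: as `δ → 0` the singularity at the origin of
`w ^ (-p') = |x| ^ (δ - 1)` becomes critical, and so does the one of the test function
`t ^ (δ - 1)` on `(0, 1)`. -/
theorem exists_extremal_of_le {α p q δ : ℝ} (hα0 : 0 < α) (hα1 : α < 1) (hp1 : 1 < p)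
    (hpα : p < 1 / α) (hq : q = p / (1 - α * p)) (hle : q ≤ conjExp p) (hδ : 0 < δ) (hδ1 : δ ≤ 1) :
    ∃ w, MemAMinus p q w ∧
      charMinus p q w ≤ ENNReal.ofReal (8 ^ (1 + q / conjExp p) * δ⁻¹ ^ (q / conjExp p)) ∧
      ENNReal.ofReal ((p / q) ^ (1 / q) / 1 ^ (1 / p) * δ⁻¹ ^ (1 - α)) ≤
        wOpNorm (rlPotential α) p (fun x => w x ^ p) q (fun x => w x ^ q) := by
  obtain ⟨hq1, hpq⟩ := exponent_relations hα0 hp1 hpα hq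
  have hp : p.HolderConjugate (conjExp p) := Real.HolderConjugate.conjExponent hp1
  have hp0 := hp.pos
  have hp'0 : 0 < conjExp p := hp.symm.pos
  have hq0 : 0 < q := by linarith
  set s := q / conjExp p with hs
  have hs0 : 0 < s := by positivity
  have hs1 : s ≤ 1 := (div_le_one hp'0).2 hle
  have hinv : (conjExp p)⁻¹ = 1 - p⁻¹ := by linarith [hp.inv_add_inv_eq_one]
  have hsq : s = q * (1 - α) - 1 := by
    rw [hs, div_eq_mul_inv, hinv, mul_sub, ← div_eq_mul_inv q p, hpq]; ring
  set γ := (1 - δ) / conjExp p with hγ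
  have hγ0 : 0 ≤ γ := div_nonneg (by linarith) hp'0.le
  have hγq : γ * q = (1 - δ) * s := by rw [hγ, hs]; ring
  have hγp' : γ * -conjExp p = δ - 1 := by rw [hγ]; field_simp; ring
  have hγp : γ * p = (1 - δ) * (p - 1) := by
    rw [hγ, div_eq_mul_inv, hinv]; field_simp
  have hchar : charMinus p q (fun x => |x| ^ γ) ≤
      ENNReal.ofReal (8 ^ (1 + s) * δ⁻¹ ^ s) := by
    have h1 : 0 ≤ (1 - δ) * s := mul_nonneg (by linarith) hs0.le
    have h2 : (1 - δ) * s ≤ 1 := by nlinarith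
    refine (charMinus_abs_rpow_le hp'0 hq0 (by rw [hγq]; linarith) (by rw [hγq]; linarith)
      (by rw [hγp']; linarith) (by rw [hγp']; linarith)).trans (ENNReal.ofReal_le_ofReal ?_)
    rw [hγq, hγp', sub_add_cancel, ← hs, Real.inv_rpow hδ.le, ← div_eq_mul_inv]
    refine div_le_div_of_nonneg_left (by positivity) (by positivity) ?_
    exact le_mul_of_one_le_left (by positivity) (by linarith)
  have hmem : MemAMinus p q (fun x => |x| ^ γ) :=
    ⟨isWeight_abs_rpow (by linarith), hchar.trans_lt ENNReal.ofReal_lt_top⟩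
  refine ⟨_, hmem, hchar, ?_⟩
  rw [← extremal_ratio hp0 hq0 hpq (by positivity) one_pos (inv_pos.2 hδ)]
  set f : ℝ → ℝ := (Ioo 0 1).indicator fun t => t ^ (δ - 1) with hf
  have hf0 : ∀ t, 0 ≤ f t := indicator_nonneg fun t ht => Real.rpow_nonneg ht.1.le _
  have hfm : Measurable f := (measurable_id.pow_const (δ - 1)).indicator measurableSet_Ioo
  refine le_wOpNorm_rlPotential hα0 hα1 hp1 hpα hq hmem hfm hf0 (by positivity)
    (by positivity) ?_ ?_
  · have h1 : (fun x => ENNReal.ofReal (|f x| ^ p * (|x| ^ γ) ^ p)) =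
        (Ioo 0 1).indicator fun x => ENNReal.ofReal (x ^ (δ - 1)) := by
      funext x
      by_cases hx : x ∈ Ioo (0 : ℝ) 1
      · have hx0 : 0 < x := hx.1
        rw [hf, indicator_of_mem hx, indicator_of_mem hx, abs_of_pos hx0,
          abs_of_pos (by positivity), ← Real.rpow_mul hx0.le, ← Real.rpow_mul hx0.le,
          ← Real.rpow_add hx0, hγp]
        congr 2; ring
      · rw [hf, indicator_of_notMem hx, indicator_of_notMem hx, abs_zero,
          Real.zero_rpow hp0.ne', zero_mul, ENNReal.ofReal_zero]
    rw [h1, lintegral_indicator measurableSet_Ioo, lintegral_Ioo_rpow (by linarith) zero_le_one,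
      sub_add_cancel, Real.one_rpow, one_mul, one_div]
  · have hlrl : ∀ x ∈ Ioo (0 : ℝ) 1, ENNReal.ofReal (x ^ (α - 1) * (x ^ δ / δ)) ≤
        lrl α (fun t => ENNReal.ofReal (f t)) x := by
      intro x hx
      have h1 := lintegral_Ioo_rpow (a := δ - 1) (by linarith) hx.1.le
      rw [sub_add_cancel] at h1
      rw [ENNReal.ofReal_mul (Real.rpow_nonneg hx.1.le _), ← h1,
        ← lintegral_const_mul' _ _ ENNReal.ofReal_ne_top]
      refine le_trans (setLIntegral_mono' measurableSet_Ioo fun t ht => ?_)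
        (lintegral_mono_set Ioo_subset_Iio_self)
      dsimp only
      rw [hf, indicator_of_mem (show t ∈ Ioo (0 : ℝ) 1 from ⟨ht.1, ht.2.trans hx.2⟩)]
      refine mul_le_mul_left (ENNReal.ofReal_le_ofReal ?_) _
      exact Real.rpow_le_rpow_of_nonpos (by linarith [ht.2]) (by linarith [ht.1]) (by linarith)
    -- the power of `x` in the integrand of the lower bound is `δ q / p - 1`
    have he : 0 < δ * (q / p) := by positivity
    have h2 : ENNReal.ofReal (p / q * δ⁻¹ ^ (1 + q)) = ∫⁻ x in Ioo (0 : ℝ) 1,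
        ENNReal.ofReal (δ⁻¹ ^ q) * ENNReal.ofReal (x ^ (δ * (q / p) - 1)) := by
      rw [lintegral_const_mul' _ _ ENNReal.ofReal_ne_top,
        lintegral_Ioo_rpow (by linarith) zero_le_one, sub_add_cancel, Real.one_rpow,
        ← ENNReal.ofReal_mul (by positivity), Real.rpow_add (by positivity), Real.rpow_one]
      congr 1
      field_simp
    rw [h2]
    refine le_trans (setLIntegral_mono' measurableSet_Ioo fun x hx => ?_)
      (setLIntegral_le_lintegral (Ioo 0 1) _)
    have hx0 : 0 < x := hx.1
    refine le_trans (le_of_eq ?_)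
      (mul_le_mul_left (ENNReal.rpow_le_rpow (hlrl x hx) hq0.le) _)
    have e : δ * (q / p) - 1 = (α - 1) * q + δ * q + γ * q := by rw [hγq, hsq, hpq]; ring
    rw [ENNReal.ofReal_rpow_of_nonneg (by positivity) hq0.le, ← ENNReal.ofReal_mul (by positivity),
      ← ENNReal.ofReal_mul (by positivity), abs_of_pos hx0, div_eq_mul_inv (x ^ δ) δ,
      Real.mul_rpow (by positivity) (by positivity), Real.mul_rpow (by positivity) (by positivity),
      ← Real.rpow_mul hx0.le, ← Real.rpow_mul hx0.le, ← Real.rpow_mul hx0.le, e,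
      Real.rpow_add hx0, Real.rpow_add hx0]
    congr 1
    ring

/-- The extremal family for `p' ≤ q`: as `δ → 0` the singularity at the origin of
`w ^ q = |x| ^ (δ - 1)` becomes critical; the potential of the test function `|t| ^ (-α)` on
`(-1, 0)` is at least a multiple of `log (1 / x)` to the right of the origin. -/
theorem exists_extremal_of_ge {α p q δ : ℝ} (hα0 : 0 < α) (hα1 : α < 1) (hp1 : 1 < p)
    (hpα : p < 1 / α) (hq : q = p / (1 - α * p)) (hge : conjExp p ≤ q) (hδ : 0 < δ) (hδ1 : δ ≤ 1) :
    ∃ w, MemAMinus p q w ∧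
      charMinus p q w ≤ ENNReal.ofReal (8 ^ (1 + q / conjExp p) * δ⁻¹ ^ (1 : ℝ)) ∧
      ENNReal.ofReal (((2 ^ (α - 1)) ^ q * Real.exp (-1)) ^ (1 / q) / (q / p) ^ (1 / p) *
          δ⁻¹ ^ (1 - α)) ≤
        wOpNorm (rlPotential α) p (fun x => w x ^ p) q (fun x => w x ^ q) := by
  obtain ⟨hq1, hpq⟩ := exponent_relations hα0 hp1 hpα hq
  have hp : p.HolderConjugate (conjExp p) := Real.HolderConjugate.conjExponent hp1
  have hp0 := hp.pos
  have hp'0 : 0 < conjExp p := hp.symm.pos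
  have hq0 : 0 < q := by linarith
  set s := q / conjExp p with hs
  have hs0 : 0 < s := by positivity
  have hqp : p / q = 1 - α * p := by
    rw [div_eq_iff hp0.ne'] at hpq
    rw [div_eq_iff hq0.ne']; linarith
  set γ := (δ - 1) / q with hγ
  have hγq : γ * q = δ - 1 := by rw [hγ]; field_simp
  have hγp' : γ * -conjExp p = (1 - δ) * (conjExp p / q) := by rw [hγ]; ring
  have hγp : γ * p = (δ - 1) * (p / q) := by rw [hγ]; ring
  have hγ1 : -1 < γ := by
    rw [hγ, lt_div_iff₀ hq0]; linarith
  have hchar : charMinus p q (fun x => |x| ^ γ) ≤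
      ENNReal.ofReal (8 ^ (1 + s) * δ⁻¹ ^ (1 : ℝ)) := by
    have h0 : conjExp p / q ≤ 1 := (div_le_one hq0).2 hge
    have h0' : 0 < conjExp p / q := by positivity
    have h1 : 0 ≤ (1 - δ) * (conjExp p / q) := mul_nonneg (by linarith) h0'.le
    have h2 : (1 - δ) * (conjExp p / q) ≤ 1 := by nlinarith
    refine (charMinus_abs_rpow_le hp'0 hq0 (by rw [hγq]; linarith) (by rw [hγq]; linarith)
      (by rw [hγp']; linarith) (by rw [hγp']; linarith)).trans (ENNReal.ofReal_le_ofReal ?_)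
    rw [hγq, hγp', sub_add_cancel, ← hs, Real.rpow_one, ← div_eq_mul_inv]
    refine div_le_div_of_nonneg_left (by positivity) (by positivity) ?_
    exact le_mul_of_one_le_right hδ.le (Real.one_le_rpow (by linarith) hs0.le)
  have hmem : MemAMinus p q (fun x => |x| ^ γ) :=
    ⟨isWeight_abs_rpow hγ1, hchar.trans_lt ENNReal.ofReal_lt_top⟩
  refine ⟨_, hmem, hchar, ?_⟩
  rw [← extremal_ratio hp0 hq0 hpq (by positivity) (by positivity) (inv_pos.2 hδ)]
  set f : ℝ → ℝ := (Ioo (-1) 0).indicator fun t => |t| ^ (-α) with hf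
  have hf0 : ∀ t, 0 ≤ f t := indicator_nonneg fun t _ => Real.rpow_nonneg (abs_nonneg t) _
  have hneg : ∀ t ∈ Ioo (0 : ℝ) 1, f (-t) = t ^ (-α) := by
    intro t ht
    rw [hf, indicator_of_mem (show -t ∈ Ioo (-1 : ℝ) 0 from ⟨neg_lt_neg ht.2, neg_lt_zero.2 ht.1⟩),
      abs_neg, abs_of_pos ht.1]
  refine le_wOpNorm_rlPotential hα0 hα1 hp1 hpα hq hmem
    ((measurable_abs_rpow _).indicator measurableSet_Ioo) hf0 (by positivity)
    (by positivity) ?_ ?_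
  · have h1 : (fun x => ENNReal.ofReal (|f x| ^ p * (|x| ^ γ) ^ p)) =
        (Ioo (-1) (-0)).indicator fun x => ENNReal.ofReal (|f x| ^ p * (|x| ^ γ) ^ p) := by
      funext x
      by_cases hx : x ∈ Ioo (-1 : ℝ) (-0)
      · rw [indicator_of_mem hx]
      · rw [indicator_of_notMem hx]
        rw [neg_zero] at hx
        rw [hf, indicator_of_notMem hx, abs_zero, Real.zero_rpow hp0.ne', zero_mul,
          ENNReal.ofReal_zero]
    have he : 0 < δ * (p / q) := by positivity
    rw [h1, lintegral_indicator measurableSet_Ioo, setLIntegral_Ioo_neg]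
    have h2 : ∫⁻ t in Ioo (0 : ℝ) 1, ENNReal.ofReal (|f (-t)| ^ p * (|-t| ^ γ) ^ p) =
        ∫⁻ t in Ioo (0 : ℝ) 1, ENNReal.ofReal (t ^ (δ * (p / q) - 1)) := by
      refine setLIntegral_congr_fun measurableSet_Ioo fun t ht => ?_
      have ht0 : 0 < t := ht.1
      rw [hneg t ht, abs_neg, abs_of_pos ht0, abs_of_pos (by positivity), ← Real.rpow_mul ht0.le,
        ← Real.rpow_mul ht0.le, ← Real.rpow_add ht0, hγp, hqp]
      congr 2; ring
    rw [h2, lintegral_Ioo_rpow (by linarith) zero_le_one, sub_add_cancel, Real.one_rpow]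
    congr 1
    field_simp
  · -- on `(0, exp (-1 / δ))` the logarithm is at least `1 / δ`, and `x ^ (δ - 1)` still has
    -- integral comparable with `1 / δ`
    have hexp1 : Real.exp (-δ⁻¹) ≤ 1 := Real.exp_le_one_iff.2 (by simpa using hδ.le)
    have hlrl : ∀ x ∈ Ioo (0 : ℝ) (Real.exp (-δ⁻¹)), ENNReal.ofReal (2 ^ (α - 1) * δ⁻¹) ≤
        lrl α (fun t => ENNReal.ofReal (f t)) x := by
      intro x hx
      have hx0 : 0 < x := hx.1
      have hx1 : x ≤ 1 := hx.2.le.trans hexp1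
      have h1 : δ⁻¹ ≤ Real.log (1 / x) := by
        rw [one_div, Real.log_inv, le_neg, ← Real.log_exp (-δ⁻¹)]
        exact Real.log_le_log hx0 hx.2.le
      refine (ENNReal.ofReal_le_ofReal (mul_le_mul_of_nonneg_left h1 (by positivity))).trans ?_
      rw [ENNReal.ofReal_mul (by positivity), ← lintegral_Ioo_inv hx0 hx1,
        ← lintegral_const_mul' _ _ ENNReal.ofReal_ne_top]
      have h2 : Ioo (-1) (-x) ⊆ Iio x := fun t ht => by
        have : t < -x := ht.2
        exact this.trans (by linarith)
      refine le_trans ?_ (lintegral_mono_set h2)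
      rw [setLIntegral_Ioo_neg]
      refine setLIntegral_mono' measurableSet_Ioo fun u hu => ?_
      have hu0 : 0 < u := hx0.trans hu.1
      dsimp only
      rw [hneg u ⟨hu0, hu.2⟩, ← ENNReal.ofReal_mul (by positivity),
        ← ENNReal.ofReal_mul (Real.rpow_nonneg (by linarith) _)]
      refine ENNReal.ofReal_le_ofReal ?_
      calc 2 ^ (α - 1) * u⁻¹ = (2 * u) ^ (α - 1) * u ^ (-α) := by
            rw [Real.mul_rpow (by norm_num) hu0.le, mul_assoc, ← Real.rpow_add hu0,
              ← Real.rpow_neg_one]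
            congr 2; ring
        _ ≤ (x - -u) ^ (α - 1) * u ^ (-α) := by
            refine mul_le_mul_of_nonneg_right ?_ (by positivity)
            exact Real.rpow_le_rpow_of_nonpos (by linarith) (by linarith [hu.1]) (by linarith)
    have h2 : ENNReal.ofReal ((2 ^ (α - 1)) ^ q * Real.exp (-1) * δ⁻¹ ^ (1 + q)) =
        ∫⁻ x in Ioo (0 : ℝ) (Real.exp (-δ⁻¹)),
          ENNReal.ofReal ((2 ^ (α - 1) * δ⁻¹) ^ q) * ENNReal.ofReal (x ^ (δ - 1)) := by
      rw [lintegral_const_mul' _ _ ENNReal.ofReal_ne_top,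
        lintegral_Ioo_rpow (by linarith) (Real.exp_pos _).le, sub_add_cancel,
        ← ENNReal.ofReal_mul (by positivity), Real.rpow_add (by positivity), Real.rpow_one,
        ← Real.exp_mul, neg_mul, inv_mul_cancel₀ hδ.ne',
        Real.mul_rpow (by positivity) (by positivity)]
      congr 1
      ring
    rw [h2]
    refine le_trans (setLIntegral_mono' measurableSet_Ioo fun x hx => ?_)
      (setLIntegral_le_lintegral (Ioo 0 (Real.exp (-δ⁻¹))) _)
    have hx0 : 0 < x := hx.1
    refine le_trans (le_of_eq ?_)
      (mul_le_mul_left (ENNReal.rpow_le_rpow (hlrl x hx) hq0.le) _)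
    rw [ENNReal.ofReal_rpow_of_nonneg (by positivity) hq0.le, abs_of_pos hx0,
      ← Real.rpow_mul hx0.le, hγq]

/-! ### Sharpness -/

/-- A two-sided comparison along a family on which the characteristic tends to infinity gives
sharpness: `N ≤ C K ^ β` for all weights, and `K ≤ D L ^ σ`, `c L ^ (σ β) ≤ N` for weights
indexed by `L ≥ 1`. -/
theorem isSharpExponent_of_family {A : (ℝ → ℝ) → Prop} {N K : (ℝ → ℝ) → ℝ≥0∞} {β σ c D : ℝ}
    {C : ℝ≥0∞} (hβ : 0 < β) (hσ : 0 < σ) (hc : 0 < c) (hD : 0 < D) (hC : C ≠ ∞)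
    (hK : ∀ w, A w → K w < ∞) (hN : ∀ w, A w → N w ≤ C * K w ^ β)
    (hfam : ∀ L : ℝ, 1 ≤ L → ∃ w, A w ∧ K w ≤ ENNReal.ofReal (D * L ^ σ) ∧
      ENNReal.ofReal (c * L ^ (σ * β)) ≤ N w) : IsSharpExponent A N K β := by
  set c₀ := c / D ^ β with hc₀
  have hc₀0 : 0 < c₀ := by positivity
  -- since `N ≤ C K ^ β`, the characteristic exceeds every `T` once `N` is large enough
  have key : ∀ T : ℝ, ∃ w, A w ∧ ∃ k : ℝ, 0 < k ∧ T ≤ k ∧ K w = ENNReal.ofReal k ∧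
      ENNReal.ofReal (c₀ * k ^ β) ≤ N w := by
    intro T
    set S := max T 1
    have hS0 : 0 < S := zero_lt_one.trans_le (le_max_right _ _)
    obtain ⟨L, hL, hL1⟩ := (((tendsto_rpow_atTop (mul_pos hσ hβ)).eventually_gt_atTop
      (C.toReal * S ^ β / c)).and (Filter.eventually_ge_atTop 1)).exists
    rw [div_lt_iff₀ hc] at hL
    obtain ⟨w, hw, hKw, hNw⟩ := hfam L hL1
    have hKt := (hK w hw).ne
    have hKr : K w = ENNReal.ofReal (K w).toReal := (ENNReal.ofReal_toReal hKt).symm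
    have hk : S < (K w).toReal := by
      by_contra! hcon
      have h1 := hNw.trans (hN w hw)
      rw [hKr, ENNReal.ofReal_rpow_of_nonneg ENNReal.toReal_nonneg hβ.le,
        ← ENNReal.ofReal_toReal hC, ← ENNReal.ofReal_mul ENNReal.toReal_nonneg,
        ENNReal.ofReal_le_ofReal_iff (by positivity)] at h1
      have h2 : (K w).toReal ^ β ≤ S ^ β := Real.rpow_le_rpow ENNReal.toReal_nonneg hcon hβ.le
      have h3 := mul_le_mul_of_nonneg_left h2 (ENNReal.toReal_nonneg (a := C))
      linarith
    refine ⟨w, hw, (K w).toReal, hS0.trans hk, (le_max_left _ _).trans hk.le, hKr, ?_⟩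
    refine (ENNReal.ofReal_le_ofReal ?_).trans hNw
    have hL0 : 0 < L := by linarith
    have h1 : (K w).toReal ≤ D * L ^ σ := ENNReal.toReal_le_of_le_ofReal (by positivity) hKw
    calc c₀ * (K w).toReal ^ β ≤ c₀ * (D * L ^ σ) ^ β := by
          refine mul_le_mul_of_nonneg_left ?_ hc₀0.le
          exact Real.rpow_le_rpow ENNReal.toReal_nonneg h1 hβ.le
      _ = c * L ^ (σ * β) := by
          rw [Real.mul_rpow hD.le (by positivity), ← Real.rpow_mul hL0.le, hc₀]
          field_simp
  constructor
  · rintro ψ - - hψo ⟨b, hb, hbound⟩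
    obtain ⟨T, hT⟩ := Filter.eventually_atTop.1 (hψo.def (c := c₀ / (2 * b)) (by positivity))
    obtain ⟨w, hw, k, hk, hTk, hKw, hNw⟩ := key T
    have h1 := hNw.trans (hbound w hw)
    have hkβ : 0 < k ^ β := by positivity
    rw [hKw, ENNReal.toReal_ofReal hk.le] at h1
    have h2 := hT k hTk
    rw [Real.norm_of_nonneg hkβ.le] at h2
    have h3 : b * ψ k ≤ c₀ * k ^ β / 2 := by
      calc b * ψ k ≤ b * (c₀ / (2 * b) * k ^ β) :=
            mul_le_mul_of_nonneg_left ((le_abs_self _).trans h2) hb.le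
        _ = c₀ * k ^ β / 2 := by field_simp
    have h4 : 0 < c₀ * k ^ β := by positivity
    have h5 := h1.trans (ENNReal.ofReal_le_ofReal h3)
    rw [ENNReal.ofReal_le_ofReal_iff (by positivity)] at h5
    linarith
  · intro δ hδ
    refine ENNReal.eq_top_of_forall_nnreal_le fun r => ?_
    obtain ⟨T, hT⟩ := Filter.eventually_atTop.1
      ((tendsto_rpow_atTop hδ).eventually_ge_atTop ((r : ℝ) / c₀))
    obtain ⟨w, hw, k, hk, hTk, hKw, hNw⟩ := key T
    have h1 := hT k hTk
    rw [div_le_iff₀ hc₀0] at h1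
    refine le_iSup_of_le w (le_iSup_of_le hw ?_)
    rw [hKw, ENNReal.ofReal_rpow_of_pos hk]
    have hkd : 0 < k ^ (β - δ) := by positivity
    rw [ENNReal.le_div_iff_mul_le (Or.inl (by simpa using hkd)) (Or.inl ENNReal.ofReal_ne_top),
      ← ENNReal.ofReal_coe_nnreal, ← ENNReal.ofReal_mul r.coe_nonneg]
    refine (ENNReal.ofReal_le_ofReal ?_).trans hNw
    calc (r : ℝ) * k ^ (β - δ) ≤ k ^ δ * c₀ * k ^ (β - δ) :=
          mul_le_mul_of_nonneg_right h1 hkd.le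
      _ = c₀ * (k ^ δ * k ^ (β - δ)) := by ring
      _ = c₀ * k ^ β := by rw [← Real.rpow_add hk, add_sub_cancel]

/-- The constants of the extremal families, in one statement for both regimes. -/
theorem exists_extremal_family {α p q : ℝ} (hα0 : 0 < α) (hα1 : α < 1) (hp1 : 1 < p)
    (hpα : p < 1 / α) (hq : q = p / (1 - α * p)) :
    ∃ c D σ : ℝ, 0 < c ∧ 0 < D ∧ 0 < σ ∧ ∀ L : ℝ, 1 ≤ L → ∃ w, MemAMinus p q w ∧
      charMinus p q w ≤ ENNReal.ofReal (D * L ^ σ) ∧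
      ENNReal.ofReal (c * L ^ (σ * ((1 - α) * max 1 (conjExp p / q)))) ≤
        wOpNorm (rlPotential α) p (fun x => w x ^ p) q (fun x => w x ^ q) := by
  obtain ⟨hq1, -⟩ := exponent_relations hα0 hp1 hpα hq
  have hp'0 : 0 < conjExp p := (Real.HolderConjugate.conjExponent hp1).symm.pos
  have hq0 : 0 < q := by linarith
  have hp0 : 0 < p := by linarith
  rcases le_total q (conjExp p) with h | h
  · refine ⟨(p / q) ^ (1 / q) / 1 ^ (1 / p), 8 ^ (1 + q / conjExp p), q / conjExp p,
      by positivity, by positivity, by positivity, fun L hL => ?_⟩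
    have hL0 : 0 < L := by linarith
    have h1 := exists_extremal_of_le hα0 hα1 hp1 hpα hq h (inv_pos.2 hL0) (inv_le_one_of_one_le₀ hL)
    rw [max_eq_right ((one_le_div hq0).2 h),
      show q / conjExp p * ((1 - α) * (conjExp p / q)) = 1 - α by field_simp]
    rwa [inv_inv] at h1
  · refine ⟨((2 ^ (α - 1)) ^ q * Real.exp (-1)) ^ (1 / q) / (q / p) ^ (1 / p),
      8 ^ (1 + q / conjExp p), 1, by positivity, by positivity, one_pos, fun L hL => ?_⟩
    have hL0 : 0 < L := by linarith
    have h1 := exists_extremal_of_ge hα0 hα1 hp1 hpα hq h (inv_pos.2 hL0) (inv_le_one_of_one_le₀ hL)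
    rw [max_eq_left ((div_le_one hq0).2 h), mul_one, one_mul]
    rwa [inv_inv] at h1

/-! ### Reflection -/

theorem wLpNorm_comp_neg (p : ℝ) (v f : ℝ → ℝ) :
    wLpNorm p (fun x => v (-x)) (fun x => f (-x)) = wLpNorm p v f := by
  rw [wLpNorm, wLpNorm, lintegral_neg_eq_self fun x => ENNReal.ofReal (|f x| ^ p * v x)]

theorem MemWLp.comp_neg {p : ℝ} {v f : ℝ → ℝ} (h : MemWLp p v f) :
    MemWLp p (fun x => v (-x)) (fun x => f (-x)) :=
  ⟨h.1.comp_quasiMeasurePreserving (Measure.measurePreserving_neg volume).quasiMeasurePreserving,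
    by rw [wLpNorm_comp_neg]; exact h.2⟩

theorem memWLp_comp_neg_iff {p : ℝ} {v f : ℝ → ℝ} :
    MemWLp p (fun x => v (-x)) (fun x => f (-x)) ↔ MemWLp p v f :=
  ⟨fun h => by simpa only [neg_neg] using h.comp_neg, MemWLp.comp_neg⟩

theorem charPlus_eq_charMinus_comp_neg (p q : ℝ) (w : ℝ → ℝ) :
    charPlus p q w = charMinus p q fun x => w (-x) := by
  have h1 : ∀ (a b r : ℝ), ∫⁻ t in Ioc a b, ENNReal.ofReal (w (-t) ^ r) =
      ∫⁻ t in Ioc (-b) (-a), ENNReal.ofReal (w t ^ r) := by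
    intro a b r
    rw [setLIntegral_congr Ioo_ae_eq_Ioc.symm, setLIntegral_congr Ioo_ae_eq_Ioc.symm,
      setLIntegral_Ioo_neg]
  refine (Equiv.neg ℝ).iSup_congr fun x => iSup_congr fun h => iSup_congr fun _ => ?_
  rw [h1, h1]
  simp only [Equiv.neg_apply, neg_add_rev, neg_neg, neg_sub]
  rw [neg_add_eq_sub, sub_neg_eq_add, add_comm h x]

theorem IsWeight.comp_neg {w : ℝ → ℝ} (h : IsWeight w) : IsWeight fun x => w (-x) := by
  refine ⟨?_, (Measure.measurePreserving_neg volume).quasiMeasurePreserving.ae h.ae_pos⟩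
  have h1 := (locallyIntegrable_map_homeomorph (Homeomorph.neg ℝ) (f := w) (μ := volume)).1
  have h2 : Measure.map (Homeomorph.neg ℝ) (volume : Measure ℝ) = volume :=
    (Measure.measurePreserving_neg volume).map_eq
  rw [h2] at h1
  exact h1 h.locallyIntegrable

theorem MemAPlus.comp_neg {p q : ℝ} {w : ℝ → ℝ} (h : MemAPlus p q w) :
    MemAMinus p q fun x => w (-x) :=
  ⟨h.1.comp_neg, by rw [← charPlus_eq_charMinus_comp_neg]; exact h.2⟩

theorem MemAMinus.comp_neg {p q : ℝ} {w : ℝ → ℝ} (h : MemAMinus p q w) :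
    MemAPlus p q fun x => w (-x) :=
  ⟨h.1.comp_neg, by rw [charPlus_eq_charMinus_comp_neg]; simpa only [neg_neg] using h.2⟩

theorem weylPotential_eq (α : ℝ) (f : ℝ → ℝ) :
    weylPotential α f = fun x => rlPotential α (fun t => f (-t)) (-x) := by
  funext x
  have h := integral_comp_neg_Iic (-x) fun t => f t / (t - x) ^ (1 - α)
  rw [neg_neg] at h
  rw [weylPotential, rlPotential, ← h, integral_Iic_eq_integral_Iio]
  refine setIntegral_congr_fun measurableSet_Iio fun t _ => ?_
  rw [neg_sub_comm]

theorem weylDefined_of_comp_neg {α : ℝ} {f : ℝ → ℝ} (h : RLDefined α fun t => f (-t)) :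
    WeylDefined α f := by
  have h1 := (Measure.measurePreserving_neg (volume : Measure ℝ)).quasiMeasurePreserving.ae h
  refine h1.mono fun x hx => ?_
  rw [← (Measure.measurePreserving_neg (volume : Measure ℝ)).integrableOn_comp_preimage
    (MeasurableEquiv.neg ℝ).measurableEmbedding]
  have e : Neg.neg ⁻¹' Ioi x = Iio (-x) := by simp
  rw [e]
  refine hx.congr_fun (fun t _ => ?_) measurableSet_Iio
  simp only [Function.comp_apply]
  rw [neg_sub_comm]

theorem wOpNorm_weylPotential (α p q : ℝ) (u v : ℝ → ℝ) :
    wOpNorm (weylPotential α) p u q v =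
      wOpNorm (rlPotential α) p (fun x => u (-x)) q (fun x => v (-x)) := by
  refine Function.Surjective.iSup_congr (fun (f : ℝ → ℝ) x => f (-x))
    (fun f => ⟨fun x => f (-x), by simp only [neg_neg]⟩) fun f => ?_
  rw [memWLp_comp_neg_iff, wLpNorm_comp_neg]
  refine iSup_congr fun _ => iSup_congr fun _ => ?_
  rw [weylPotential_eq, ← wLpNorm_comp_neg q v]
  simp only [neg_neg]

/-! ### The operator norm -/

theorem wOpNorm_rlPotential_le {α p q : ℝ} (hα0 : 0 < α) (hα1 : α < 1) (hp1 : 1 < p)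
    (hpα : p < 1 / α) (hq : q = p / (1 - α * p)) :
    ∃ c : ℝ, 0 < c ∧ ∀ w : ℝ → ℝ, MemAMinus p q w →
      (∀ f : ℝ → ℝ, MemWLp p (fun x => w x ^ p) f →
        RLDefined α f ∧ MemWLp q (fun x => w x ^ q) (rlPotential α f)) ∧
      wOpNorm (rlPotential α) p (fun x => w x ^ p) q (fun x => w x ^ q) ≤
        ENNReal.ofReal c * charMinus p q w ^ ((1 - α) * max 1 (conjExp p / q)) := by
  obtain ⟨C, hC, hbound⟩ := rlPotential_bound hα0 hα1 hp1 hpα hq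
  have hβ : 0 ≤ (1 - α) * max 1 (conjExp p / q) :=
    mul_nonneg (by linarith) (zero_le_one.trans (le_max_left _ _))
  refine ⟨C.toReal + 1, by positivity, fun w hw => ⟨fun f hf => ?_, ?_⟩⟩
  · obtain ⟨h1, h2, h3⟩ := hbound w hw f hf
    refine ⟨h1, h2, h3.trans_lt ?_⟩
    exact ENNReal.mul_lt_top (ENNReal.mul_lt_top hC.lt_top
      (ENNReal.rpow_lt_top_of_nonneg hβ hw.2.ne)) hf.2
  · refine iSup_le fun f => iSup_le fun hf => iSup_le fun hf1 => ?_
    obtain ⟨-, -, h3⟩ := hbound w hw f hf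
    calc wLpNorm q (fun x => w x ^ q) (rlPotential α f)
        ≤ C * charMinus p q w ^ ((1 - α) * max 1 (conjExp p / q)) * 1 :=
          h3.trans (mul_le_mul_right hf1 _)
      _ ≤ ENNReal.ofReal (C.toReal + 1) *
          charMinus p q w ^ ((1 - α) * max 1 (conjExp p / q)) := by
          rw [mul_one]
          refine mul_le_mul_left ?_ _
          rw [← ENNReal.ofReal_toReal hC]
          exact ENNReal.ofReal_le_ofReal (by simp)

theorem theorem3p3 (α p q : ℝ) (hα0 : 0 < α) (hα1 : α < 1) (hp1 : 1 < p) (hpα : p < 1 / α)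
    (hq : q = p / (1 - α * p)) :
    ((∃ c : ℝ, 0 < c ∧ ∀ w : ℝ → ℝ, MemAMinus p q w →
        (∀ f : ℝ → ℝ, MemWLp p (fun x => w x ^ p) f →
          RLDefined α f ∧ MemWLp q (fun x => w x ^ q) (rlPotential α f)) ∧
        wOpNorm (rlPotential α) p (fun x => w x ^ p) q (fun x => w x ^ q) ≤
          ENNReal.ofReal c * charMinus p q w ^ ((1 - α) * max 1 (conjExp p / q))) ∧
      IsSharpExponent (MemAMinus p q)
        (fun w => wOpNorm (rlPotential α) p (fun x => w x ^ p) q (fun x => w x ^ q))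
        (charMinus p q) ((1 - α) * max 1 (conjExp p / q))) ∧
    ((∃ c : ℝ, 0 < c ∧ ∀ w : ℝ → ℝ, MemAPlus p q w →
        (∀ f : ℝ → ℝ, MemWLp p (fun x => w x ^ p) f →
          WeylDefined α f ∧ MemWLp q (fun x => w x ^ q) (weylPotential α f)) ∧
        wOpNorm (weylPotential α) p (fun x => w x ^ p) q (fun x => w x ^ q) ≤
          ENNReal.ofReal c * charPlus p q w ^ ((1 - α) * max 1 (conjExp p / q))) ∧
      IsSharpExponent (MemAPlus p q)
        (fun w => wOpNorm (weylPotential α) p (fun x => w x ^ p) q (fun x => w x ^ q))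
        (charPlus p q) ((1 - α) * max 1 (conjExp p / q))) := by
  obtain ⟨hq1, -⟩ := exponent_relations hα0 hp1 hpα hq
  have hβ : 0 < (1 - α) * max 1 (conjExp p / q) :=
    mul_pos (by linarith) (zero_lt_one.trans_le (le_max_left _ _))
  obtain ⟨b, hb, hbound⟩ := wOpNorm_rlPotential_le hα0 hα1 hp1 hpα hq
  obtain ⟨c, D, σ, hc, hD, hσ, hfam⟩ := exists_extremal_family hα0 hα1 hp1 hpα hq
  have hweyl : ∀ w : ℝ → ℝ, MemAPlus p q w →
      (∀ f : ℝ → ℝ, MemWLp p (fun x => w x ^ p) f →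
        WeylDefined α f ∧ MemWLp q (fun x => w x ^ q) (weylPotential α f)) ∧
      wOpNorm (weylPotential α) p (fun x => w x ^ p) q (fun x => w x ^ q) ≤
        ENNReal.ofReal b * charPlus p q w ^ ((1 - α) * max 1 (conjExp p / q)) := by
    intro w hw
    obtain ⟨h1, h2⟩ := hbound _ hw.comp_neg
    rw [wOpNorm_weylPotential, charPlus_eq_charMinus_comp_neg]
    refine ⟨fun f hf => ?_, h2⟩
    obtain ⟨h3, h4⟩ := h1 _ hf.comp_neg
    refine ⟨weylDefined_of_comp_neg h3, ?_⟩
    rw [weylPotential_eq]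
    simpa only [neg_neg] using h4.comp_neg
  refine ⟨⟨⟨b, hb, hbound⟩, ?_⟩, ⟨b, hb, hweyl⟩, ?_⟩
  · exact isSharpExponent_of_family hβ hσ hc hD ENNReal.ofReal_ne_top (fun w hw => hw.2)
      (fun w hw => (hbound w hw).2) hfam
  · refine isSharpExponent_of_family hβ hσ hc hD ENNReal.ofReal_ne_top (fun w hw => hw.2)
      (fun w hw => (hweyl w hw).2) fun L hL => ?_
    obtain ⟨w, hw, h1, h2⟩ := hfam L hL
    refine ⟨fun x => w (-x), hw.comp_neg, ?_, ?_⟩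
    · rw [charPlus_eq_charMinus_comp_neg]
      simpa only [neg_neg] using h1
    · rw [wOpNorm_weylPotential]
      simpa only [neg_neg] using h2
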